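/- Let $A$ and $B$ be hyperbolic groups, $G=A*B$, and let $S_A$, $S_B$ be finite generating sets of $A$, $B$. Write $\overline{A}=A\sqcup\partial A$ for the vertex set of the Cayley graph of $A$ with respect to $S_A$ together with its Gromov boundary (equivalence classes of geodesic rays), with the usual topology of the Gromov compactification (vertices are isolated); similarly $\overline B=B\sqcup\partial B$, using $S_B$. Let $T$ be the Bass–Serre tree of $A*B$: its vertices are the cosets $gA$ and $gB$ ($g\in G$), and each $g\in G$ gives an edge joining $gA$ to $gB$. Let $\partial T$ be the set of ends of $T$ (geodesic rays of $T$, two rays being identified when they coincide after deleting finite initial parts). Let $$\delta_{Stab}\Gamma=\big(G\times(\partial A\sqcup\partial B)\big)/\!\sim,$$ where $(g_1,\xi_1)\sim(g_2,\xi_2)$ if either $\xi_1,\xi_2\in\partial A$, $g_2^{-1}g_1\in A$ and $g_2^{-1}g_1\xi_1=\xi_2$, or the same holds with $B$ in place of $A$. Put $\delta\Gamma=\delta_{Stab}\Gamma\sqcup\partial T$, with the action of $G$ given by $g'\cdot[g,\xi]=[g'g,\xi]$ on $\delta_{Stab}\Gamma$ and the action induced from that on $T$ on $\partial T$. Let $p:\delta\Gamma\to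 V(T)\cup\partial T$ send $[g,\xi]$ to $gA$ if $\xi\in\partial A$ and to $gB$ if $\xi\in\partial B$, and be the identity on $\partial T$. Fix a vertex $v_0$ of $T$. Topologize $\delta\Gamma$ by the following bases of neighbourhoods. * For $\xi\in\partial A$, the point $[g,\xi]$ has the basic neighbourhoods $V_{gU}$, where $U$ runs through the open neighbourhoods of $\xi$ in $\overline A$: the set $V_{gU}$ consists of the points $[g,\zeta]$ with $\zeta\in U\cap\partial A$ and of all $z$ with $p(z)\neq gA$ such that the geodesic in $T$ from $gA$ to $p(z)$ starts with the edge joining $gA=gaA$ to $gaB$ for some $a\in A\cap U$. For $\xi\in\partial B$ the definition is the same with the roles of $A$ and $B$ exchanged. * A point $\eta\in\partial T$ has the basic neighbourhoods $V_n(\eta)$, $n\ge 1$: the set $V_n(\eta)$ consists of all $z$ such that the geodesic in $T$ from $v_0$ to $p(z)$ has the same first $n$ edges as the geodesic ray $[v_0,\eta)$ and $p(z)$ is not the vertex of that ray at distance $n$ from $v_0$. (This is the topology induced on $\delta\Gamma$ from the compactification $\overline\Gamma=\Gamma\sqcup\delta\Gamma$ of the tree $\Gamma$ of Cayley graphs obtained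 from $T$ by blowing up its vertices to copies of the Cayley graphs of $A$ and $B$.) Then $\delta\Gamma$ is a compact metrizable space. Moreover $G$ is a hyperbolic group, and $\delta\Gamma$ is $G$-equivariantly homeomorphic to the Gromov boundary $\partial G$ of $G$, computed with respect to any finite generating set of $G$. -/

import Mathlib

open scoped Monoid.Coprod

noncomputable section

namespace FreeProd

universe u v w

/-! ### Actions on graphs -/

/-- The group `G` acts on the graph `X` by graph automorphisms. -/
class IsGraphAction (G : Type u) {V : Type v} [Group G] [MulAction G V]
    (X : SimpleGraph V) : Prop where
  adj_smul : ∀ (g : G) {x y : V}, X.Adj x y → X.Adj (g • x) (g • y)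

section Graph

variable {V : Type v} (X : SimpleGraph V)

theorem edist_smul_le {G : Type u} [Group G] [MulAction G V] [IsGraphAction G X]
    (g : G) (x y : V) : X.edist (g • x) (g • y) ≤ X.edist x y := by
  by_cases h : X.edist x y = ⊤
  · rw [h]; exact le_top
  · obtain ⟨p, hp⟩ := X.exists_walk_of_edist_ne_top h
    let f : X →g X := ⟨fun z => g • z, fun h => IsGraphAction.adj_smul g h⟩
    rw [← hp, ← SimpleGraph.Walk.length_map f p]
    exact SimpleGraph.edist_le (p.map f)

theorem edist_smul {G : Type u} [Group G] [MulAction G V] [IsGraphAction G X]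
    (g : G) (x y : V) : X.edist (g • x) (g • y) = X.edist x y := by
  refine le_antisymm (edist_smul_le X g x y) ?_
  have h := edist_smul_le X g⁻¹ (g • x) (g • y)
  simpa using h

theorem dist_smul {G : Type u} [Group G] [MulAction G V] [IsGraphAction G X]
    (g : G) (x y : V) : X.dist (g • x) (g • y) = X.dist x y := by
  unfold SimpleGraph.dist
  rw [edist_smul]

/-! ### Geodesic rays, ends, the Gromov boundary and its topology -/

/-- A geodesic ray in a graph: a sequence of vertices with `d(ρ i, ρ j) = j - i` for `i ≤ j`. -/
@[ext]
structure GeodesicRay where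
  toFun : ℕ → V
  isGeodesic : ∀ i j : ℕ, i ≤ j → X.dist (toFun i) (toFun j) = j - i

instance : CoeFun (GeodesicRay X) (fun _ => ℕ → V) := ⟨GeodesicRay.toFun⟩

instance {G : Type u} [Group G] [MulAction G V] [IsGraphAction G X] :
    MulAction G (GeodesicRay X) where
  smul g ρ := ⟨fun n => g • ρ n, fun i j h => by rw [dist_smul]; exact ρ.isGeodesic i j h⟩
  one_smul ρ := by
    apply GeodesicRay.ext
    funext n
    exact one_smul G (ρ n)
  mul_smul g h ρ := by
    apply GeodesicRay.ext
    funext n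
    exact mul_smul g h (ρ n)

theorem GeodesicRay.smul_apply {G : Type u} [Group G] [MulAction G V] [IsGraphAction G X]
    (g : G) (ρ : GeodesicRay X) (n : ℕ) : (g • ρ) n = g • ρ n := rfl

/-- Two geodesic rays are asymptotic if they remain at finite distance from one another. -/
def asymptotic : Setoid (GeodesicRay X) where
  r ρ σ := ∃ C : ℕ, ∀ n, X.edist (ρ n) (σ n) ≤ C
  iseqv :=
    { refl := fun ρ => ⟨0, fun n => by simp⟩
      symm := fun ⟨C, hC⟩ => ⟨C, fun n => by rw [SimpleGraph.edist_comm]; exact hC n⟩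
      trans := fun ⟨C, hC⟩ ⟨D, hD⟩ => ⟨C + D, fun n =>
        (SimpleGraph.edist_triangle).trans (by push_cast; exact add_le_add (hC n) (hD n))⟩ }

/-- Two geodesic rays are cofinal if they coincide after deleting bounded initial parts. -/
def cofinal : Setoid (GeodesicRay X) where
  r ρ σ := ∃ m n : ℕ, ∀ k, ρ (m + k) = σ (n + k)
  iseqv :=
    { refl := fun ρ => ⟨0, 0, fun k => rfl⟩
      symm := fun ⟨m, n, h⟩ => ⟨n, m, fun k => (h k).symm⟩
      trans := fun ⟨m, n, h⟩ ⟨m', n', h'⟩ => ⟨m + m', n' + n, fun k => by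
        rw [add_assoc, h, add_assoc, ← h', ← add_assoc, ← add_assoc, add_comm n m']⟩ }

/-- The Gromov boundary of a graph: geodesic rays up to bounded distance. -/
def GromovBoundary : Type v := Quotient (asymptotic X)

/-- The set of ends of a tree: geodesic rays up to deletion of initial parts. -/
def Ends : Type v := Quotient (cofinal X)

variable {X} in
/-- The point at infinity represented by a geodesic ray. -/
def GeodesicRay.limit (ρ : GeodesicRay X) : GromovBoundary X := Quotient.mk (asymptotic X) ρ

variable {X} in
/-- The end (of a tree) represented by a geodesic ray. -/
def GeodesicRay.end' (ρ : GeodesicRay X) : Ends X := Quotient.mk (cofinal X) ρ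

instance {G : Type u} [Group G] [MulAction G V] [IsGraphAction G X] :
    MulAction G (GromovBoundary X) where
  smul g := Quotient.map (fun ρ => g • ρ) (fun ρ σ ⟨C, hC⟩ =>
    ⟨C, fun n => by
      rw [GeodesicRay.smul_apply, GeodesicRay.smul_apply, edist_smul]; exact hC n⟩)
  one_smul := by
    rintro ⟨ρ⟩
    exact congrArg (Quotient.mk (asymptotic X)) (one_smul G ρ)
  mul_smul := by
    rintro g h ⟨ρ⟩
    exact congrArg (Quotient.mk (asymptotic X)) (mul_smul g h ρ)

instance {G : Type u} [Group G] [MulAction G V] [IsGraphAction G X] :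
    MulAction G (Ends X) where
  smul g := Quotient.map (fun ρ => g • ρ) (fun _ _ ⟨m, n, h⟩ =>
    ⟨m, n, fun k => congrArg (fun x => g • x) (h k)⟩)
  one_smul := by
    rintro ⟨ρ⟩
    exact congrArg (Quotient.mk (cofinal X)) (one_smul G ρ)
  mul_smul := by
    rintro g h ⟨ρ⟩
    exact congrArg (Quotient.mk (cofinal X)) (mul_smul g h ρ)

/-- The vertex set of a graph together with its Gromov boundary. -/
inductive Bordification : Type v
  | vertex (x : V) : Bordification
  | bdry (ξ : GromovBoundary X) : Bordification

/-- The Gromov product `(x | y)_o` in the graph metric. -/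
def gromovProd (o x y : V) : ℝ := ((X.dist o x : ℝ) + X.dist o y - X.dist x y) / 2

/-- A vertex is represented by the constant sequence, a boundary point by each geodesic ray in its
class. -/
def Represents (s : ℕ → V) : Bordification X → Prop
  | .vertex x => ∀ n, s n = x
  | .bdry ξ => ∃ ρ : GeodesicRay X, ρ.limit = ξ ∧ ∀ n, s n = ρ n

/-- The set of points `z` with `(ξ | z)_o ≥ R`, where the Gromov product is extended to boundary
points by `sup liminf (s i | t j)_o` over representing sequences (the extensions in use in a
hyperbolic graph differ by bounded amounts, and the topology below does not depend on the choice). -/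
def gromovNhd (o : V) (ξ : GromovBoundary X) (R : ℝ) : Set (Bordification X) :=
  {z | ∃ s t : ℕ → V, Represents X s (.bdry ξ) ∧ Represents X t z ∧
    ∃ N, ∀ i ≥ N, ∀ j ≥ N, R ≤ gromovProd X o (s i) (t j)}

variable {X} in
theorem gromovNhd_anti (o : V) (ξ : GromovBoundary X) {R R' : ℝ} (h : R ≤ R') :
    gromovNhd X o ξ R' ⊆ gromovNhd X o ξ R := by
  rintro z ⟨s, t, hs, ht, N, hN⟩
  exact ⟨s, t, hs, ht, N, fun i hi j hj => h.trans (hN i hi j hj)⟩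

/-- The topology of the Gromov compactification (of the vertex set): vertices are isolated, and the
sets `{z | (ξ | z)_o ≥ R}` form a neighbourhood basis of the boundary point `ξ`. -/
instance : TopologicalSpace (Bordification X) where
  IsOpen U := ∀ ξ, Bordification.bdry ξ ∈ U → ∀ o : V, ∃ R : ℝ, gromovNhd X o ξ R ⊆ U
  isOpen_univ := fun _ _ _ => ⟨0, Set.subset_univ _⟩
  isOpen_inter := by
    intro U U' hU hU' ξ hξ o
    obtain ⟨R, hR⟩ := hU ξ hξ.1 o
    obtain ⟨R', hR'⟩ := hU' ξ hξ.2 o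
    exact ⟨max R R', Set.subset_inter
      ((gromovNhd_anti o ξ (le_max_left _ _)).trans hR)
      ((gromovNhd_anti o ξ (le_max_right _ _)).trans hR')⟩
  isOpen_sUnion := by
    intro S hS ξ ⟨U, hU, hξ⟩ o
    obtain ⟨R, hR⟩ := hS U hU ξ hξ o
    exact ⟨R, hR.trans (Set.subset_sUnion_of_mem hU)⟩

/-- The Gromov boundary carries the topology induced from the compactification. -/
instance : TopologicalSpace (GromovBoundary X) :=
  TopologicalSpace.induced Bordification.bdry inferInstance

/-- Gromov's hyperbolicity condition for a connected graph with its path metric. -/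
def IsHyperbolicGraph : Prop :=
  X.Connected ∧ ∃ δ : ℝ, ∀ o x y z : V,
    min (gromovProd X o x y) (gromovProd X o y z) - δ ≤ gromovProd X o x z

end Graph

/-! ### Hyperbolic groups -/

/-- A group is hyperbolic if its Cayley graph for some finite generating set is hyperbolic. -/
def IsHyperbolicGroup (G : Type u) [Group G] : Prop :=
  ∃ S : Set G, S.Finite ∧ Subgroup.closure S = ⊤ ∧ IsHyperbolicGraph (SimpleGraph.mulCayley S)

/-- A group acts on its Cayley graphs by left multiplication. -/
instance {G : Type u} [Group G] (S : Set G) : IsGraphAction G (SimpleGraph.mulCayley S) where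
  adj_smul _ _ _ h := SimpleGraph.mulCayley_adj_mul_iff_right.2 h

/-! ### Induced `G`-sets -/

section Induced

variable {G : Type u} {H : Type v} [Group G] [Group H] (φ : H →* G)
  (Y : Type w) [MulAction H Y]

/-- `(g₁, y₁) ~ (g₂, y₂)` if `g₂⁻¹ g₁` lies in (the image of) `H` and `g₂⁻¹ g₁ y₁ = y₂`. -/
def inducedSetoid : Setoid (G × Y) where
  r a b := ∃ h : H, φ h = b.1⁻¹ * a.1 ∧ h • a.2 = b.2
  iseqv :=
    { refl := fun a => ⟨1, by simp, by simp⟩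
      symm := fun ⟨h, h1, h2⟩ => ⟨h⁻¹, by simp [h1], by rw [← h2, inv_smul_smul]⟩
      trans := fun ⟨h, h1, h2⟩ ⟨k, k1, k2⟩ => ⟨k * h, by
        rw [map_mul, h1, k1]; group, by rw [mul_smul, h2, k2]⟩ }

/-- The `G`-set `(G × Y) / ~` induced from the `H`-set `Y`. -/
def Induced : Type (max u w) := Quotient (inducedSetoid φ Y)

variable {Y} in
/-- The class `[g, y]`. -/
def Induced.mk (g : G) (y : Y) : Induced φ Y := Quotient.mk (inducedSetoid φ Y) (g, y)

/-- The action `g' • [g, y] = [g' g, y]`. -/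
instance : MulAction G (Induced φ Y) where
  smul g' := Quotient.map (fun a => (g' * a.1, a.2)) (fun a b ⟨h, h1, h2⟩ =>
    ⟨h, by rw [h1]; group, h2⟩)
  one_smul := by
    rintro ⟨g, y⟩
    exact congrArg (fun g => Induced.mk φ g y) (one_mul g)
  mul_smul := by
    rintro g g' ⟨g'', y⟩
    exact congrArg (fun g => Induced.mk φ g y) (mul_assoc g g' g'')

variable {φ Y} in
/-- The projection `[g, y] ↦ g H`. -/
def Induced.proj : Induced φ Y → G ⧸ φ.range :=
  Quotient.lift (fun a => (a.1 : G ⧸ φ.range)) (fun _ _ ⟨h, h1, _⟩ =>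
    (QuotientGroup.eq.2 (MonoidHom.mem_range.2 ⟨h, h1⟩)).symm)

end Induced

/-! ### The Bass–Serre tree of `A ∗ B` -/

section BassSerre

variable (A : Type u) (B : Type v) [Group A] [Group B]

/-- Vertices of the Bass–Serre tree: cosets of `A` and cosets of `B` in `A ∗ B`. -/
abbrev TreeVertex : Type (max u v) :=
  ((A ∗ B) ⧸ (Monoid.Coprod.inl : A →* A ∗ B).range) ⊕
    ((A ∗ B) ⧸ (Monoid.Coprod.inr : B →* A ∗ B).range)

variable {A B}

/-- The vertex `[g, v_A]`. -/
def vertexA (g : A ∗ B) : TreeVertex A B := Sum.inl (g : (A ∗ B) ⧸ _)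

/-- The vertex `[g, v_B]`. -/
def vertexB (g : A ∗ B) : TreeVertex A B := Sum.inr (g : (A ∗ B) ⧸ _)

variable (A B)

/-- The Bass–Serre tree: for every `g` the vertices `[g, v_A]` and `[g, v_B]` are joined by an
edge `[g, τ]`. -/
def tree : SimpleGraph (TreeVertex A B) where
  Adj x y := ∃ g : A ∗ B, (x = vertexA g ∧ y = vertexB g) ∨ (x = vertexB g ∧ y = vertexA g)
  symm := ⟨fun _ _ ⟨g, h⟩ => ⟨g, by tauto⟩⟩
  loopless := ⟨fun x ⟨g, h⟩ => by
    rcases h with ⟨h, h'⟩ | ⟨h, h'⟩ <;> (rw [h] at h'; cases h')⟩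

instance : IsGraphAction (A ∗ B) (tree A B) where
  adj_smul := by
    rintro k x y ⟨g, ⟨rfl, rfl⟩ | ⟨rfl, rfl⟩⟩
    · exact ⟨k * g, Or.inl ⟨rfl, rfl⟩⟩
    · exact ⟨k * g, Or.inr ⟨rfl, rfl⟩⟩

variable {A B}

/-- `OnGeodesic x y z`: the vertex `z` lies on the geodesic of the Bass–Serre tree from the vertex
`x` to the point `y`, where `y` is a vertex or an end. -/
def OnGeodesic (x : TreeVertex A B) : TreeVertex A B ⊕ Ends (tree A B) → TreeVertex A B → Prop
  | .inl y, z => (tree A B).dist x z + (tree A B).dist z y = (tree A B).dist x y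
  | .inr η, z => ∃ r : GeodesicRay (tree A B), r 0 = x ∧ r.end' = η ∧ ∃ n, r n = z

end BassSerre

/-! ### The space `δΓ` -/

section Boundary

variable {A : Type u} {B : Type v} [Group A] [Group B] (SA : Set A) (SB : Set B)
  (v₀ : TreeVertex A B)

/-- `δΓ = δ_Stab Γ ⊔ ∂T`, where `δ_Stab Γ = (G × (∂A ⊔ ∂B)) / ~`. The parameter `v₀` is only used in
the topology. -/
def DeltaGamma (_v₀ : TreeVertex A B) : Type (max u v) :=
  (Induced (Monoid.Coprod.inl : A →* A ∗ B) (GromovBoundary (SimpleGraph.mulCayley SA)) ⊕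
    Induced (Monoid.Coprod.inr : B →* A ∗ B) (GromovBoundary (SimpleGraph.mulCayley SB))) ⊕
  Ends (tree A B)

instance : MulAction (A ∗ B) (DeltaGamma SA SB v₀) :=
  inferInstanceAs (MulAction (A ∗ B)
    ((Induced (Monoid.Coprod.inl : A →* A ∗ B) (GromovBoundary (SimpleGraph.mulCayley SA)) ⊕
      Induced (Monoid.Coprod.inr : B →* A ∗ B) (GromovBoundary (SimpleGraph.mulCayley SB))) ⊕
    Ends (tree A B)))

variable (A B) in
/-- The vertices `(G × (A ⊔ B)) / ~` of the tree of Cayley graphs `Γ`. -/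
abbrev GammaVertex : Type (max u v) :=
  Induced (Monoid.Coprod.inl : A →* A ∗ B) A ⊕ Induced (Monoid.Coprod.inr : B →* A ∗ B) B

/-- The vertex set of `Γ` together with the boundary `δΓ`. -/
inductive GammaBar : Type (max u v)
  | vertex (x : GammaVertex A B) : GammaBar
  | bdry (z : DeltaGamma SA SB v₀) : GammaBar

/-- The projection `p` to the tree and its ends. -/
def GammaBar.p : GammaBar SA SB v₀ → TreeVertex A B ⊕ Ends (tree A B)
  | .vertex (.inl x) => .inl (.inl x.proj)
  | .vertex (.inr x) => .inl (.inr x.proj)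
  | .bdry (.inl (.inl ξ)) => .inl (.inl ξ.proj)
  | .bdry (.inl (.inr ξ)) => .inl (.inr ξ.proj)
  | .bdry (.inr η) => .inr η

/-- For `v = [g, v_A]`, the identification `x ↦ [g, x]` of the compactified Cayley graph of `A` with
the preimage of `v`. -/
def incA (g : A ∗ B) : Bordification (SimpleGraph.mulCayley SA) → GammaBar SA SB v₀
  | .vertex a => .vertex (.inl (Induced.mk _ g a))
  | .bdry ξ => .bdry (.inl (.inl (Induced.mk _ g ξ)))

/-- For `v = [g, v_B]`, the identification `x ↦ [g, x]` of the compactified Cayley graph of `B` with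
the preimage of `v`. -/
def incB (g : A ∗ B) : Bordification (SimpleGraph.mulCayley SB) → GammaBar SA SB v₀
  | .vertex b => .vertex (.inr (Induced.mk _ g b))
  | .bdry ξ => .bdry (.inl (.inr (Induced.mk _ g ξ)))

/-- The set `V_{gU}` for `v = [g, v_A]` and a subset `U` of the compactified Cayley graph of `A`: the
translate `gU` together with all `z` with `p z ≠ v` for which the geodesic from `v` to `p z` starts
with an edge whose lift is attached at a point of `gU`. The edges of the tree at `v` are the
`[g a, τ]` with `a ∈ A`; the other endpoint of such an edge is `[g a, v_B]`, and its lift is attached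
at the vertex `[g a, 1] = [g, a]`. -/
def nhdA (g : A ∗ B) (U : Set (Bordification (SimpleGraph.mulCayley SA))) :
    Set (GammaBar SA SB v₀) :=
  incA SA SB v₀ g '' U ∪
    {z | z.p ≠ .inl (vertexA g) ∧ ∃ a : A, Bordification.vertex a ∈ U ∧
      OnGeodesic (vertexA g) z.p (vertexB (g * Monoid.Coprod.inl a))}

/-- The set `V_{gU}` for `v = [g, v_B]` and a subset `U` of the compactified Cayley graph of `B`. -/
def nhdB (g : A ∗ B) (U : Set (Bordification (SimpleGraph.mulCayley SB))) :
    Set (GammaBar SA SB v₀) :=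
  incB SA SB v₀ g '' U ∪
    {z | z.p ≠ .inl (vertexB g) ∧ ∃ b : B, Bordification.vertex b ∈ U ∧
      OnGeodesic (vertexB g) z.p (vertexA (g * Monoid.Coprod.inr b))}

/-- The set `V_n(η)`: with `r = [v₀, η)` the geodesic ray from `v₀` to the end `η`, all `z` such that
the geodesic from `v₀` to `p z` has the same first `n` edges as `r` and `p z ≠ r n`. -/
def nhdEnd (η : Ends (tree A B)) (n : ℕ) : Set (GammaBar SA SB v₀) :=
  {z | ∃ r : GeodesicRay (tree A B), r 0 = v₀ ∧ r.end' = η ∧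
    (∀ i ≤ n, OnGeodesic v₀ z.p (r i)) ∧ z.p ≠ .inl (r n)}

theorem nhdA_mono (g : A ∗ B) {U U' : Set (Bordification (SimpleGraph.mulCayley SA))}
    (h : U ⊆ U') : nhdA SA SB v₀ g U ⊆ nhdA SA SB v₀ g U' :=
  Set.union_subset_union (Set.image_mono h) (fun _ ⟨h1, a, ha, h2⟩ => ⟨h1, a, h ha, h2⟩)

theorem nhdB_mono (g : A ∗ B) {U U' : Set (Bordification (SimpleGraph.mulCayley SB))}
    (h : U ⊆ U') : nhdB SA SB v₀ g U ⊆ nhdB SA SB v₀ g U' :=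
  Set.union_subset_union (Set.image_mono h) (fun _ ⟨h1, a, ha, h2⟩ => ⟨h1, a, h ha, h2⟩)

theorem nhdEnd_anti (η : Ends (tree A B)) {m n : ℕ} (h : m ≤ n) :
    nhdEnd SA SB v₀ η n ⊆ nhdEnd SA SB v₀ η m := by
  rintro z ⟨r, h0, hη, hr, hne⟩
  refine ⟨r, h0, hη, fun i hi => hr i (hi.trans h), fun hz => hne ?_⟩
  have h1 := hr n le_rfl
  rw [hz] at h1
  have h2 := r.isGeodesic 0 n (Nat.zero_le n)
  have h3 := r.isGeodesic 0 m (Nat.zero_le m)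
  rw [h0] at h2 h3
  change (tree A B).dist v₀ (r n) + (tree A B).dist (r n) (r m) = (tree A B).dist v₀ (r m) at h1
  have h4 : m = n := by omega
  rw [hz, h4]

/-- The topology in which the vertices of `Γ` are isolated, a point `[g, ξ]` of `δ_Stab Γ` has the
basic neighbourhoods `V_{gU}` with `U` an open neighbourhood of `ξ` in the compactified Cayley graph,
and an end `η` has the basic neighbourhoods `V_n(η)`, `n ≥ 1`. -/
instance : TopologicalSpace (GammaBar SA SB v₀) where
  IsOpen W :=
    (∀ g ξ, incA SA SB v₀ g (.bdry ξ) ∈ W →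
      ∃ U, IsOpen U ∧ Bordification.bdry ξ ∈ U ∧ nhdA SA SB v₀ g U ⊆ W) ∧
    (∀ g ξ, incB SA SB v₀ g (.bdry ξ) ∈ W →
      ∃ U, IsOpen U ∧ Bordification.bdry ξ ∈ U ∧ nhdB SA SB v₀ g U ⊆ W) ∧
    (∀ η, GammaBar.bdry (.inr η) ∈ W → ∃ n ≥ 1, nhdEnd SA SB v₀ η n ⊆ W)
  isOpen_univ :=
    ⟨fun _ _ _ => ⟨Set.univ, isOpen_univ, trivial, Set.subset_univ _⟩,
      fun _ _ _ => ⟨Set.univ, isOpen_univ, trivial, Set.subset_univ _⟩,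
      fun _ _ => ⟨1, le_rfl, Set.subset_univ _⟩⟩
  isOpen_inter := by
    rintro W W' ⟨hA, hB, hE⟩ ⟨hA', hB', hE'⟩
    refine ⟨fun g ξ h => ?_, fun g ξ h => ?_, fun η h => ?_⟩
    · obtain ⟨U, hU, hξ, hW⟩ := hA g ξ h.1
      obtain ⟨U', hU', hξ', hW'⟩ := hA' g ξ h.2
      exact ⟨U ∩ U', hU.inter hU', ⟨hξ, hξ'⟩, Set.subset_inter
        ((nhdA_mono SA SB v₀ g Set.inter_subset_left).trans hW)
        ((nhdA_mono SA SB v₀ g Set.inter_subset_right).trans hW')⟩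
    · obtain ⟨U, hU, hξ, hW⟩ := hB g ξ h.1
      obtain ⟨U', hU', hξ', hW'⟩ := hB' g ξ h.2
      exact ⟨U ∩ U', hU.inter hU', ⟨hξ, hξ'⟩, Set.subset_inter
        ((nhdB_mono SA SB v₀ g Set.inter_subset_left).trans hW)
        ((nhdB_mono SA SB v₀ g Set.inter_subset_right).trans hW')⟩
    · obtain ⟨n, hn, hW⟩ := hE η h.1
      obtain ⟨n', _, hW'⟩ := hE' η h.2
      exact ⟨max n n', hn.trans (le_max_left _ _), Set.subset_inter
        ((nhdEnd_anti SA SB v₀ η (le_max_left _ _)).trans hW)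
        ((nhdEnd_anti SA SB v₀ η (le_max_right _ _)).trans hW')⟩
  isOpen_sUnion := by
    intro S hS
    refine ⟨fun g ξ ⟨W, hW, h⟩ => ?_, fun g ξ ⟨W, hW, h⟩ => ?_, fun η ⟨W, hW, h⟩ => ?_⟩
    · obtain ⟨U, hU, hξ, hU'⟩ := (hS W hW).1 g ξ h
      exact ⟨U, hU, hξ, hU'.trans (Set.subset_sUnion_of_mem hW)⟩
    · obtain ⟨U, hU, hξ, hU'⟩ := (hS W hW).2.1 g ξ h
      exact ⟨U, hU, hξ, hU'.trans (Set.subset_sUnion_of_mem hW)⟩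
    · obtain ⟨n, hn, hU'⟩ := (hS W hW).2.2 η h
      exact ⟨n, hn, hU'.trans (Set.subset_sUnion_of_mem hW)⟩

/-- `δΓ` carries the topology induced from the compactification of `Γ`. -/
instance : TopologicalSpace (DeltaGamma SA SB v₀) :=
  TopologicalSpace.induced GammaBar.bdry inferInstance

end Boundary

end FreeProd

end

/-! The group `A ∗ B` is studied through the Cayley graph for the union of `SA` and `SB`. There the
length of an element is the total length of the letters of its normal form, and distances follow by
cancelling common prefixes (`dist_one_eq`, `dist_spell`). Hence the Gromov product of two elements
at `1` is the length of their common prefix plus the product, inside one factor, of the first two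
letters that differ; it adds nothing if these belong to different factors (`gromovProd_one_eq`).
Gromov's four point condition for this product reduces to single letters (`wordProd_four_point`), so
`A ∗ B` is hyperbolic.

The same formula describes sequences going to infinity. Either their normal forms agree on longer
and longer prefixes, and the resulting infinite reduced word is a ray of the tree; or there is a
longest word `w` that is eventually a prefix, and the next letters go to infinity in one factor, so
that the limit is a point `[w, ξ]` (`exists_rep_evGe`). Conversely each point of `δΓ` has standard
sequences `Rep`, consisting of edge labels along a ray or of a translated geodesic ray of a factor.
Sending a point to the limit of its standard sequences is well defined (`Rep.evGe`), injective
(`eq_of_rep_of_evGe`) and surjective. It is equivariant because translates of standard sequences are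
standard.

For the topology, the main tool is the projection `Side.π` to a factor, the first letter of the
normal form if it lies in that factor. Metrically, `π (g⁻¹ k)` determines the Gromov products at `g`
of `k` with the points of the coset through `g` (`Side.Metric.gromovProd_mul_φ`). In the tree, it
labels the first edge from the vertex of that coset towards `k` (`Side.OnTree.onGeodesic_iff`). So
the sets `V_{gU}` are preimages of `U` under a projection to the compactified factor
(`Rep.exists_tendsTo_A`), and they cut out the same neighbourhoods as the Gromov products do
(`IsLimitMap.mem_nhds_iff`). At an end, following the ray for `n` edges and sharing an initial word
with it control each other, up to a shift by one (`RayWord.onGeodesic_of_prefix`,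
`RayWord.prefix_of_onGeodesic`).

The rest is general theory. The boundary of a proper hyperbolic graph is compact, by limits of rays
along ultrafilters, and metrizable, since Gromov products generate a countably generated uniformity.
Finite generating sets give bilipschitz metrics; by the stability of geodesics
(`FourPoint.exists_near_geodesicSeg`) the two Gromov products then control each other coarsely, so
hyperbolicity and the boundary do not depend on the generating set. -/

noncomputable section
namespace FreeProd
universe u v w

/-! ### Gromov products and geodesic segments in graphs. -/

section Graph

variable {V : Type v} {X : SimpleGraph V}

theorem dist_triangle_real (hX : X.Connected) (a b c : V) :
    (X.dist a c : ℝ) ≤ X.dist a b + X.dist b c := by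
  exact_mod_cast hX.dist_triangle

theorem gromovProd_comm (o x y : V) : gromovProd X o x y = gromovProd X o y x := by
  unfold gromovProd
  rw [X.dist_comm (u := x)]
  ring

theorem gromovProd_self (o x : V) : gromovProd X o x x = X.dist o x := by
  simp [gromovProd]

theorem gromovProd_nonneg (hX : X.Connected) (o x y : V) : 0 ≤ gromovProd X o x y := by
  have := dist_triangle_real hX x o y
  rw [X.dist_comm (u := x) (v := o)] at this
  unfold gromovProd
  linarith

theorem gromovProd_le_left (hX : X.Connected) (o x y : V) : gromovProd X o x y ≤ X.dist o x := by
  have := dist_triangle_real hX o x y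
  unfold gromovProd
  linarith

theorem gromovProd_le_right (hX : X.Connected) (o x y : V) : gromovProd X o x y ≤ X.dist o y := by
  rw [gromovProd_comm]
  exact gromovProd_le_left hX o y x

theorem gromovProd_le_of_between (hX : X.Connected) (o : V) {x p y : V}
    (h : X.dist x p + X.dist p y = X.dist x y) : gromovProd X o x y ≤ X.dist o p := by
  have h1 := dist_triangle_real hX o p x
  have h2 := dist_triangle_real hX o p y
  rw [X.dist_comm (u := p) (v := x)] at h1
  have h' : (X.dist x p : ℝ) + X.dist p y = X.dist x y := by exact_mod_cast h
  unfold gromovProd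
  linarith

theorem gromovProd_eq_zero {x p y : V}
    (h : X.dist x p + X.dist p y = X.dist x y) : gromovProd X p x y = 0 := by
  have h' : (X.dist x p : ℝ) + X.dist p y = X.dist x y := by exact_mod_cast h
  rw [X.dist_comm (u := x) (v := p)] at h'
  unfold gromovProd
  linarith

theorem gromovProd_base (hX : X.Connected) (o p x y : V) :
    gromovProd X o x y ≤ gromovProd X p x y + X.dist o p := by
  have h1 := dist_triangle_real hX o p x
  have h2 := dist_triangle_real hX o p y
  unfold gromovProd
  linarith

theorem gromovProd_smul {G : Type u} [Group G] [MulAction G V] [IsGraphAction G X]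
    (g : G) (o x y : V) : gromovProd X (g • o) (g • x) (g • y) = gromovProd X o x y := by
  simp [gromovProd, dist_smul]

/-- A sequence `c 0, …, c n` which is geodesic for the metric of the graph. -/
def IsGeodesicSeg (Y : SimpleGraph V) (c : ℕ → V) (n : ℕ) : Prop :=
  ∀ i j, i ≤ j → j ≤ n → Y.dist (c i) (c j) + i = j

/-- A geodesic segment joining two vertices of a connected graph. -/
theorem exists_geodesic (hX : X.Connected) (x y : V) :
    ∃ c : ℕ → V, c 0 = x ∧ c (X.dist x y) = y ∧ IsGeodesicSeg X c (X.dist x y) := by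
  obtain ⟨p, hp⟩ := hX.exists_walk_length_eq_dist x y
  have hstep : ∀ i k, i + k ≤ p.length → X.dist (p.getVert i) (p.getVert (i + k)) ≤ k := by
    intro i k
    induction k with
    | zero => intro _; simp
    | succ k ih =>
      intro h
      have h1 := ih (by omega)
      have h2 := SimpleGraph.dist_eq_one_iff_adj.2 (p.adj_getVert_succ (i := i + k) (by omega))
      have h3 := hX.dist_triangle (u := p.getVert i) (v := p.getVert (i + k))
        (w := p.getVert (i + k + 1))
      rw [← add_assoc]
      omega
  refine ⟨p.getVert, p.getVert_zero, by rw [← hp]; exact p.getVert_length, fun i j hij hj => ?_⟩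
  have h1 := hstep i (j - i) (by omega)
  have h2 := hstep 0 i (by omega)
  have h3 := hstep j (p.length - j) (by omega)
  rw [Nat.add_sub_cancel' hij] at h1
  rw [Nat.add_sub_cancel' (by omega), p.getVert_length] at h3
  rw [zero_add, p.getVert_zero] at h2
  have h4 := hX.dist_triangle (u := x) (v := p.getVert i) (w := y)
  have h5 := hX.dist_triangle (u := p.getVert i) (v := p.getVert j) (w := y)
  omega

theorem exists_between (hX : X.Connected) (x y : V) {k : ℕ} (hk : k ≤ X.dist x y) :
    ∃ p, X.dist x p = k ∧ X.dist x p + X.dist p y = X.dist x y := by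
  obtain ⟨c, h0, h1, h2⟩ := exists_geodesic hX x y
  have h3 := h2 0 k (Nat.zero_le _) hk
  have h4 := h2 k _ hk le_rfl
  rw [h0] at h3
  rw [h1] at h4
  exact ⟨c k, by omega, by omega⟩

theorem exists_geodesic_through (hX : X.Connected) {x p y : V}
    (hp : X.dist x p + X.dist p y = X.dist x y) :
    ∃ c : ℕ → V, c 0 = x ∧ c (X.dist x y) = y ∧ c (X.dist x p) = p ∧
      IsGeodesicSeg X c (X.dist x y) := by
  obtain ⟨a, ha0, ha1, ha2⟩ := exists_geodesic hX x p
  obtain ⟨b, hb0, hb1, hb2⟩ := exists_geodesic hX p y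
  refine ⟨fun i => if i ≤ X.dist x p then a i else b (i - X.dist x p), by simp [ha0], ?_,
    by simp [ha1], ?_⟩
  · dsimp only
    split_ifs with hle
    · have h1 : X.dist p y = 0 := by omega
      rw [hX.dist_eq_zero_iff] at h1
      have h2 : X.dist x y = X.dist x p := by rw [h1]
      rw [h2, ha1, h1]
    · rw [show X.dist x y - X.dist x p = X.dist p y by omega, hb1]
  · intro i j hij hj
    dsimp only
    split_ifs with hi' hj' hj'
    · exact ha2 i j hij hj'
    · have h1 := ha2 i _ hi' le_rfl
      have h2 := hb2 0 (j - X.dist x p) (Nat.zero_le _) (by omega)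
      have h3 := ha2 0 i (Nat.zero_le _) hi'
      have h4 := hb2 (j - X.dist x p) _ (by omega) le_rfl
      have h5 := hX.dist_triangle (u := a i) (v := p) (w := b (j - X.dist x p))
      have h6 := hX.dist_triangle (u := x) (v := a i) (w := y)
      have h7 := hX.dist_triangle (u := a i) (v := b (j - X.dist x p)) (w := y)
      rw [ha1] at h1
      rw [hb0] at h2
      rw [ha0] at h3
      rw [hb1] at h4
      omega
    · omega
    · have := hb2 (i - X.dist x p) (j - X.dist x p) (by omega) (by omega)
      omega

/-- Gromov's four point condition with constant `δ`. -/
structure FourPoint (X : SimpleGraph V) (δ : ℝ) : Prop where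
  connected : X.Connected
  nonneg : 0 ≤ δ
  min_le : ∀ o x y z : V,
    min (gromovProd X o x y) (gromovProd X o y z) - δ ≤ gromovProd X o x z

theorem IsHyperbolicGraph.fourPoint (h : IsHyperbolicGraph X) : ∃ δ, FourPoint X δ := by
  obtain ⟨hX, δ, hδ⟩ := h
  obtain ⟨o⟩ := hX.nonempty
  exact ⟨δ, hX, by simpa [gromovProd_self] using hδ o o o o, hδ⟩

theorem FourPoint.isHyperbolicGraph {δ : ℝ} (h : FourPoint X δ) : IsHyperbolicGraph X :=
  ⟨h.connected, δ, h.min_le⟩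

theorem FourPoint.le {δ R : ℝ} (h : FourPoint X δ) {o x y z : V} (h1 : R ≤ gromovProd X o x y)
    (h2 : R ≤ gromovProd X o y z) : R - δ ≤ gromovProd X o x z :=
  le_trans (sub_le_sub_right (le_min h1 h2) δ) (h.min_le o x y z)

/-- The geodesic `[x, y]` comes within `(x | y)_p + 2 δ + 1` of `p`. -/
theorem FourPoint.exists_between_dist_le {δ : ℝ} (h : FourPoint X δ) (p x y : V) :
    ∃ q, X.dist x q + X.dist q y = X.dist x y ∧
      (X.dist p q : ℝ) ≤ gromovProd X p x y + 2 * δ + 1 := by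
  have hX := h.connected
  -- The point sought is the one where the inscribed circle of the triangle touches `[x, y]`, at
  -- distance `(p | y)_x` from `x`. Rounding down to an integer costs the summand `1`.
  have hx : gromovProd X x p y ≤ X.dist x y := gromovProd_le_right hX x p y
  have hfl : ⌊gromovProd X x p y⌋₊ ≤ X.dist x y := Nat.floor_le_of_le hx
  obtain ⟨q, hq, hb⟩ := exists_between hX x y hfl
  refine ⟨q, hb, ?_⟩
  have h0 := gromovProd_nonneg hX x p y
  have h1 := Nat.floor_le h0
  have h2 := Nat.lt_floor_add_one (gromovProd X x p y)
  rw [← hq] at h1 h2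
  have h3 := h.min_le p x q y
  have hb' : (X.dist x q : ℝ) + X.dist q y = X.dist x y := by exact_mod_cast hb
  simp only [gromovProd] at *
  rw [X.dist_comm (u := x) (v := p)] at *
  rcases min_choice (((X.dist p x : ℝ) + X.dist p q - X.dist x q) / 2)
    (((X.dist p q : ℝ) + X.dist p y - X.dist q y) / 2) with hm | hm <;> rw [hm] at h3 <;> linarith

/-- Discrete connectedness of an interval covered by two sets: just before the first point of the
second set one is still in the first. It replaces continuity along geodesics, at the price of one
step. -/
theorem exists_switch {P Q : ℕ → Prop} {n : ℕ} (h0 : P 0) (hn : Q n)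
    (h : ∀ t ≤ n, P t ∨ Q t) : ∃ t ≤ n, P t ∧ (Q t ∨ t + 1 ≤ n ∧ Q (t + 1)) := by
  classical
  have hex : ∃ t, Q t := ⟨n, hn⟩
  have hle : Nat.find hex ≤ n := Nat.find_min' hex hn
  rcases Nat.eq_zero_or_pos (Nat.find hex) with hz | hz
  · exact ⟨0, Nat.zero_le _, h0, Or.inl (hz ▸ Nat.find_spec hex)⟩
  · obtain ⟨m, hm⟩ := Nat.exists_eq_succ_of_ne_zero hz.ne'
    have hQ := Nat.find_spec hex
    have hnQ : ¬ Q m := Nat.find_min hex (by omega)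
    refine ⟨m, by omega, (h m (by omega)).resolve_right hnQ, Or.inr ⟨by omega, ?_⟩⟩
    rwa [hm] at hQ

end Graph

/-! ### Stability of geodesics and bilipschitz invariance of hyperbolicity. -/

section Morse

variable {V : Type v} {X Y : SimpleGraph V} {δ : ℝ}

/-- Halving the chain costs one `δ` per level, so the loss is only logarithmic in the number of
points. This logarithm against a linear length is what makes the stability of geodesics work. -/
theorem FourPoint.chain (h : FourPoint X δ) (o : V) (m : ℝ) (k : ℕ) :
    ∀ (n : ℕ) (z : ℕ → V), 1 ≤ n → n ≤ 2 ^ k →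
      (∀ i < n, m ≤ gromovProd X o (z i) (z (i + 1))) →
      m - k * δ ≤ gromovProd X o (z 0) (z n) := by
  induction k with
  | zero =>
    intro n z h1 h2 hz
    obtain rfl : n = 1 := by simp at h2; omega
    simpa using hz 0 one_pos
  | succ k ih =>
    intro n z h1 h2 hz
    rcases Nat.lt_or_ge n 2 with hn | hn
    · obtain rfl : n = 1 := by omega
      have := hz 0 one_pos
      have h0 := h.nonneg
      have : 0 ≤ ((k + 1 : ℕ) : ℝ) * δ := by positivity
      simp only [zero_add] at *
      linarith
    · have h3 : (2 : ℕ) ^ (k + 1) = 2 * 2 ^ k := by ring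
      have ha := ih (n / 2) z (by omega) (by omega) (fun i hi => hz i (by omega))
      have hb := ih (n - n / 2) (fun i => z (n / 2 + i)) (by omega) (by omega)
        (fun i hi => hz (n / 2 + i) (by omega))
      simp only [add_zero] at hb
      rw [Nat.add_sub_cancel' (by omega)] at hb
      have := h.le ha hb
      push_cast
      linarith

theorem FourPoint.chain' (h : FourPoint X δ) (o : V) {m : ℝ} {k i j : ℕ} {z : ℕ → V}
    (h1 : i < j) (h2 : j ≤ i + 2 ^ k)
    (hz : ∀ t, i ≤ t → t < j → m ≤ gromovProd X o (z t) (z (t + 1))) :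
    m - k * δ ≤ gromovProd X o (z i) (z j) := by
  have := h.chain o m k (j - i) (fun t => z (i + t)) (by omega) (by omega)
    (fun t ht => hz (i + t) (by omega) (by omega))
  simpa [Nat.add_sub_cancel' h1.le] using this

theorem exists_pow_bound (a b : ℝ) : ∃ k₀ : ℕ, ∀ k ≥ k₀, a + b * k ≤ 2 ^ k := by
  have h1 : Filter.Tendsto (fun n : ℕ => (n : ℝ) ^ 1 / (2 : ℝ) ^ n) Filter.atTop (nhds 0) :=
    tendsto_pow_const_div_const_pow_of_one_lt 1 (by norm_num)
  have h2 : Filter.Tendsto (fun n : ℕ => (n : ℝ) ^ 0 / (2 : ℝ) ^ n) Filter.atTop (nhds 0) :=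
    tendsto_pow_const_div_const_pow_of_one_lt 0 (by norm_num)
  have h3 := (h2.const_mul a).add (h1.const_mul b)
  simp only [mul_zero, add_zero] at h3
  obtain ⟨k₀, hk⟩ := Filter.eventually_atTop.1 (h3.eventually (gt_mem_nhds one_pos))
  refine ⟨k₀, fun k hk' => ?_⟩
  have h4 := hk k hk'
  have h5 : (0 : ℝ) < 2 ^ k := by positivity
  have h6 : a * ((k : ℝ) ^ 0 / 2 ^ k) + b * ((k : ℝ) ^ 1 / 2 ^ k) = (a + b * k) / 2 ^ k := by
    field_simp
  rw [h6, div_lt_one h5] at h4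
  exact h4.le

variable {K : ℕ}

/-- In a hyperbolic graph, geodesics stay close to the geodesics of a bilipschitz graph metric. -/
theorem FourPoint.exists_near_geodesicSeg (h : FourPoint X δ) (hK : 1 ≤ K)
    (hXY : ∀ x y, X.dist x y ≤ K * Y.dist x y) (hYX : ∀ x y, Y.dist x y ≤ K * X.dist x y) :
    ∃ D₀ : ℕ, ∀ (c : ℕ → V) (n : ℕ), IsGeodesicSeg Y c n →
      ∀ p, X.dist (c 0) p + X.dist p (c n) = X.dist (c 0) (c n) →
        ∃ i ≤ n, X.dist p (c i) ≤ D₀ := by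
  classical
  -- The constants anticipate the final contradiction `2 ^ k < 6 K D ≤ 6 K (K + 3 δ + k δ)`.
  obtain ⟨k₀, hk₀⟩ := exists_pow_bound (6 * K * (K + 3 * δ + 1)) (6 * K * δ)
  refine ⟨2 ^ k₀, fun c n hc => ?_⟩
  have hX := h.connected
  set I : Set V := {p | X.dist (c 0) p + X.dist p (c n) = X.dist (c 0) (c n)} with hI
  -- the points at distance at least `D` from the path
  let far : ℕ → Prop := fun D => ∃ p ∈ I, ∀ i ≤ n, D ≤ X.dist p (c i)
  have hbd : ∀ D, far D → D ≤ X.dist (c 0) (c n) := by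
    rintro D ⟨p, hp, hD⟩
    have h1 := hD 0 (Nat.zero_le _)
    rw [X.dist_comm] at h1
    have : X.dist (c 0) p + X.dist p (c n) = X.dist (c 0) (c n) := hp
    omega
  -- The largest distance from a point of an `X`-geodesic between the endpoints to the path; a point
  -- `p` realizing it is examined.
  set D := Nat.findGreatest far (X.dist (c 0) (c n)) with hDdef
  have hfar : far D := Nat.findGreatest_spec (P := far) (m := 0) (Nat.zero_le _)
    ⟨c 0, by simp [hI], fun _ _ => Nat.zero_le _⟩
  have hmax : ∀ p ∈ I, ∃ i ≤ n, X.dist p (c i) ≤ D := by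
    intro p hp
    by_contra hcon
    push Not at hcon
    have hf : far (D + 1) := ⟨p, hp, fun i hi => hcon i hi⟩
    have := Nat.le_findGreatest (hbd _ hf) hf
    omega
  suffices hD : D ≤ 2 ^ k₀ by
    intro p hp
    obtain ⟨i, hi, hle⟩ := hmax p hp
    exact ⟨i, hi, hle.trans hD⟩
  by_contra hlt
  push Not at hlt
  obtain ⟨p, hp, hpD⟩ := hfar
  have hp' : X.dist (c 0) p + X.dist p (c n) = X.dist (c 0) (c n) := hp
  -- a point `u` before `p` with a nearby point of the path
  have key : ∀ e : V, (∃ i ≤ n, e = c i) →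
      (∀ u, X.dist p u + X.dist u e = X.dist p e → u ∈ I) →
      ∃ u, ∃ i ≤ n, X.dist p u + X.dist u e = X.dist p e ∧
        (D : ℝ) ≤ gromovProd X p u (c i) ∧ X.dist p (c i) ≤ 3 * D := by
    rintro e ⟨i₀, hi₀, rfl⟩ hsub
    rcases le_total (X.dist p (c i₀)) (2 * D) with hle | hle
    · refine ⟨c i₀, i₀, hi₀, by simp, ?_, by omega⟩
      rw [gromovProd_self]
      exact_mod_cast hpD i₀ hi₀
    -- Going out to distance `2 D` suffices: a path point within `D` of `u` is still at distance at
    -- least `D` from `p`, so the product is at least `(2 D + D - D) / 2 = D`.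
    · obtain ⟨u, hu1, hu2⟩ := exists_between hX p (c i₀) hle
      obtain ⟨i, hi, hui⟩ := hmax u (hsub u hu2)
      refine ⟨u, i, hi, hu2, ?_, ?_⟩
      · have h1 := hpD i hi
        have h2 : (D : ℝ) ≤ X.dist p (c i) := by exact_mod_cast h1
        have h3 : (X.dist u (c i) : ℝ) ≤ D := by exact_mod_cast hui
        have h4 : (X.dist p u : ℝ) = 2 * D := by exact_mod_cast hu1
        unfold gromovProd
        linarith
      · have := hX.dist_triangle (u := p) (v := u) (w := c i)
        omega
  obtain ⟨u, i, hi, hu, hui, hpi⟩ := key (c 0) ⟨0, Nat.zero_le _, rfl⟩ (by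
    intro u hu
    have h1 := hX.dist_triangle (u := c 0) (v := u) (w := c n)
    have h2 := hX.dist_triangle (u := u) (v := p) (w := c n)
    have h3 := X.dist_comm (u := p) (v := u)
    have h4 := X.dist_comm (u := u) (v := c 0)
    have h5 := X.dist_comm (u := p) (v := c 0)
    change _ = _
    omega)
  obtain ⟨v, j, hj, hv, hvj, hpj⟩ := key (c n) ⟨n, le_rfl, rfl⟩ (by
    intro u hu
    have h1 := hX.dist_triangle (u := c 0) (v := u) (w := c n)
    have h2 := hX.dist_triangle (u := c 0) (v := p) (w := u)
    change _ = _
    omega)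
  -- `p` lies between `u` and `v`
  have huv : gromovProd X p u v = 0 := by
    apply gromovProd_eq_zero
    have h1 := hX.dist_triangle (u := c 0) (v := u) (w := c n)
    have h2 := hX.dist_triangle (u := u) (v := v) (w := c n)
    have h3 := hX.dist_triangle (u := u) (v := p) (w := v)
    have h4 := X.dist_comm (u := p) (v := u)
    have h5 := X.dist_comm (u := u) (v := c 0)
    have h6 := X.dist_comm (u := p) (v := c 0)
    omega
  have hij : ∀ i j, i ≤ n → j ≤ n → X.dist p (c i) ≤ 3 * D → X.dist p (c j) ≤ 3 * D → i ≤ j →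
      j ≤ i + 6 * K * D := by
    intro i j hi hj hpi hpj hij
    have h1 := hX.dist_triangle (u := c i) (v := p) (w := c j)
    rw [X.dist_comm (u := c i) (v := p)] at h1
    have h2 := hc i j hij hj
    have h3 := hYX (c i) (c j)
    have h4 : K * X.dist (c i) (c j) ≤ K * (6 * D) := Nat.mul_le_mul_left _ (by omega)
    have h5 : K * (6 * D) = 6 * K * D := by ring
    omega
  -- choose `k`
  obtain ⟨k, hk1, hk2, hk3⟩ : ∃ k, k₀ ≤ k ∧ 2 ^ k < 6 * K * D ∧ 6 * K * D ≤ 2 ^ (k + 1) := by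
    have hex : ∃ k, 6 * K * D ≤ 2 ^ k := ⟨6 * K * D, Nat.lt_two_pow_self.le⟩
    have hge : D ≤ 6 * K * D := Nat.le_mul_of_pos_left _ (by omega)
    have hgt : k₀ < Nat.find hex := by
      by_contra hcon
      push Not at hcon
      have h1 := Nat.find_spec hex
      have h2 := Nat.pow_le_pow_right (n := 2) (by norm_num) hcon
      omega
    refine ⟨Nat.find hex - 1, by omega, ?_, ?_⟩
    · exact not_le.1 (Nat.find_min hex (by omega))
    · have := Nat.find_spec hex
      rwa [Nat.sub_add_cancel (by omega)]
  have hstep : ∀ t, t < n → (D : ℝ) - K ≤ gromovProd X p (c t) (c (t + 1)) := by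
    intro t ht
    have h1 : (D : ℝ) ≤ X.dist p (c t) := by exact_mod_cast hpD t ht.le
    have h2 : (D : ℝ) ≤ X.dist p (c (t + 1)) := by exact_mod_cast hpD (t + 1) ht
    have h3 : (X.dist (c t) (c (t + 1)) : ℝ) ≤ K := by
      have h4 := hXY (c t) (c (t + 1))
      have h5 := hc t (t + 1) (Nat.le_succ _) ht
      have h6 : Y.dist (c t) (c (t + 1)) = 1 := by omega
      rw [h6, mul_one] at h4
      exact_mod_cast h4
    have hK0 : (0 : ℝ) ≤ K := Nat.cast_nonneg _
    unfold gromovProd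
    linarith
  have hδ := h.nonneg
  have hK0 : (0 : ℝ) ≤ K := Nat.cast_nonneg _
  have hkδ : (0 : ℝ) ≤ ((k + 1 : ℕ) : ℝ) * δ := by positivity
  have hmid : (D : ℝ) - K - (k + 1 : ℕ) * δ ≤ gromovProd X p (c i) (c j) := by
    rcases lt_trichotomy i j with hlt' | rfl | hlt'
    · refine h.chain' p hlt' ?_ fun t _ ht => hstep t (by omega)
      have := hij i j hi hj hpi hpj hlt'.le
      omega
    · rw [gromovProd_self]
      have h1 : (D : ℝ) ≤ X.dist p (c i) := by exact_mod_cast hpD i hi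
      linarith
    · rw [gromovProd_comm]
      refine h.chain' p hlt' ?_ fun t _ ht => hstep t (by omega)
      have := hij j i hj hi hpj hpi hlt'.le
      omega
  rw [gromovProd_comm] at hvj
  -- The chain `u, c i, c j, v` costs two more `δ`. Since `p` lies between `u` and `v`, the
  -- resulting lower bound is at most `0`, which bounds `D` by a linear function of `k`.
  have h1 := h.le (R := (D : ℝ) - K - (k + 1 : ℕ) * δ) (by linarith) hmid (x := u)
  have h2 := h.le (R := (D : ℝ) - K - (k + 1 : ℕ) * δ - δ) h1 (by linarith) (z := v)
  rw [huv] at h2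
  have h3 := hk₀ k hk1
  have h4 : ((2 ^ k : ℕ) : ℝ) < ((6 * K * D : ℕ) : ℝ) := by exact_mod_cast hk2
  push_cast at h2 h4
  have hK1 : (1 : ℝ) ≤ K := by exact_mod_cast hK
  have h5 : (D : ℝ) ≤ K + 3 * δ + k * δ := by linarith
  have h6 : 6 * (K : ℝ) * D ≤ 6 * K * (K + 3 * δ + k * δ) :=
    mul_le_mul_of_nonneg_left h5 (by positivity)
  nlinarith

/-- Stability of quasi-geodesics. -/
theorem FourPoint.exists_gromovProd_le (h : FourPoint X δ) (hY : Y.Connected) (hK : 1 ≤ K)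
    (hXY : ∀ x y, X.dist x y ≤ K * Y.dist x y) (hYX : ∀ x y, Y.dist x y ≤ K * X.dist x y) :
    ∃ M : ℝ, ∀ x p y, Y.dist x p + Y.dist p y = Y.dist x y → gromovProd X p x y ≤ M := by
  obtain ⟨D₀, hD₀⟩ := h.exists_near_geodesicSeg hK hXY hYX
  refine ⟨((D₀ + K * (K * (2 * D₀ + 1)) : ℕ) : ℝ), fun x p y hp => ?_⟩
  have hX := h.connected
  obtain ⟨c, h0, hcn, hcm, hc⟩ := exists_geodesic_through hY hp
  generalize hm' : Y.dist x p = m at hcm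
  generalize hn' : Y.dist x y = n at hc hcn
  have hm : m ≤ n := by omega
  obtain ⟨γ, hγ0, hγ1, hγ⟩ := exists_geodesic hX x y
  have hbet : ∀ t ≤ X.dist x y, X.dist x (γ t) + X.dist (γ t) y = X.dist x y := by
    intro t ht
    have h1 := hγ 0 t (Nat.zero_le _) ht
    have h2 := hγ t _ ht le_rfl
    rw [hγ0] at h1
    rw [hγ1] at h2
    omega
  -- Walking along the `X`-geodesic, the nearby points of the path pass from before `p` to after
  -- `p`. At the switch, one point of the `X`-geodesic is close to path points on both sides of `p`;
  -- these are close to one another, hence to `p`.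
  obtain ⟨t, ht, ⟨i, him, hi⟩, hQ⟩ := exists_switch
    (P := fun t => ∃ i ≤ m, X.dist (γ t) (c i) ≤ D₀)
    (Q := fun t => ∃ i, m ≤ i ∧ i ≤ n ∧ X.dist (γ t) (c i) ≤ D₀) (n := X.dist x y)
    ⟨0, Nat.zero_le _, by simp [hγ0, h0]⟩ ⟨n, hm, le_rfl, by simp [hγ1, hcn]⟩ (by
      intro t ht
      obtain ⟨i, hi, hle⟩ := hD₀ c n hc (γ t) (by rw [h0, hcn]; exact hbet t ht)
      rcases le_total i m with him | him
      · exact Or.inl ⟨i, him, hle⟩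
      · exact Or.inr ⟨i, him, hi, hle⟩)
  obtain ⟨j, hmj, hjn, hj⟩ : ∃ j, m ≤ j ∧ j ≤ n ∧ X.dist (γ t) (c j) ≤ D₀ + 1 := by
    rcases hQ with ⟨j, h1, h2, h3⟩ | ⟨htn, j, h1, h2, h3⟩
    · exact ⟨j, h1, h2, by omega⟩
    · have h4 := hγ t (t + 1) (Nat.le_succ _) htn
      have h5 := hX.dist_triangle (u := γ t) (v := γ (t + 1)) (w := c j)
      exact ⟨j, h1, h2, by omega⟩
  have h1 := hX.dist_triangle (u := c i) (v := γ t) (w := c j)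
  rw [X.dist_comm (u := c i) (v := γ t)] at h1
  have h2 : Y.dist (c i) (c j) ≤ K * (2 * D₀ + 1) :=
    (hYX _ _).trans (Nat.mul_le_mul_left _ (by omega))
  have h3 := hc i j (him.trans hmj) hjn
  have h4 := hc i m him hm
  have h5 : X.dist (c i) (c m) ≤ K * (K * (2 * D₀ + 1)) :=
    (hXY _ _).trans (Nat.mul_le_mul_left _ (by omega))
  have h6 := hX.dist_triangle (u := p) (v := c i) (w := γ t)
  rw [hcm, X.dist_comm] at h5
  rw [X.dist_comm (u := c i) (v := γ t)] at h6
  refine (gromovProd_le_of_between hX p (hbet t ht)).trans ?_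
  exact_mod_cast (by omega : X.dist p (γ t) ≤ D₀ + K * (K * (2 * D₀ + 1)))

/-- Gromov products are coarsely controlled by those of a bilipschitz hyperbolic graph metric. -/
theorem FourPoint.exists_gromovProd_le_of_le (h : FourPoint X δ) (hY : Y.Connected) (hK : 1 ≤ K)
    (hXY : ∀ x y, X.dist x y ≤ K * Y.dist x y) (hYX : ∀ x y, Y.dist x y ≤ K * X.dist x y)
    (R : ℝ) :
    ∃ R' : ℝ, ∀ p x y, gromovProd X p x y ≤ R → gromovProd Y p x y ≤ R' := by
  obtain ⟨D₀, hD₀⟩ := h.exists_near_geodesicSeg hK hXY hYX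
  refine ⟨K * (R + 2 * δ + 1 + D₀), fun p x y hp => ?_⟩
  have hX := h.connected
  -- A small `X`-product brings the `X`-geodesic close to `p`, hence the `Y`-geodesic too, and the
  -- distance to the latter bounds the `Y`-product.
  obtain ⟨q, hq, hpq⟩ := h.exists_between_dist_le p x y
  obtain ⟨c, h0, h1, hc⟩ := exists_geodesic hY x y
  obtain ⟨i, hi, hqi⟩ := hD₀ c _ hc q (by rw [h0, h1]; exact hq)
  have h2 := dist_triangle_real hX p q (c i)
  have h3 : (X.dist q (c i) : ℝ) ≤ D₀ := by exact_mod_cast hqi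
  have h4 : (Y.dist p (c i) : ℝ) ≤ K * X.dist p (c i) := by exact_mod_cast hYX p (c i)
  have h5 : (K : ℝ) * X.dist p (c i) ≤ K * (R + 2 * δ + 1 + D₀) :=
    mul_le_mul_of_nonneg_left (by linarith) (Nat.cast_nonneg _)
  refine (gromovProd_le_of_between hY p (p := c i) ?_).trans (h4.trans h5)
  have h6 := hc 0 i (Nat.zero_le _) hi
  have h7 := hc i _ hi le_rfl
  rw [h0] at h6
  rw [h1] at h7
  omega

/-- Hyperbolicity is invariant under bilipschitz changes of the graph metric. -/
theorem FourPoint.of_bilipschitz (h : FourPoint X δ) (hY : Y.Connected) (hK : 1 ≤ K)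
    (hXY : ∀ x y, X.dist x y ≤ K * Y.dist x y) (hYX : ∀ x y, Y.dist x y ≤ K * X.dist x y) :
    ∃ δ', FourPoint Y δ' := by
  obtain ⟨M, hM⟩ := h.exists_gromovProd_le hY hK hXY hYX
  obtain ⟨C, hC⟩ := h.exists_gromovProd_le_of_le hY hK hXY hYX (M + δ)
  -- Thinness of `Y`-triangles: at a point of a `Y`-geodesic the `X`-product of the endpoints is
  -- bounded, the four point condition in `X` bounds one of the two products with `z`, and this
  -- bound is carried over to `Y`.
  have thin : ∀ x p y z, Y.dist x p + Y.dist p y = Y.dist x y →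
      gromovProd Y p x z ≤ C ∨ gromovProd Y p z y ≤ C := by
    intro x p y z hp
    have h1 := hM x p y hp
    have h2 := h.min_le p x z y
    rcases min_le_iff.1 (by linarith : min (gromovProd X p x z) (gromovProd X p z y) ≤ M + δ)
      with h3 | h3
    · exact Or.inl (hC _ _ _ h3)
    · exact Or.inr (hC _ _ _ h3)
  refine IsHyperbolicGraph.fourPoint ⟨hY, 3 * C + 2, fun o x y z => ?_⟩
  obtain ⟨c, h0, h1, hc⟩ := exists_geodesic hY x z
  have hbet : ∀ t ≤ Y.dist x z, Y.dist x (c t) + Y.dist (c t) z = Y.dist x z := by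
    intro t ht
    have h2 := hc 0 t (Nat.zero_le _) ht
    have h3 := hc t _ ht le_rfl
    rw [h0] at h2
    rw [h1] at h3
    omega
  have hC0 : 0 ≤ C := by
    rcases thin o o o o (by simp) with h2 | h2 <;> simpa [gromovProd_self] using h2
  -- A point of `[x, z]` close to both other sides of the triangle with vertex `o`; its distance to
  -- `o` exceeds `(x | z)_o` by at most `2 C + 1`. Thinness with respect to `y` at this point then
  -- gives the four point condition.
  obtain ⟨t, ht, hP, hQ⟩ := exists_switch (P := fun t => gromovProd Y (c t) x o ≤ C)
    (Q := fun t => gromovProd Y (c t) o z ≤ C) (n := Y.dist x z)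
    ((gromovProd_le_left hY _ _ _).trans (by simpa [h0] using hC0))
    ((gromovProd_le_right hY _ _ _).trans (by simpa [h1] using hC0))
    (fun t ht => thin x (c t) z o (hbet t ht))
  have hQ' : gromovProd Y (c t) o z ≤ C + 1 := by
    rcases hQ with hQ | ⟨ht', hQ⟩
    · linarith
    · have h2 := gromovProd_base hY (c t) (c (t + 1)) o z
      have h3 : Y.dist (c t) (c (t + 1)) = 1 := by
        have := hc t (t + 1) (Nat.le_succ _) ht'
        omega
      rw [h3] at h2
      push_cast at h2
      linarith
  have hlow : (Y.dist o (c t) : ℝ) - 2 * C - 1 ≤ gromovProd Y o x z := by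
    have hb : (Y.dist x (c t) : ℝ) + Y.dist (c t) z = Y.dist x z := by
      exact_mod_cast hbet t ht
    unfold gromovProd at *
    rw [Y.dist_comm (u := x) (v := o), Y.dist_comm (u := c t) (v := o),
      Y.dist_comm (u := c t) (v := x)] at hP
    rw [Y.dist_comm (u := c t) (v := o)] at hQ'
    linarith
  rcases thin x (c t) z y (hbet t ht) with h2 | h2
  · have h3 := gromovProd_base hY o (c t) x y
    have h4 := min_le_left (gromovProd Y o x y) (gromovProd Y o y z)
    linarith
  · have h3 := gromovProd_base hY o (c t) y z
    have h4 := min_le_right (gromovProd Y o x y) (gromovProd Y o y z)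
    linarith

end Morse


/-! ### The Gromov boundary of a hyperbolic graph. -/

section BoundaryTheory

variable {V : Type v} {X Y : SimpleGraph V} {δ δ' : ℝ}

/-- Eventually `R ≤ (x i | y j)_o`. -/
def EvGe (X : SimpleGraph V) (o : V) (R : ℝ) (x y : ℕ → V) : Prop :=
  ∃ N, ∀ i ≥ N, ∀ j ≥ N, R ≤ gromovProd X o (x i) (y j)

theorem EvGe.symm {o : V} {R : ℝ} {x y : ℕ → V} (h : EvGe X o R x y) : EvGe X o R y x := by
  obtain ⟨N, hN⟩ := h
  exact ⟨N, fun i hi j hj => by rw [gromovProd_comm]; exact hN j hj i hi⟩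

theorem EvGe.mono {o : V} {R R' : ℝ} {x y : ℕ → V} (h : EvGe X o R x y) (hR : R' ≤ R) :
    EvGe X o R' x y := by
  obtain ⟨N, hN⟩ := h
  exact ⟨N, fun i hi j hj => hR.trans (hN i hi j hj)⟩

theorem EvGe.base (hX : X.Connected) {o : V} {R : ℝ} {x y : ℕ → V} (h : EvGe X o R x y) (o' : V) :
    EvGe X o' (R - X.dist o o') x y := by
  obtain ⟨N, hN⟩ := h
  refine ⟨N, fun i hi j hj => ?_⟩
  have := gromovProd_base hX o o' (x i) (y j)
  linarith [hN i hi j hj]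

theorem EvGe.trans (h : FourPoint X δ) {o : V} {R : ℝ} {x y z : ℕ → V} (h1 : EvGe X o R x y)
    (h2 : EvGe X o R y z) : EvGe X o (R - δ) x z := by
  obtain ⟨N, hN⟩ := h1
  obtain ⟨M, hM⟩ := h2
  exact ⟨max N M, fun i hi j hj => h.le (hN i (le_of_max_le_left hi) (max N M) (le_max_left _ _))
    (hM (max N M) (le_max_right _ _) j (le_of_max_le_right hj))⟩

theorem EvGe.congr_right {o : V} {R : ℝ} {x y z : ℕ → V} (h : EvGe X o R x y)
    (hyz : ∀ᶠ j in Filter.atTop, y j = z j) : EvGe X o R x z := by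
  obtain ⟨N, hN⟩ := h
  obtain ⟨M, hM⟩ := Filter.eventually_atTop.1 hyz
  exact ⟨max N M, fun i hi j hj => by
    rw [← hM j (le_of_max_le_right hj)]
    exact hN i (le_of_max_le_left hi) j (le_of_max_le_left hj)⟩

theorem evGe_smul_iff {G : Type u} [Group G] [MulAction G V] [IsGraphAction G X] (g : G) {o : V}
    {R : ℝ} {x y : ℕ → V} :
    EvGe X (g • o) R (fun i => g • x i) (fun i => g • y i) ↔ EvGe X o R x y := by
  simp [EvGe, gromovProd_smul]

theorem GeodesicRay.dist_eq (ρ : GeodesicRay X) {i j : ℕ} (h : i ≤ j) :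
    X.dist (ρ i) (ρ j) + i = j := by
  have := ρ.isGeodesic i j h
  omega

theorem GeodesicRay.le_gromovProd (hX : X.Connected) (ρ : GeodesicRay X) (o : V) {k i j : ℕ}
    (hi : k ≤ i) (hj : k ≤ j) : (k : ℝ) - X.dist o (ρ 0) ≤ gromovProd X o (ρ i) (ρ j) := by
  have h1 := gromovProd_base hX (ρ 0) o (ρ i) (ρ j)
  rw [X.dist_comm (u := ρ 0)] at h1
  have h2 : (k : ℝ) ≤ gromovProd X (ρ 0) (ρ i) (ρ j) := by
    rcases le_total i j with hij | hij
    · have h3 := ρ.dist_eq (Nat.zero_le i)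
      have h4 := ρ.dist_eq (Nat.zero_le j)
      have h5 := ρ.dist_eq hij
      have h3' : (X.dist (ρ 0) (ρ i) : ℝ) = i := by exact_mod_cast h3
      have h4' : (X.dist (ρ 0) (ρ j) : ℝ) = j := by exact_mod_cast h4
      have h5' : (X.dist (ρ i) (ρ j) : ℝ) + i = j := by exact_mod_cast h5
      have h6 : (k : ℝ) ≤ i := by exact_mod_cast hi
      unfold gromovProd
      linarith
    · have h3 := ρ.dist_eq (Nat.zero_le i)
      have h4 := ρ.dist_eq (Nat.zero_le j)
      have h5 := ρ.dist_eq hij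
      have h3' : (X.dist (ρ 0) (ρ i) : ℝ) = i := by exact_mod_cast h3
      have h4' : (X.dist (ρ 0) (ρ j) : ℝ) = j := by exact_mod_cast h4
      have h5' : (X.dist (ρ j) (ρ i) : ℝ) + j = i := by exact_mod_cast h5
      have h6 : (k : ℝ) ≤ j := by exact_mod_cast hj
      rw [X.dist_comm] at h5'
      unfold gromovProd
      linarith
  linarith

theorem GeodesicRay.evGe_self (hX : X.Connected) (ρ : GeodesicRay X) (o : V) (R : ℝ) :
    EvGe X o R ρ ρ := by
  obtain ⟨k, hk⟩ := exists_nat_ge (R + X.dist o (ρ 0))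
  exact ⟨k, fun i hi j hj => le_trans (by linarith) (ρ.le_gromovProd hX o hi hj)⟩

theorem GeodesicRay.limit_eq_iff_edist {ρ σ : GeodesicRay X} :
    ρ.limit = σ.limit ↔ ∃ C : ℕ, ∀ n, X.edist (ρ n) (σ n) ≤ C :=
  Quotient.eq

/-- Two geodesic rays of a hyperbolic graph have the same limit if and only if their Gromov
products tend to infinity. -/
theorem FourPoint.limit_eq_iff (h : FourPoint X δ) {ρ σ : GeodesicRay X} :
    ρ.limit = σ.limit ↔ ∀ o R, EvGe X o R ρ σ := by
  have hX := h.connected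
  rw [GeodesicRay.limit_eq_iff_edist]
  constructor
  · rintro ⟨C, hC⟩ o R
    obtain ⟨k, hk⟩ := exists_nat_ge (R + 2 * δ + C + X.dist o (ρ 0) + X.dist o (σ 0))
    -- Far out, `ρ k` and `σ k` bridge the two rays: both are far from `o` and at distance at most
    -- `C` from each other. Two uses of the four point condition spend the margin `2 δ`.
    have hk1 : R + 2 * δ ≤ gromovProd X o (ρ k) (σ k) := by
      have h1 : (X.dist (ρ k) (σ k) : ℝ) ≤ C := by
        have := hC k
        rw [← (hX (ρ k) (σ k)).coe_dist_eq_edist] at this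
        exact_mod_cast this
      have h2 := ρ.le_gromovProd hX o (le_refl k) (le_refl k)
      have h3 := σ.le_gromovProd hX o (le_refl k) (le_refl k)
      rw [gromovProd_self] at h2 h3
      have h4 : (0 : ℝ) ≤ X.dist o (ρ 0) := Nat.cast_nonneg _
      have h5 : (0 : ℝ) ≤ X.dist o (σ 0) := Nat.cast_nonneg _
      have h6 := h.nonneg
      have h7 : (0 : ℝ) ≤ C := Nat.cast_nonneg _
      unfold gromovProd
      linarith
    refine ⟨k, fun i hi j hj => ?_⟩
    have h4 : (0 : ℝ) ≤ X.dist o (ρ 0) := Nat.cast_nonneg _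
    have h5 : (0 : ℝ) ≤ X.dist o (σ 0) := Nat.cast_nonneg _
    have h6 := h.nonneg
    have h7 : (0 : ℝ) ≤ C := Nat.cast_nonneg _
    have h8 := h.le (R := R + 2 * δ)
      (le_trans (by linarith) (ρ.le_gromovProd hX o hi (le_refl k))) hk1
    have h9 := h.le (R := R + 2 * δ - δ) h8
      (le_trans (by linarith) (σ.le_gromovProd hX o (le_refl k) hj))
    linarith
  · intro hall
    -- With `d` the distance of the origins, passing through a far index gives `(ρ n | σ n) ≥ n - d
    -- - 2 δ`; since `σ n` is at distance at most `n + d` from `ρ 0`, the distance of `ρ n` and `σ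
    -- n` is at most `3 d + 4 δ`.
    obtain ⟨C, hC⟩ := exists_nat_ge (3 * (X.dist (ρ 0) (σ 0) : ℝ) + 4 * δ)
    refine ⟨C, fun n => ?_⟩
    obtain ⟨N, hN⟩ := hall (ρ 0) n
    have h1 := ρ.le_gromovProd hX (ρ 0) (le_refl n) (le_max_right N n)
    have h2 := hN (max N n) (le_max_left _ _) (max N n) (le_max_left _ _)
    have h3 := σ.le_gromovProd hX (ρ 0) (le_max_right N n) (le_refl n)
    simp only [SimpleGraph.dist_self, Nat.cast_zero, sub_zero] at h1
    have h0 : (0 : ℝ) ≤ X.dist (ρ 0) (σ 0) := Nat.cast_nonneg _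
    have hδ := h.nonneg
    have h4 := h.le h1 h2
    have h5 := h.le (R := n - X.dist (ρ 0) (σ 0) - δ) (by linarith)
      (le_trans (by linarith) h3) (x := ρ n)
    have h6 : (X.dist (ρ 0) (ρ n) : ℝ) = n := by exact_mod_cast ρ.dist_eq (Nat.zero_le n)
    have h7 : (X.dist (σ 0) (σ n) : ℝ) = n := by exact_mod_cast σ.dist_eq (Nat.zero_le n)
    have h8 := dist_triangle_real hX (ρ 0) (σ 0) (σ n)
    rw [← (hX (ρ n) (σ n)).coe_dist_eq_edist]
    have h9 : (X.dist (ρ n) (σ n) : ℝ) ≤ C := by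
      unfold gromovProd at h5
      linarith
    exact_mod_cast h9

/-- The sequence `x` of vertices converges to the boundary point `ξ`. -/
def ConvTo (X : SimpleGraph V) (x : ℕ → V) (ξ : GromovBoundary X) : Prop :=
  ∃ ρ : GeodesicRay X, ρ.limit = ξ ∧ ∀ o R, EvGe X o R x ρ

theorem GeodesicRay.convTo (hX : X.Connected) (ρ : GeodesicRay X) : ConvTo X ρ ρ.limit :=
  ⟨ρ, rfl, ρ.evGe_self hX⟩

theorem ConvTo.trans (h : FourPoint X δ) {x y : ℕ → V} {ξ : GromovBoundary X}
    (hy : ConvTo X y ξ) (hxy : ∀ o R, EvGe X o R x y) : ConvTo X x ξ := by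
  obtain ⟨ρ, hρ, hall⟩ := hy
  exact ⟨ρ, hρ, fun o R => by simpa using (hxy o (R + δ)).trans h (hall o (R + δ))⟩

theorem ConvTo.evGe (h : FourPoint X δ) {x y : ℕ → V} {ξ : GromovBoundary X} (hx : ConvTo X x ξ)
    (hy : ConvTo X y ξ) (o : V) (R : ℝ) : EvGe X o R x y := by
  obtain ⟨ρ, rfl, hρ⟩ := hx
  obtain ⟨σ, hσ, hσ'⟩ := hy
  have h1 := (hρ o (R + 2 * δ)).trans h (h.limit_eq_iff.1 hσ.symm o (R + 2 * δ))
  have h2 := h1.trans h ((hσ' o (R + 2 * δ - δ)).symm)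
  exact h2.mono (by linarith)

theorem ConvTo.unique (h : FourPoint X δ) {x : ℕ → V} {ξ η : GromovBoundary X}
    (hx : ConvTo X x ξ) (hy : ConvTo X x η) : ξ = η := by
  obtain ⟨ρ, rfl, hρ⟩ := hx
  obtain ⟨σ, rfl, hσ⟩ := hy
  exact h.limit_eq_iff.2 fun o R => by
    simpa using (hρ o (R + δ)).symm.trans h (hσ o (R + δ))

theorem ConvTo.eq_of_evGe (h : FourPoint X δ) {x y : ℕ → V} {ξ η : GromovBoundary X}
    (hx : ConvTo X x ξ) (hy : ConvTo X y η) (hxy : ∀ o R, EvGe X o R x y) : ξ = η :=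
  hx.unique h (hy.trans h hxy)

theorem GromovBoundary.exists_convTo (hX : X.Connected) (ξ : GromovBoundary X) :
    ∃ x, ConvTo X x ξ := by
  obtain ⟨ρ, rfl⟩ := Quotient.exists_rep ξ
  exact ⟨ρ, ρ.convTo hX⟩

theorem ConvTo.smul {G : Type u} [Group G] [MulAction G V] [IsGraphAction G X] {x : ℕ → V}
    {ξ : GromovBoundary X} (hx : ConvTo X x ξ) (g : G) :
    ConvTo X (fun n => g • x n) (g • ξ) := by
  obtain ⟨ρ, rfl, hρ⟩ := hx
  refine ⟨g • ρ, rfl, fun o R => ?_⟩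
  have := (evGe_smul_iff g).2 (hρ (g⁻¹ • o) R)
  rwa [smul_inv_smul] at this

/-- All balls are finite. -/
def ProperGraph (X : SimpleGraph V) : Prop := ∀ o n, {y | X.dist o y ≤ n}.Finite

/-- A limit along an ultrafilter of longer and longer geodesic segments issuing from `o`. -/
theorem ProperGraph.exists_ray_of_ultrafilter (hfin : ProperGraph X) {ι : Type*}
    (F : Ultrafilter ι) (c : ι → ℕ → V) (o : V)
    (hc : ∀ k, ∀ᶠ i in (F : Filter ι), c i 0 = o ∧ IsGeodesicSeg X (c i) k) :
    ∃ σ : GeodesicRay X, σ 0 = o ∧ ∀ k, ∀ᶠ i in (F : Filter ι), c i k = σ k := by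
  have hex : ∀ k, ∃ y, ∀ᶠ i in (F : Filter ι), c i k = y := by
    intro k
    -- The `k`-th vertices lie in a finite ball, so the ultrafilter selects one of them.
    have hmem : (⋃ y ∈ {y | X.dist o y ≤ k}, {i | c i k = y}) ∈ F := by
      filter_upwards [hc k] with i hi
      simp only [Set.mem_ofPred_eq, Set.mem_iUnion, exists_prop, exists_eq_right']
      have := hi.2 0 k (Nat.zero_le _) le_rfl
      rw [hi.1] at this
      omega
    obtain ⟨y, -, hy⟩ := (Ultrafilter.finite_biUnion_mem_iff (hfin o k)).1 hmem
    exact ⟨y, hy⟩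
  choose σ hσ using hex
  refine ⟨⟨σ, fun i j hij => ?_⟩, ?_, hσ⟩
  · obtain ⟨a, ha1, ha2, ha3⟩ := ((hσ i).and ((hσ j).and (hc j))).exists
    have := ha3.2 i j hij le_rfl
    rw [ha1, ha2] at this
    omega
  · obtain ⟨a, ha1, ha2⟩ := ((hσ 0).and (hc 0)).exists
    exact ha1.symm.trans ha2.1

/-- In a proper hyperbolic graph every sequence converging to infinity has a limit. -/
theorem FourPoint.exists_convTo_ray (h : FourPoint X δ) (hfin : ProperGraph X) (o : V)
    {x : ℕ → V} (hx : ∀ R, EvGe X o R x x) :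
    ∃ ρ : GeodesicRay X, ρ 0 = o ∧ ConvTo X x ρ.limit := by
  have hX := h.connected
  choose c hc0 hc1 hc using fun i => exists_geodesic hX o (x i)
  have hfar : ∀ k : ℕ, ∀ᶠ i in Filter.atTop, k ≤ X.dist o (x i) := by
    intro k
    obtain ⟨N, hN⟩ := hx k
    filter_upwards [Filter.eventually_ge_atTop N] with i hi
    have := hN i hi i hi
    rw [gromovProd_self] at this
    exact_mod_cast this
  obtain ⟨ρ, hρ0, hρ⟩ := hfin.exists_ray_of_ultrafilter (Filter.hyperfilter ℕ) c o (by
    intro k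
    filter_upwards [Nat.hyperfilter_le_atTop (hfar k)] with i hi
    exact ⟨hc0 i, fun a b hab hb => hc i a b hab (hb.trans hi)⟩)
  refine ⟨ρ, hρ0, ρ, rfl, ?_⟩
  have key : ∀ R, EvGe X o R x ρ := by
    intro R
    obtain ⟨N, hN⟩ := hx (R + δ)
    obtain ⟨k, hk⟩ := exists_nat_ge (R + δ)
    refine ⟨max N k, fun i hi j hj => ?_⟩
    -- An index `a` for which the segment from `o` to `x a` passes through `ρ j`; then `(x a | ρ
    -- j)_o` is exactly `j`.
    obtain ⟨a, ha1, ha2, ha3⟩ := ((hρ j).and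
      ((Filter.Eventually.filter_mono Nat.hyperfilter_le_atTop (hfar j)).and
      (Filter.Eventually.filter_mono Nat.hyperfilter_le_atTop
        (Filter.eventually_ge_atTop N)))).exists
    have h1 := hN i (le_of_max_le_left hi) a ha3
    have h2 : gromovProd X o (x a) (ρ j) = j := by
      have h3 := hc a 0 j (Nat.zero_le _) ha2
      have h4 := hc a j _ ha2 le_rfl
      rw [hc0] at h3
      rw [hc1] at h4
      rw [ha1] at h3 h4
      rw [X.dist_comm (u := ρ j)] at h4
      have h3' : (X.dist o (ρ j) : ℝ) = j := by exact_mod_cast h3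
      have h4' : (X.dist (x a) (ρ j) : ℝ) + j = X.dist o (x a) := by exact_mod_cast h4
      unfold gromovProd
      linarith
    have h5 : (k : ℝ) ≤ j := by exact_mod_cast le_of_max_le_right hj
    have := h.le h1 (by rw [h2]; linarith : R + δ ≤ gromovProd X o (x a) (ρ j))
    linarith
  exact fun o' R => (by simpa using (key (R + X.dist o o')).base hX o')

theorem FourPoint.exists_ray_from (h : FourPoint X δ) (hfin : ProperGraph X) (o : V)
    (ξ : GromovBoundary X) : ∃ ρ : GeodesicRay X, ρ 0 = o ∧ ρ.limit = ξ := by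
  obtain ⟨σ, rfl⟩ := Quotient.exists_rep ξ
  obtain ⟨ρ, h0, hρ⟩ := h.exists_convTo_ray hfin o (fun R => σ.evGe_self h.connected o R)
  exact ⟨ρ, h0, hρ.unique h (σ.convTo h.connected)⟩

/-! ### Neighbourhoods -/

/-- Convergence of a sequence of vertices to a point of the bordification. -/
def TendsTo (X : SimpleGraph V) (t : ℕ → V) : Bordification X → Prop
  | .vertex a => ∀ᶠ j in Filter.atTop, t j = a
  | .bdry ξ => ConvTo X t ξ

theorem exists_tendsTo (hX : X.Connected) (z : Bordification X) : ∃ t, TendsTo X t z := by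
  cases z with
  | vertex a => exact ⟨fun _ => a, Filter.Eventually.of_forall fun _ => rfl⟩
  | bdry ξ => exact ξ.exists_convTo hX

/-- The neighbourhoods are defined by geodesic representatives. Together with the converse below,
this permits arbitrary convergent sequences, with a loss of `2 δ` each way: one `δ` for each of the
two sequences replaced. -/
theorem FourPoint.mem_gromovNhd (h : FourPoint X δ) {o : V} {R : ℝ} {s t : ℕ → V}
    {ξ : GromovBoundary X} {z : Bordification X} (hs : ConvTo X s ξ) (ht : TendsTo X t z)
    (hst : EvGe X o (R + 2 * δ) s t) : z ∈ gromovNhd X o ξ R := by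
  obtain ⟨ρ, hρ, hρ'⟩ := hs
  have h1 : EvGe X o (R + δ) ρ t := by
    have := (hρ' o (R + 2 * δ)).symm.trans h hst
    exact this.mono (by linarith)
  cases z with
  | vertex a =>
    exact ⟨ρ, fun _ => a, ⟨ρ, hρ, fun _ => rfl⟩, fun _ => rfl,
      (h1.congr_right ht).mono (by linarith [h.nonneg])⟩
  | bdry η =>
    obtain ⟨σ, hσ, hσ'⟩ := ht
    have h2 := h1.trans h (hσ' o (R + δ))
    exact ⟨ρ, σ, ⟨ρ, hρ, fun _ => rfl⟩, ⟨σ, hσ, fun _ => rfl⟩, h2.mono (by linarith)⟩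

theorem FourPoint.evGe_of_mem_gromovNhd (h : FourPoint X δ) {o : V} {R : ℝ} {s t : ℕ → V}
    {ξ : GromovBoundary X} {z : Bordification X} (hs : ConvTo X s ξ) (ht : TendsTo X t z)
    (hz : z ∈ gromovNhd X o ξ R) : EvGe X o (R - 2 * δ) s t := by
  obtain ⟨s', t', ⟨ρ, hρ, hs'⟩, ht', hst⟩ := hz
  obtain rfl : s' = ρ := funext hs'
  have hst : EvGe X o R ρ t' := hst
  have h1 := ((hs.evGe h (hρ ▸ ρ.convTo h.connected) o R)).trans h hst
  cases z with
  | vertex a =>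
    refine (h1.congr_right (z := t) ?_).mono (by linarith [h.nonneg])
    filter_upwards [ht] with j hj
    rw [hj]
    exact ht' j
  | bdry η =>
    obtain ⟨σ, hσ, ht'⟩ := ht'
    obtain rfl : t' = σ := funext ht'
    have h2 := h1.trans h (ConvTo.evGe h (hσ ▸ σ.convTo h.connected) ht o (R - δ))
    exact h2.mono (by linarith)

theorem gromovNhd_base (hX : X.Connected) (o o' : V) (ξ : GromovBoundary X) (R : ℝ) :
    gromovNhd X o' ξ (R + X.dist o o') ⊆ gromovNhd X o ξ R := by
  rintro z ⟨s, t, hs, ht, hst⟩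
  refine ⟨s, t, hs, ht, ?_⟩
  have := EvGe.base hX (show EvGe X o' (R + X.dist o o') s t from hst) o
  rw [X.dist_comm (u := o')] at this
  exact this.mono (by linarith)

/-- Of the `5 δ`, two are lost in passing to sequences, one in the four point condition and two in
passing back. This is the source both of open neighbourhoods and of the composition axiom of the
uniformity. -/
theorem FourPoint.gromovNhd_trans (h : FourPoint X δ) {o : V} {R : ℝ} {ξ η : GromovBoundary X}
    (hη : .bdry η ∈ gromovNhd X o ξ (R + 5 * δ)) :
    gromovNhd X o η (R + 5 * δ) ⊆ gromovNhd X o ξ R := by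
  intro z hz
  obtain ⟨s, hs⟩ := ξ.exists_convTo h.connected
  obtain ⟨t, ht⟩ := η.exists_convTo h.connected
  obtain ⟨r, hr⟩ := exists_tendsTo h.connected z
  have h1 := (h.evGe_of_mem_gromovNhd hs (z := .bdry η) ht hη).trans h (h.evGe_of_mem_gromovNhd ht hr hz)
  exact h.mem_gromovNhd hs hr (h1.mono (by linarith))

theorem bdry_mem_gromovNhd_self (hX : X.Connected) (o : V) (ξ : GromovBoundary X) (R : ℝ) :
    .bdry ξ ∈ gromovNhd X o ξ R := by
  obtain ⟨ρ, rfl⟩ := Quotient.exists_rep ξ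
  exact ⟨ρ, ρ, ⟨ρ, rfl, fun _ => rfl⟩, ⟨ρ, rfl, fun _ => rfl⟩, ρ.evGe_self hX o R⟩

theorem bdry_mem_gromovNhd_comm {o : V} {ξ η : GromovBoundary X} {R : ℝ}
    (h : .bdry η ∈ gromovNhd X o ξ R) : .bdry ξ ∈ gromovNhd X o η R := by
  obtain ⟨s, t, hs, ht, hst⟩ := h
  exact ⟨t, s, ht, hs, EvGe.symm hst⟩

/-- In a hyperbolic graph the sets `gromovNhd X o ξ R` are neighbourhoods of `ξ`. -/
theorem FourPoint.exists_isOpen_subset_gromovNhd (h : FourPoint X δ) (o : V)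
    (ξ : GromovBoundary X) (R : ℝ) :
    ∃ U, IsOpen U ∧ Bordification.bdry ξ ∈ U ∧ U ⊆ gromovNhd X o ξ R := by
  have hX := h.connected
  -- This is the interior: vertices are isolated and need no condition, and a boundary point is kept
  -- if one of its own neighbourhoods fits inside.
  refine ⟨{z | z ∈ gromovNhd X o ξ R ∧
    ∀ η, z = .bdry η → ∃ R', gromovNhd X o η R' ⊆ gromovNhd X o ξ R}, ?_, ?_, fun z hz => hz.1⟩
  · intro η hη o'
    obtain ⟨R', hR'⟩ := hη.2 η rfl
    have hb := gromovNhd_base hX o o' η (R' + 5 * δ)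
    refine ⟨R' + 5 * δ + X.dist o o', fun z hz => ⟨hR' (gromovNhd_anti o η ?_ (hb hz)), ?_⟩⟩
    · linarith [h.nonneg]
    · rintro ζ rfl
      exact ⟨R' + 5 * δ, (h.gromovNhd_trans (hb hz)).trans hR'⟩
  · refine ⟨bdry_mem_gromovNhd_self hX o ξ R, fun η hη => ⟨R, ?_⟩⟩
    cases hη
    exact subset_rfl

theorem isOpen_boundary_iff {U : Set (GromovBoundary X)} :
    IsOpen U ↔ ∀ ξ ∈ U, ∀ o, ∃ R, ∀ η, .bdry η ∈ gromovNhd X o ξ R → η ∈ U := by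
  rw [isOpen_induced_iff]
  constructor
  · rintro ⟨W, hW, rfl⟩ ξ hξ o
    obtain ⟨R, hR⟩ := hW ξ hξ o
    exact ⟨R, fun η hη => hR hη⟩
  · intro hU
    -- Adding all vertices to `U` does no harm, since openness is only tested at boundary points.
    refine ⟨{z | ∀ η, z = .bdry η → η ∈ U}, fun ξ hξ o => ?_, ?_⟩
    · obtain ⟨R, hR⟩ := hU ξ (hξ ξ rfl) o
      refine ⟨R, ?_⟩
      rintro z hz η rfl
      exact hR η hz
    · ext ξ
      simp

theorem FourPoint.mem_nhds_boundary_iff (h : FourPoint X δ) (o : V) {ξ : GromovBoundary X}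
    {U : Set (GromovBoundary X)} :
    U ∈ nhds ξ ↔ ∃ R, ∀ η, .bdry η ∈ gromovNhd X o ξ R → η ∈ U := by
  constructor
  · intro hU
    obtain ⟨W, hWU, hW, hξ⟩ := mem_nhds_iff.1 hU
    obtain ⟨R, hR⟩ := isOpen_boundary_iff.1 hW ξ hξ o
    exact ⟨R, fun η hη => hWU (hR η hη)⟩
  · rintro ⟨R, hR⟩
    obtain ⟨W, hW, hξ, hWR⟩ := h.exists_isOpen_subset_gromovNhd o ξ R
    exact mem_nhds_iff.2 ⟨Bordification.bdry ⁻¹' W, fun η hη => hR η (hWR hη),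
      isOpen_induced hW, hξ⟩

theorem FourPoint.eq_of_forall_mem_gromovNhd (h : FourPoint X δ) (o : V)
    {ξ η : GromovBoundary X} (hall : ∀ n : ℕ, .bdry η ∈ gromovNhd X o ξ n) : ξ = η := by
  obtain ⟨s, hs⟩ := ξ.exists_convTo h.connected
  obtain ⟨t, ht⟩ := η.exists_convTo h.connected
  refine hs.eq_of_evGe h ht fun o' R => ?_
  obtain ⟨n, hn⟩ := exists_nat_ge (R + X.dist o o' + 2 * δ)
  exact ((h.evGe_of_mem_gromovNhd hs (z := .bdry η) ht (hall n)).base h.connected o').mono (by linarith)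

/-- The boundary of a hyperbolic graph is metrizable. -/
theorem FourPoint.metrizableSpace (h : FourPoint X δ) :
    TopologicalSpace.MetrizableSpace (GromovBoundary X) := by
  have hX := h.connected
  obtain ⟨o⟩ := hX.nonempty
  let E : ℕ → Set (GromovBoundary X × GromovBoundary X) :=
    fun n => {p | .bdry p.2 ∈ gromovNhd X o p.1 n}
  have hp : TopologicalSpace.PseudoMetrizableSpace (GromovBoundary X) := by
    have hanti : ∀ m n, m ≤ n → E n ⊆ E m := fun m n hmn p hp =>
      gromovNhd_anti o p.1 (by exact_mod_cast hmn) hp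
    have hbasis : (⨅ n, Filter.principal (E n)).HasBasis (fun _ => True) E :=
      Filter.hasBasis_iInf_principal (directed_of_isDirected_le fun m n hmn => hanti m n hmn)
    -- The entourages are the pairs with Gromov product at least `n`. The countable basis gives
    -- pseudometrizability, and points with unbounded product coincide, which gives separation.
    let U : UniformSpace (GromovBoundary X) :=
      { uniformity := ⨅ n, Filter.principal (E n)
        symm := by
          rw [hbasis.tendsto_iff hbasis]
          exact fun n _ => ⟨n, trivial, fun p hp => bdry_mem_gromovNhd_comm hp⟩
        comp := by
          refine ((hbasis.lift' (monotone_id.relComp monotone_id)).le_basis_iff hbasis).2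
            fun n _ => ?_
          obtain ⟨m, hm⟩ := exists_nat_ge ((n : ℝ) + 5 * δ)
          refine ⟨m, trivial, ?_⟩
          rintro ⟨ξ, ζ⟩ ⟨η, h1, h2⟩
          exact h.gromovNhd_trans (gromovNhd_anti o ξ hm h1) (gromovNhd_anti o η hm h2)
        nhds_eq_comap_uniformity := by
          intro ξ
          ext W
          rw [h.mem_nhds_boundary_iff o, (hbasis.comap _).mem_iff]
          constructor
          · rintro ⟨R, hR⟩
            obtain ⟨n, hn⟩ := exists_nat_ge R
            exact ⟨n, trivial, fun η hη => hR η (gromovNhd_anti o ξ hn hη)⟩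
          · rintro ⟨n, -, hn⟩
            exact ⟨n, fun η hη => hn hη⟩ }
    have hc : (@uniformity _ U).IsCountablyGenerated := hbasis.isCountablyGenerated
    exact @UniformSpace.pseudoMetrizableSpace _ U hc
  have hT : T0Space (GromovBoundary X) := by
    refine ⟨fun ξ η hi => h.eq_of_forall_mem_gromovNhd o fun n => ?_⟩
    have h1 : Bordification.bdry ⁻¹' gromovNhd X o ξ n ∈ nhds ξ :=
      (h.mem_nhds_boundary_iff o).2 ⟨n, fun ζ hζ => hζ⟩
    rw [Inseparable.nhds_eq hi] at h1
    exact (mem_of_mem_nhds h1 : η ∈ Bordification.bdry ⁻¹' gromovNhd X o ξ n)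
  infer_instance

/-- The boundary of a proper hyperbolic graph is compact. -/
theorem FourPoint.compactSpace (h : FourPoint X δ) (hfin : ProperGraph X) :
    CompactSpace (GromovBoundary X) := by
  have hX := h.connected
  obtain ⟨o⟩ := hX.nonempty
  rw [← isCompact_univ_iff, isCompact_iff_ultrafilter_le_nhds]
  intro F _
  choose c hc0 hc using fun ξ => h.exists_ray_from hfin o ξ
  -- The limit of the ultrafilter is the class of the limit of the rays from `o` representing its
  -- points: most of these rays agree with `σ` at time `k`, which makes the product with `σ` at
  -- least `k - δ`.
  obtain ⟨σ, hσ0, hσ⟩ := hfin.exists_ray_of_ultrafilter F (fun ξ => c ξ) o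
    (fun k => Filter.Eventually.of_forall fun ξ => ⟨hc0 ξ, fun i j hij _ => (c ξ).dist_eq hij⟩)
  refine ⟨σ.limit, trivial, fun U hU => ?_⟩
  obtain ⟨R, hR⟩ := (h.mem_nhds_boundary_iff o).1 hU
  obtain ⟨k, hk⟩ := exists_nat_ge (R + 3 * δ)
  filter_upwards [hσ k] with ξ hξ
  refine hR ξ (h.mem_gromovNhd (σ.convTo hX) (hc ξ ▸ (c ξ).convTo hX) ⟨k, fun i hi j hj => ?_⟩)
  have h1 := σ.le_gromovProd hX o hi (le_refl k)
  have h2 := (c ξ).le_gromovProd hX o (le_refl k) hj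
  rw [hσ0, SimpleGraph.dist_self, Nat.cast_zero, sub_zero] at h1
  rw [hc0, SimpleGraph.dist_self, Nat.cast_zero, sub_zero, hξ] at h2
  have := h.le h1 h2
  linarith

/-! ### Two graphs on the same vertex set -/

/-- If each Gromov product is large whenever the other is, the same sequences converge at infinity
in both graphs. The homeomorphism is recorded through its effect on sequences, which gives
uniqueness and equivariance later. -/
theorem FourPoint.exists_homeomorph (hX : FourPoint X δ) (hY : FourPoint Y δ')
    (hfX : ProperGraph X) (hfY : ProperGraph Y)
    (hXY : ∀ R, ∃ R', ∀ p x y, R' ≤ gromovProd X p x y → R ≤ gromovProd Y p x y)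
    (hYX : ∀ R, ∃ R', ∀ p x y, R' ≤ gromovProd Y p x y → R ≤ gromovProd X p x y) :
    ∃ h : GromovBoundary X ≃ₜ GromovBoundary Y, ∀ x ξ, ConvTo X x ξ → ConvTo Y x (h ξ) := by
  obtain ⟨o⟩ := hX.connected.nonempty
  have ev : ∀ {X Y : SimpleGraph V}, (∀ R, ∃ R', ∀ p x y, R' ≤ gromovProd X p x y →
      R ≤ gromovProd Y p x y) → ∀ {x y : ℕ → V}, (∀ o R, EvGe X o R x y) →
      ∀ o R, EvGe Y o R x y := by
    intro X Y hXY x y hx o R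
    obtain ⟨R', hR'⟩ := hXY R
    obtain ⟨N, hN⟩ := hx o R'
    exact ⟨N, fun i hi j hj => hR' _ _ _ (hN i hi j hj)⟩
  have ex : ∀ {X Y : SimpleGraph V} {δ δ' : ℝ}, FourPoint X δ → FourPoint Y δ' → ProperGraph Y →
      (∀ R, ∃ R', ∀ p x y, R' ≤ gromovProd X p x y → R ≤ gromovProd Y p x y) →
      ∃ f : GromovBoundary X → GromovBoundary Y, Continuous f ∧
        ∀ x ξ, ConvTo X x ξ → ConvTo Y x (f ξ) := by
    intro X Y δ δ' hX hY hfY hXY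
    have ex1 : ∀ ξ : GromovBoundary X, ∃ ω, ∀ x, ConvTo X x ξ → ConvTo Y x ω := by
      intro ξ
      obtain ⟨s, hs⟩ := ξ.exists_convTo hX.connected
      obtain ⟨ρ, -, hρ⟩ := hY.exists_convTo_ray hfY o (x := s)
        (ev hXY (fun o' R => hs.evGe hX hs o' R) o)
      exact ⟨_, fun x hx => hρ.trans hY (ev hXY (fun o' R => hx.evGe hX hs o' R))⟩
    choose f hf using ex1
    refine ⟨f, continuous_iff_continuousAt.2 fun ξ U hU => ?_, fun x ξ => hf ξ x⟩
    obtain ⟨R, hR⟩ := (hY.mem_nhds_boundary_iff o).1 hU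
    obtain ⟨R', hR'⟩ := hXY (R + 2 * δ')
    refine (hX.mem_nhds_boundary_iff o).2 ⟨R' + 2 * δ, fun η hη => hR _ ?_⟩
    obtain ⟨s, hs⟩ := ξ.exists_convTo hX.connected
    obtain ⟨t, ht⟩ := η.exists_convTo hX.connected
    obtain ⟨N, hN⟩ := hX.evGe_of_mem_gromovNhd hs (z := .bdry η) ht hη
    refine hY.mem_gromovNhd (hf ξ s hs) (hf η t ht) ⟨N, fun i hi j hj => hR' _ _ _ ?_⟩
    have := hN i hi j hj
    linarith
  obtain ⟨f, hfc, hf⟩ := ex hX hY hfY hXY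
  obtain ⟨g, hgc, hg⟩ := ex hY hX hfX hYX
  refine ⟨⟨⟨f, g, fun ξ => ?_, fun ξ => ?_⟩, hfc, hgc⟩, hf⟩
  · obtain ⟨s, hs⟩ := ξ.exists_convTo hX.connected
    exact (hg s _ (hf s _ hs)).unique hX hs
  · obtain ⟨s, hs⟩ := ξ.exists_convTo hY.connected
    exact (hf s _ (hg s _ hs)).unique hY hs

end BoundaryTheory


/-! ### Cayley graphs and independence of the generating set. -/

section Cayley

variable {G : Type u} [Group G] {S S' : Set G}

theorem dist_mul_left (S : Set G) (g x y : G) :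
    (SimpleGraph.mulCayley S).dist (g * x) (g * y) = (SimpleGraph.mulCayley S).dist x y :=
  dist_smul (SimpleGraph.mulCayley S) g x y

theorem dist_eq_dist_one (S : Set G) (x y : G) :
    (SimpleGraph.mulCayley S).dist x y = (SimpleGraph.mulCayley S).dist 1 (x⁻¹ * y) := by
  rw [← dist_mul_left S x⁻¹, inv_mul_cancel]

theorem dist_one_inv (S : Set G) (x : G) :
    (SimpleGraph.mulCayley S).dist 1 x⁻¹ = (SimpleGraph.mulCayley S).dist 1 x := by
  rw [← dist_mul_left S x, mul_one, mul_inv_cancel, SimpleGraph.dist_comm]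

theorem mulCayley_connected (hS : Subgroup.closure S = ⊤) :
    (SimpleGraph.mulCayley S).Connected := by
  have key : ∀ g : G, (SimpleGraph.mulCayley S).Reachable 1 g := by
    intro g
    have hsm : ∀ {x y : G} (z : G), (SimpleGraph.mulCayley S).Reachable x y →
        (SimpleGraph.mulCayley S).Reachable (z * x) (z * y) := by
      intro x y z h
      rw [← SimpleGraph.edist_ne_top_iff_reachable] at h ⊢
      exact (edist_smul (SimpleGraph.mulCayley S) z x y).symm ▸ h
    have hg : g ∈ Subgroup.closure S := hS ▸ Subgroup.mem_top g
    induction hg using Subgroup.closure_induction with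
    | mem x hx =>
      by_cases h1 : (1 : G) = x
      · rw [← h1]
      · exact (SimpleGraph.Adj.reachable ((SimpleGraph.mulCayley_adj S 1 x).2
          ⟨h1, Or.inl (by simpa using hx)⟩))
    | one => exact SimpleGraph.Reachable.refl _
    | mul x y _ _ hx hy =>
      have := hsm x hy
      rw [mul_one] at this
      exact hx.trans this
    | inv x _ hx =>
      have := hsm x⁻¹ hx
      rw [mul_one, inv_mul_cancel] at this
      exact this.symm
  exact SimpleGraph.Connected.mk (fun x y => (key x).symm.trans (key y))

theorem mulCayley_proper (hS : S.Finite) (hS' : Subgroup.closure S = ⊤) :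
    ProperGraph (SimpleGraph.mulCayley S) := by
  have hX := mulCayley_connected hS'
  intro o n
  induction n with
  | zero =>
    refine (Set.finite_singleton o).subset fun y hy => ?_
    have : (SimpleGraph.mulCayley S).dist o y = 0 := Nat.le_zero.1 hy
    exact (hX.dist_eq_zero_iff.1 this).symm
  | succ n ih =>
    have hnb : ∀ x : G, ((fun s => x * s) '' S ∪ (fun s => x * s⁻¹) '' S).Finite :=
      fun x => (hS.image _).union (hS.image _)
    refine (ih.union (ih.biUnion fun x _ => hnb x)).subset fun y hy => ?_
    have hy' : (SimpleGraph.mulCayley S).dist o y ≤ n + 1 := hy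
    rcases Nat.lt_or_ge ((SimpleGraph.mulCayley S).dist o y) (n + 1) with hlt | hge
    · exact Or.inl (Nat.lt_succ_iff.1 hlt)
    · right
      obtain ⟨p, hp1, hp2⟩ := exists_between hX o y (k := n) (by omega)
      refine Set.mem_biUnion (show p ∈ {y | (SimpleGraph.mulCayley S).dist o y ≤ n} from hp1.le) ?_
      have hadj := SimpleGraph.dist_eq_one_iff_adj.1
        (show (SimpleGraph.mulCayley S).dist p y = 1 by omega)
      rcases ((SimpleGraph.mulCayley_adj S p y).1 hadj).2 with h | h
      · exact Or.inl ⟨p⁻¹ * y, h, by simp⟩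
      · exact Or.inr ⟨y⁻¹ * p, h, by simp⟩

theorem dist_le_of_generators {Y : SimpleGraph G} [IsGraphAction G Y] (hY : Y.Connected)
    (hS : Subgroup.closure S = ⊤) {K : ℕ} (hK : ∀ s ∈ S, Y.dist 1 s ≤ K) (x y : G) :
    Y.dist x y ≤ K * (SimpleGraph.mulCayley S).dist x y := by
  obtain ⟨p, hp⟩ := (mulCayley_connected hS).exists_walk_length_eq_dist x y
  rw [← hp]
  have hinv : ∀ a b : G, Y.dist a b = Y.dist 1 (a⁻¹ * b) := by
    intro a b
    have := dist_smul Y a⁻¹ a b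
    rw [smul_eq_mul, smul_eq_mul, inv_mul_cancel] at this
    exact this.symm
  clear hp
  induction p with
  | nil => simp
  | @cons a b c hadj q ih =>
    have h1 : Y.dist a b ≤ K := by
      rcases ((SimpleGraph.mulCayley_adj S a b).1 hadj).2 with h | h
      · exact hinv a b ▸ hK _ h
      · rw [Y.dist_comm]
        exact hinv b a ▸ hK _ h
    have h2 := hY.dist_triangle (u := a) (v := b) (w := c)
    rw [SimpleGraph.Walk.length_cons, mul_add, mul_one]
    omega

theorem exists_bilipschitz (hS : S.Finite) (hS' : Subgroup.closure S = ⊤) (hT : S'.Finite)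
    (hT' : Subgroup.closure S' = ⊤) :
    ∃ K : ℕ, 1 ≤ K ∧
      (∀ x y, (SimpleGraph.mulCayley S).dist x y ≤ K * (SimpleGraph.mulCayley S').dist x y) ∧
      ∀ x y, (SimpleGraph.mulCayley S').dist x y ≤ K * (SimpleGraph.mulCayley S).dist x y := by
  obtain ⟨K, hK⟩ := (hT.image fun s => (SimpleGraph.mulCayley S).dist 1 s).bddAbove
  obtain ⟨L, hL⟩ := (hS.image fun s => (SimpleGraph.mulCayley S').dist 1 s).bddAbove
  refine ⟨K + L + 1, by omega, fun x y => ?_, fun x y => ?_⟩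
  · refine dist_le_of_generators (mulCayley_connected hS') hT' (fun s hs => ?_) x y
    have := hK ⟨s, hs, rfl⟩
    dsimp only at this
    omega
  · refine dist_le_of_generators (mulCayley_connected hT') hS' (fun s hs => ?_) x y
    have := hL ⟨s, hs, rfl⟩
    dsimp only at this
    omega

/-- Hyperbolicity of a group does not depend on the finite generating set. -/
theorem IsHyperbolicGroup.fourPoint (hG : IsHyperbolicGroup G) (hS : S.Finite)
    (hS' : Subgroup.closure S = ⊤) : ∃ δ, FourPoint (SimpleGraph.mulCayley S) δ := by
  obtain ⟨S₀, h1, h2, h3⟩ := hG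
  obtain ⟨δ, hδ⟩ := h3.fourPoint
  obtain ⟨K, hK, hK1, hK2⟩ := exists_bilipschitz h1 h2 hS hS'
  exact hδ.of_bilipschitz (mulCayley_connected hS') hK hK1 hK2

/-- The boundary of a hyperbolic group does not depend on the finite generating set. -/
theorem IsHyperbolicGroup.exists_homeomorph (hG : IsHyperbolicGroup G) (hS : S.Finite)
    (hS' : Subgroup.closure S = ⊤) (hT : S'.Finite) (hT' : Subgroup.closure S' = ⊤) :
    ∃ h : GromovBoundary (SimpleGraph.mulCayley S) ≃ₜ GromovBoundary (SimpleGraph.mulCayley S'),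
      ∀ (g : G) ξ, h (g • ξ) = g • h ξ := by
  obtain ⟨δ, hδ⟩ := hG.fourPoint hS hS'
  obtain ⟨δ', hδ'⟩ := hG.fourPoint hT hT'
  obtain ⟨K, hK, hK1, hK2⟩ := exists_bilipschitz hS hS' hT hT'
  obtain ⟨h, hh⟩ := hδ.exists_homeomorph hδ' (mulCayley_proper hS hS') (mulCayley_proper hT hT')
    (fun R => by
      -- Contrapositive of coarse control: a product that is bounded in one metric is bounded in the
      -- other, so a large product cannot become small.
      obtain ⟨R', hR'⟩ := hδ'.exists_gromovProd_le_of_le hδ.connected hK hK2 hK1 R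
      refine ⟨R' + 1, fun p x y hp => ?_⟩
      by_contra hcon
      linarith [hR' p x y (not_le.1 hcon).le])
    (fun R => by
      obtain ⟨R', hR'⟩ := hδ.exists_gromovProd_le_of_le hδ'.connected hK hK1 hK2 R
      refine ⟨R' + 1, fun p x y hp => ?_⟩
      by_contra hcon
      linarith [hR' p x y (not_le.1 hcon).le])
  refine ⟨h, fun g ξ => ?_⟩
  obtain ⟨s, hs⟩ := ξ.exists_convTo hδ.connected
  exact (hh _ _ (hs.smul g)).unique hδ' ((hh s ξ hs).smul g)

end Cayley


/-! ### Normal forms in the free product, by letting it act on reduced words. -/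

section NormalForm

variable {A : Type u} {B : Type v} [Group A] [Group B] {H : Type w} [Group H]

/-- The element of the free product given by a letter. -/
def letter : A ⊕ B → A ∗ B := Sum.elim Monoid.Coprod.inl Monoid.Coprod.inr

/-- The element of the free product spelled by a list of letters. -/
def spell (l : List (A ⊕ B)) : A ∗ B := (l.map letter).prod

/-- The inverse letter. -/
def invLetter : A ⊕ B → A ⊕ B := Sum.map (·⁻¹) (·⁻¹)

/-- Reduced words: alternating lists of nontrivial letters. -/
def Red (l : List (A ⊕ B)) : Prop :=
  (∀ x ∈ l, letter x ≠ 1) ∧ l.IsChain (fun x y => x.isLeft ≠ y.isLeft)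

variable (A B H) in
/-- One of the two free factors. -/
structure Side where
  ι : H → A ⊕ B
  φ : H →* A ∗ B
  side : Bool
  get : A ⊕ B → H
  letter_ι : ∀ h, letter (ι h) = φ h
  isLeft_ι : ∀ h, (ι h).isLeft = side
  get_ι : ∀ h, get (ι h) = h
  ι_get : ∀ x, x.isLeft = side → ι (get x) = x
  get_other : ∀ x, x.isLeft ≠ side → get x = 1
  injective : Function.Injective φ

variable (A B) in
/-- The factor `A`. -/
def sideA : Side A B A where
  ι := Sum.inl
  φ := Monoid.Coprod.inl
  side := true
  get := Sum.elim id (fun _ => 1)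
  letter_ι _ := rfl
  isLeft_ι _ := rfl
  get_ι _ := rfl
  ι_get x h := by cases x <;> simp_all
  get_other x h := by cases x <;> simp_all
  injective := Monoid.Coprod.inl_injective

variable (A B) in
/-- The factor `B`. -/
def sideB : Side A B B where
  ι := Sum.inr
  φ := Monoid.Coprod.inr
  side := false
  get := Sum.elim (fun _ => 1) id
  letter_ι _ := rfl
  isLeft_ι _ := rfl
  get_ι _ := rfl
  ι_get x h := by cases x <;> simp_all
  get_other x h := by cases x <;> simp_all
  injective := Monoid.Coprod.inr_injective

@[simp] theorem spell_nil : spell ([] : List (A ⊕ B)) = 1 := rfl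

@[simp] theorem spell_cons (x : A ⊕ B) (l : List (A ⊕ B)) :
    spell (x :: l) = letter x * spell l := by simp [spell]

@[simp] theorem spell_append (l m : List (A ⊕ B)) : spell (l ++ m) = spell l * spell m := by
  simp [spell]

theorem letter_invLetter (x : A ⊕ B) : letter (invLetter x) = (letter x)⁻¹ := by
  cases x <;> simp [letter, invLetter]

theorem isLeft_invLetter (x : A ⊕ B) : (invLetter x).isLeft = x.isLeft := by
  cases x <;> rfl

theorem Red.nil : Red ([] : List (A ⊕ B)) := by simp [Red]

theorem red_cons {x : A ⊕ B} {l : List (A ⊕ B)} :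
    Red (x :: l) ↔ letter x ≠ 1 ∧ (∀ y ∈ l.head?, x.isLeft ≠ y.isLeft) ∧ Red l := by
  simp only [Red, List.mem_cons, forall_eq_or_imp, List.isChain_cons]
  tauto

theorem red_append {l m : List (A ⊕ B)} :
    Red (l ++ m) ↔ Red l ∧ Red m ∧ ∀ x ∈ l.getLast?, ∀ y ∈ m.head?, x.isLeft ≠ y.isLeft := by
  simp only [Red, List.mem_append, or_imp, forall_and, List.isChain_append]
  tauto

namespace Side

variable (s : Side A B H)

/-- The reduced word of length at most one given by an element of the factor. -/
def tail (h : H) : List (A ⊕ B) := open Classical in if h = 1 then [] else [s.ι h]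

/-- The first letter, if it belongs to the factor. -/
def head : List (A ⊕ B) → H
  | [] => 1
  | x :: _ => s.get x

/-- What remains after removing the first letter if it belongs to the factor. -/
def drop : List (A ⊕ B) → List (A ⊕ B)
  | [] => []
  | x :: t => if x.isLeft = s.side then t else x :: t

/-- The first letter does not belong to the factor. -/
def Free (l : List (A ⊕ B)) : Prop := ∀ x ∈ l.head?, x.isLeft ≠ s.side

/-- Left multiplication of a word by an element of the factor. -/
def cons (h : H) (l : List (A ⊕ B)) : List (A ⊕ B) := s.tail (h * s.head l) ++ s.drop l

@[simp] theorem tail_one : s.tail 1 = [] := by simp [tail]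

theorem tail_of_ne {h : H} (hh : h ≠ 1) : s.tail h = [s.ι h] := by simp [tail, hh]

theorem spell_tail (h : H) : spell (s.tail h) = s.φ h := by
  by_cases hh : h = 1
  · simp [hh]
  · simp [s.tail_of_ne hh, s.letter_ι]

theorem red_tail (h : H) : Red (s.tail h) := by
  by_cases hh : h = 1
  · simp [hh, Red.nil]
  · rw [s.tail_of_ne hh, red_cons]
    refine ⟨?_, by simp, Red.nil⟩
    rw [s.letter_ι]
    exact fun h1 => hh (s.injective (h1.trans (map_one _).symm))

theorem red_tail_append (h : H) {l : List (A ⊕ B)} (hl : Red l) (hf : s.Free l) :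
    Red (s.tail h ++ l) := by
  by_cases hh : h = 1
  · simpa [hh] using hl
  · refine red_append.2 ⟨s.red_tail h, hl, ?_⟩
    rw [s.tail_of_ne hh]
    intro x hx y hy
    simp only [List.getLast?_singleton, Option.mem_def, Option.some.injEq] at hx
    rw [← hx, s.isLeft_ι]
    exact (hf y hy).symm

theorem head_of_free {l : List (A ⊕ B)} (hf : s.Free l) : s.head l = 1 := by
  cases l with
  | nil => rfl
  | cons x t => exact s.get_other x (hf x (by simp))

theorem drop_of_free {l : List (A ⊕ B)} (hf : s.Free l) : s.drop l = l := by
  cases l with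
  | nil => rfl
  | cons x t => exact if_neg (hf x (by simp))

theorem head_tail_append (h : H) {l : List (A ⊕ B)} (hf : s.Free l) :
    s.head (s.tail h ++ l) = h := by
  by_cases hh : h = 1
  · simp [hh, s.head_of_free hf]
  · simp [s.tail_of_ne hh, head, s.get_ι]

theorem drop_tail_append (h : H) {l : List (A ⊕ B)} (hf : s.Free l) :
    s.drop (s.tail h ++ l) = l := by
  by_cases hh : h = 1
  · simp [hh, s.drop_of_free hf]
  · simp [s.tail_of_ne hh, drop, s.isLeft_ι]

theorem free_drop {l : List (A ⊕ B)} (hl : Red l) : s.Free (s.drop l) := by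
  cases l with
  | nil => simp [Free, drop]
  | cons x t =>
    by_cases hx : x.isLeft = s.side
    · simp only [drop, hx, if_true]
      exact fun y hy => hx ▸ ((red_cons.1 hl).2.1 y hy).symm
    · simp only [drop, hx, if_false]
      intro y hy
      simp only [List.head?_cons, Option.mem_def, Option.some.injEq] at hy
      exact hy ▸ hx

theorem red_drop {l : List (A ⊕ B)} (hl : Red l) : Red (s.drop l) := by
  cases l with
  | nil => exact hl
  | cons x t =>
    unfold drop
    dsimp only
    split_ifs
    · exact (red_cons.1 hl).2.2
    · exact hl

theorem tail_head_append_drop {l : List (A ⊕ B)} (hl : Red l) :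
    s.tail (s.head l) ++ s.drop l = l := by
  cases l with
  | nil => simp [head, drop]
  | cons x t =>
    by_cases hx : x.isLeft = s.side
    · have h1 : s.get x ≠ 1 := by
        intro h1
        have := s.letter_ι (s.get x)
        rw [s.ι_get x hx, h1, map_one] at this
        exact (red_cons.1 hl).1 this
      simp [head, drop, hx, s.tail_of_ne h1, s.ι_get x hx]
    · simp [head, drop, hx, s.get_other x hx]

theorem red_cons' (h : H) {l : List (A ⊕ B)} (hl : Red l) : Red (s.cons h l) :=
  s.red_tail_append _ (s.red_drop hl) (s.free_drop hl)

theorem cons_one {l : List (A ⊕ B)} (hl : Red l) : s.cons 1 l = l := by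
  rw [cons, one_mul, s.tail_head_append_drop hl]

/-- A reduced word splits uniquely into an element of the factor and a remainder not starting in the
factor; multiplication touches only the former. Each factor thus acts on reduced words, and the
universal property makes the free product act (van der Waerden's method). -/
theorem cons_mul (h k : H) {l : List (A ⊕ B)} (hl : Red l) :
    s.cons (h * k) l = s.cons h (s.cons k l) := by
  simp only [cons]
  rw [s.head_tail_append _ (s.free_drop hl), s.drop_tail_append _ (s.free_drop hl), mul_assoc]

theorem spell_cons (h : H) {l : List (A ⊕ B)} (hl : Red l) :
    spell (s.cons h l) = s.φ h * spell l := by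
  conv_rhs => rw [← s.tail_head_append_drop hl]
  simp [cons, s.spell_tail, mul_assoc]

/-- The action of the factor on reduced words. -/
def act : H →* Function.End {l : List (A ⊕ B) // Red l} where
  toFun h := fun l => ⟨s.cons h l.1, s.red_cons' h l.2⟩
  map_one' := by
    funext l
    exact Subtype.ext (s.cons_one l.2)
  map_mul' h k := by
    funext l
    exact Subtype.ext (s.cons_mul h k l.2)

end Side

/-- The action of the free product on reduced words. -/
def wordAct : A ∗ B →* Function.End {l : List (A ⊕ B) // Red l} :=
  Monoid.Coprod.lift (sideA A B).act (sideB A B).act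

/-- The normal form of an element of the free product. -/
def nf (g : A ∗ B) : List (A ⊕ B) := (wordAct g ⟨[], Red.nil⟩).1

theorem red_nf (g : A ∗ B) : Red (nf g) := (wordAct g ⟨[], Red.nil⟩).2

theorem nf_inl_mul (a : A) (g : A ∗ B) :
    nf (Monoid.Coprod.inl a * g) = (sideA A B).cons a (nf g) := by
  simp only [nf, map_mul, wordAct, Monoid.Coprod.lift_apply_inl]
  rfl

theorem nf_inr_mul (b : B) (g : A ∗ B) :
    nf (Monoid.Coprod.inr b * g) = (sideB A B).cons b (nf g) := by
  simp only [nf, map_mul, wordAct, Monoid.Coprod.lift_apply_inr]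
  rfl

theorem nf_one : nf (1 : A ∗ B) = [] := by
  rw [nf, map_one]
  rfl

theorem spell_nf (g : A ∗ B) : spell (nf g) = g := by
  have key : ∀ l : List (A ⊕ B), spell (nf (spell l)) = spell l := by
    intro l
    induction l with
    | nil => simp [nf_one]
    | cons x t ih =>
      cases x with
      | inl a =>
        rw [spell_cons, letter, Sum.elim_inl, nf_inl_mul, Side.spell_cons _ _ (red_nf _), ih]
        rfl
      | inr b =>
        rw [spell_cons, letter, Sum.elim_inr, nf_inr_mul, Side.spell_cons _ _ (red_nf _), ih]
        rfl
  obtain ⟨l, rfl⟩ : ∃ l, g = spell l := by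
    obtain ⟨l, rfl⟩ := Monoid.Coprod.mk_surjective g
    induction l using FreeMonoid.recOn with
    | one => exact ⟨[], by simp⟩
    | of_mul x t ih =>
      obtain ⟨m, hm⟩ := ih
      refine ⟨x :: m, ?_⟩
      rw [map_mul, hm, spell_cons]
      cases x <;> rfl
  exact key l

/-- Uniqueness of normal forms: when a reduced word is built up from the empty one, each letter
meets a word that does not start in its factor, so acting merely prepends it. -/
theorem nf_spell {l : List (A ⊕ B)} (hl : Red l) : nf (spell l) = l := by
  induction l with
  | nil => exact nf_one
  | cons x t ih =>
    obtain ⟨h1, h2, h3⟩ := red_cons.1 hl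
    cases x with
    | inl a =>
      have hf : (sideA A B).Free t := fun y hy => (h2 y hy).symm
      have ha : a ≠ 1 := by
        rintro rfl
        exact h1 (map_one _)
      rw [spell_cons, letter, Sum.elim_inl, nf_inl_mul, ih h3, Side.cons, Side.head_of_free _ hf,
        Side.drop_of_free _ hf, mul_one, Side.tail_of_ne _ ha]
      rfl
    | inr b =>
      have hf : (sideB A B).Free t := fun y hy => (h2 y hy).symm
      have hb : b ≠ 1 := by
        rintro rfl
        exact h1 (map_one _)
      rw [spell_cons, letter, Sum.elim_inr, nf_inr_mul, ih h3, Side.cons, Side.head_of_free _ hf,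
        Side.drop_of_free _ hf, mul_one, Side.tail_of_ne _ hb]
      rfl

theorem nf_eq_of_spell_eq {l : List (A ⊕ B)} (hl : Red l) {g : A ∗ B} (h : spell l = g) :
    nf g = l := h ▸ nf_spell hl

namespace Side

variable (s : Side A B H)

theorem nf_φ_mul (h : H) (g : A ∗ B) : nf (s.φ h * g) = s.cons h (nf g) :=
  nf_eq_of_spell_eq (s.red_cons' h (red_nf g)) (by rw [s.spell_cons h (red_nf g), spell_nf])

theorem nf_φ (h : H) : nf (s.φ h) = s.tail h := nf_eq_of_spell_eq (s.red_tail h) (s.spell_tail h)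

/-- The projection of the free product to one of its factors: the first letter of the normal form,
if it belongs to the factor. -/
def π (g : A ∗ B) : H := s.head (nf g)

theorem π_φ_mul (h : H) (g : A ∗ B) : s.π (s.φ h * g) = h * s.π g := by
  rw [π, nf_φ_mul, cons, s.head_tail_append _ (s.free_drop (red_nf g))]
  rfl

@[simp] theorem π_one : s.π 1 = 1 := by rw [π, nf_one]; rfl

@[simp] theorem π_φ (h : H) : s.π (s.φ h) = h := by
  have := s.π_φ_mul h 1
  simpa using this

/-- The last letter is split off if it lies in the factor, with `h = 1` otherwise; right
multiplication by the factor changes only this last piece. -/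
theorem exists_nf_mul_φ (g : A ∗ B) : ∃ l h, Red l ∧ nf g = l ++ s.tail h ∧
    ∀ k, nf (g * s.φ k) = l ++ s.tail (h * k) := by
  obtain ⟨l, h, hl, hg, hend⟩ : ∃ l h, Red l ∧ nf g = l ++ s.tail h ∧
      ∀ x ∈ l.getLast?, x.isLeft ≠ s.side := by
    have hred := red_nf g
    rcases List.eq_nil_or_concat (nf g) with h0 | ⟨l, x, hlx⟩
    · exact ⟨[], 1, Red.nil, by simp [h0], by simp⟩
    · rw [List.concat_eq_append] at hlx
      rw [hlx, red_append, red_cons] at hred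
      by_cases hx : x.isLeft = s.side
      · refine ⟨l, s.get x, hred.1, ?_, fun y hy => ?_⟩
        · have h1 : s.get x ≠ 1 := by
            intro h1
            have := s.letter_ι (s.get x)
            rw [s.ι_get x hx, h1, map_one] at this
            exact hred.2.1.1 this
          rw [hlx, s.tail_of_ne h1, s.ι_get x hx]
        · exact hx ▸ hred.2.2 y hy x (by simp)
      · refine ⟨nf g, 1, red_nf g, by simp, fun y hy => ?_⟩
        rw [hlx] at hy
        simp only [List.getLast?_append, List.getLast?_singleton, Option.some_or, Option.mem_def,
          Option.some.injEq] at hy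
        exact hy ▸ hx
  refine ⟨l, h, hl, hg, fun k => nf_eq_of_spell_eq ?_ ?_⟩
  · by_cases hk : h * k = 1
    · simpa [hk] using hl
    · refine red_append.2 ⟨hl, s.red_tail _, fun x hx y hy => ?_⟩
      rw [s.tail_of_ne hk] at hy
      simp only [List.head?_cons, Option.mem_def, Option.some.injEq] at hy
      rw [← hy, s.isLeft_ι]
      exact hend x hx
  · rw [← spell_nf g, hg]
    simp [s.spell_tail, mul_assoc]

theorem head_append_of_ne_nil {l : List (A ⊕ B)} (hl : l ≠ []) (m : List (A ⊕ B)) :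
    s.head (l ++ m) = s.head l := by
  cases l with
  | nil => exact absurd rfl hl
  | cons x t => rfl

/-- Outside the factor something precedes the part changed by the multiplication, so the first
letter survives. Hence the projection is constant on every coset of the factor except the factor
itself. -/
theorem π_mul_φ {g : A ∗ B} (hg : g ∉ s.φ.range) (k : H) : s.π (g * s.φ k) = s.π g := by
  obtain ⟨l, h, -, h1, h2⟩ := s.exists_nf_mul_φ g
  have hl : l ≠ [] := by
    rintro rfl
    exact hg ⟨h, by rw [← s.spell_tail, ← spell_nf g, h1, List.nil_append]⟩
  rw [π, π, h2 k, h1, s.head_append_of_ne_nil hl, s.head_append_of_ne_nil hl]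

theorem π_mul_other {K : Type*} [Group K] (t : Side A B K) (hst : s.side ≠ t.side) (g : A ∗ B)
    (k : K) : s.π (g * t.φ k) = s.π g := by
  obtain ⟨l, h, -, h1, h2⟩ := t.exists_nf_mul_φ g
  have hone : ∀ k, s.head (t.tail k) = 1 := by
    intro k
    by_cases hk : k = 1
    · rw [hk, t.tail_one]
      rfl
    · rw [t.tail_of_ne hk]
      exact s.get_other _ (by rw [t.isLeft_ι]; exact hst.symm)
  rw [π, π, h2 k, h1]
  by_cases hl : l = []
  · simp [hl, hone]
  · rw [s.head_append_of_ne_nil hl, s.head_append_of_ne_nil hl]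

end Side

end NormalForm


/-! ### The word metric of the free product and its hyperbolicity. -/

section Metric

variable {A : Type u} {B : Type v} [Group A] [Group B] {SA : Set A} {SB : Set B}

/-- The generating set of the free product given by generating sets of the factors. -/
def coprodGen (SA : Set A) (SB : Set B) : Set (A ∗ B) :=
  Monoid.Coprod.inl '' SA ∪ Monoid.Coprod.inr '' SB

theorem coprodGen_finite (hA : SA.Finite) (hB : SB.Finite) : (coprodGen SA SB).Finite :=
  (hA.image _).union (hB.image _)

theorem closure_coprodGen (hA : Subgroup.closure SA = ⊤) (hB : Subgroup.closure SB = ⊤) :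
    Subgroup.closure (coprodGen SA SB) = ⊤ := by
  rw [coprodGen, Subgroup.closure_union, ← MonoidHom.map_closure, ← MonoidHom.map_closure, hA, hB,
    ← MonoidHom.range_eq_map, ← MonoidHom.range_eq_map, Monoid.Coprod.range_inl_sup_range_inr]

/-- The Cayley graph of the free product. -/
abbrev coprodGraph (SA : Set A) (SB : Set B) : SimpleGraph (A ∗ B) :=
  SimpleGraph.mulCayley (coprodGen SA SB)

/-- The length of a letter. -/
def letterLength (SA : Set A) (SB : Set B) : A ⊕ B → ℕ
  | .inl a => (SimpleGraph.mulCayley SA).dist 1 a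
  | .inr b => (SimpleGraph.mulCayley SB).dist 1 b

/-- The length of a word. -/
def wordLength (SA : Set A) (SB : Set B) (l : List (A ⊕ B)) : ℕ :=
  (l.map (letterLength SA SB)).sum

/-- The Gromov product of letters, which vanishes for letters of different factors. -/
def letterProd (SA : Set A) (SB : Set B) : A ⊕ B → A ⊕ B → ℝ
  | .inl a, .inl a' => gromovProd (SimpleGraph.mulCayley SA) 1 a a'
  | .inr b, .inr b' => gromovProd (SimpleGraph.mulCayley SB) 1 b b'
  | _, _ => 0

open Classical in
/-- The Gromov product of words: the length of the common prefix plus the Gromov product of the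
first different letters. -/
def wordProd (SA : Set A) (SB : Set B) : List (A ⊕ B) → List (A ⊕ B) → ℝ
  | x :: l, y :: m =>
    if x = y then letterLength SA SB x + wordProd SA SB l m else letterProd SA SB x y
  | [], _ => 0
  | _ :: _, [] => 0

@[simp] theorem wordLength_nil : wordLength SA SB [] = 0 := rfl

@[simp] theorem wordLength_cons (x : A ⊕ B) (l : List (A ⊕ B)) :
    wordLength SA SB (x :: l) = letterLength SA SB x + wordLength SA SB l := by
  simp [wordLength]

@[simp] theorem wordLength_append (l m : List (A ⊕ B)) :
    wordLength SA SB (l ++ m) = wordLength SA SB l + wordLength SA SB m := by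
  simp [wordLength]

@[simp] theorem wordProd_nil_left (m : List (A ⊕ B)) : wordProd SA SB [] m = 0 := by
  simp [wordProd]

@[simp] theorem wordProd_nil_right (l : List (A ⊕ B)) : wordProd SA SB l [] = 0 := by
  cases l <;> simp [wordProd]

theorem wordProd_cons_self (x : A ⊕ B) (l m : List (A ⊕ B)) :
    wordProd SA SB (x :: l) (x :: m) = letterLength SA SB x + wordProd SA SB l m := by
  simp [wordProd]

theorem wordProd_cons_of_ne {x y : A ⊕ B} (h : x ≠ y) (l m : List (A ⊕ B)) :
    wordProd SA SB (x :: l) (y :: m) = letterProd SA SB x y := by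
  simp [wordProd, h]

theorem wordProd_append (w l m : List (A ⊕ B)) :
    wordProd SA SB (w ++ l) (w ++ m) = wordLength SA SB w + wordProd SA SB l m := by
  induction w with
  | nil => simp
  | cons x w ih =>
    simp only [List.cons_append, wordProd_cons_self, ih, wordLength_cons]
    push_cast
    ring

theorem letterProd_nonneg (hA : (SimpleGraph.mulCayley SA).Connected)
    (hB : (SimpleGraph.mulCayley SB).Connected) (x y : A ⊕ B) : 0 ≤ letterProd SA SB x y := by
  rcases x with a | b <;> rcases y with a' | b'
  · exact gromovProd_nonneg hA _ _ _
  · exact le_rfl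
  · exact le_rfl
  · exact gromovProd_nonneg hB _ _ _

theorem letterProd_of_ne {x y : A ⊕ B} (h : x.isLeft ≠ y.isLeft) : letterProd SA SB x y = 0 := by
  rcases x with a | b <;> rcases y with a' | b' <;> first | rfl | exact absurd rfl h

theorem letterProd_le_left (hA : (SimpleGraph.mulCayley SA).Connected)
    (hB : (SimpleGraph.mulCayley SB).Connected) (x y : A ⊕ B) :
    letterProd SA SB x y ≤ letterLength SA SB x := by
  rcases x with a | b <;> rcases y with a' | b'
  · exact gromovProd_le_left hA _ _ _
  · exact Nat.cast_nonneg _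
  · exact Nat.cast_nonneg _
  · exact gromovProd_le_left hB _ _ _

theorem wordProd_nonneg (hA : (SimpleGraph.mulCayley SA).Connected)
    (hB : (SimpleGraph.mulCayley SB).Connected) (l m : List (A ⊕ B)) :
    0 ≤ wordProd SA SB l m := by
  induction l generalizing m with
  | nil => simp
  | cons x l ih =>
    cases m with
    | nil => simp
    | cons y m =>
      by_cases hxy : x = y
      · subst hxy
        rw [wordProd_cons_self]
        have := ih m
        positivity
      · rw [wordProd_cons_of_ne hxy]
        exact letterProd_nonneg hA hB x y

theorem letterProd_four_point {δ : ℝ} (hA : FourPoint (SimpleGraph.mulCayley SA) δ)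
    (hB : FourPoint (SimpleGraph.mulCayley SB) δ) (x y z : A ⊕ B) :
    min (letterProd SA SB x y) (letterProd SA SB y z) - δ ≤ letterProd SA SB x z := by
  have h0 := letterProd_nonneg hA.connected hB.connected x z
  have hδ := hA.nonneg
  by_cases hxy : x.isLeft = y.isLeft
  · by_cases hyz : y.isLeft = z.isLeft
    · rcases x with a | b <;> rcases y with a' | b' <;> simp at hxy <;>
        rcases z with a'' | b'' <;> simp at hyz
      · exact hA.min_le _ _ _ _
      · exact hB.min_le _ _ _ _
    · rw [letterProd_of_ne hyz]
      linarith [min_le_right (letterProd SA SB x y) 0]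
  · rw [letterProd_of_ne hxy]
    linarith [min_le_left 0 (letterProd SA SB y z)]

/-- A first letter common to all three words adds the same length to every term and can be removed;
otherwise the first letters decide, up to the cases of two equal ones. So the constant of the
factors does not grow. -/
theorem wordProd_four_point {δ : ℝ} (hA : FourPoint (SimpleGraph.mulCayley SA) δ)
    (hB : FourPoint (SimpleGraph.mulCayley SB) δ) (l m n : List (A ⊕ B)) :
    min (wordProd SA SB l m) (wordProd SA SB m n) - δ ≤ wordProd SA SB l n := by
  have cA := hA.connected
  have cB := hB.connected
  have hδ := hA.nonneg
  induction l generalizing m n with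
  | nil =>
    rw [wordProd_nil_left, wordProd_nil_left]
    linarith [min_le_left 0 (wordProd SA SB m n)]
  | cons x l ih =>
    have h0 := wordProd_nonneg cA cB (x :: l) n
    cases m with
    | nil =>
      rw [wordProd_nil_right, wordProd_nil_left, min_self]
      linarith
    | cons y m =>
      cases n with
      | nil =>
        rw [wordProd_nil_right, wordProd_nil_right]
        linarith [min_le_right (wordProd SA SB (x :: l) (y :: m)) 0]
      | cons z n =>
        by_cases hxy : x = y
        · subst hxy
          by_cases hxz : x = z
          · subst hxz
            simp only [wordProd_cons_self, min_add_add_left]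
            linarith [ih m n]
          · rw [wordProd_cons_of_ne hxz, wordProd_cons_of_ne hxz]
            linarith [min_le_right (wordProd SA SB (x :: l) (x :: m)) (letterProd SA SB x z)]
        · by_cases hyz : y = z
          · subst hyz
            rw [wordProd_cons_of_ne hxy, wordProd_cons_of_ne hxy]
            linarith [min_le_left (letterProd SA SB x y) (wordProd SA SB (y :: m) (y :: n))]
          · rw [wordProd_cons_of_ne hxy, wordProd_cons_of_ne hyz]
            by_cases hxz : x = z
            -- The outer words share a first letter that the middle one lacks: the product with the
            -- middle word is at most the length of that letter, which the outer product already
            -- contains.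
            · subst hxz
              rw [wordProd_cons_self]
              have h1 := min_le_left (letterProd SA SB x y) (letterProd SA SB y x)
              have h2 := letterProd_le_left cA cB x y
              have h3 := wordProd_nonneg cA cB l n
              linarith
            · rw [wordProd_cons_of_ne hxz]
              exact letterProd_four_point hA hB x y z

/-! ### The word metric -/

theorem letterLength_invLetter (x : A ⊕ B) :
    letterLength SA SB (invLetter x) = letterLength SA SB x := by
  rcases x with a | b
  · exact dist_one_inv SA a
  · exact dist_one_inv SB b

theorem wordLength_tail_inl (a : A) :
    wordLength SA SB ((sideA A B).tail a) = (SimpleGraph.mulCayley SA).dist 1 a := by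
  by_cases ha : a = 1
  · simp [ha]
  · rw [Side.tail_of_ne _ ha, wordLength_cons, wordLength_nil, add_zero]
    rfl

theorem wordLength_tail_inr (b : B) :
    wordLength SA SB ((sideB A B).tail b) = (SimpleGraph.mulCayley SB).dist 1 b := by
  by_cases hb : b = 1
  · simp [hb]
  · rw [Side.tail_of_ne _ hb, wordLength_cons, wordLength_nil, add_zero]
    rfl

theorem dist_one_mul_le {G : Type*} [Group G] {S : Set G}
    (hS : (SimpleGraph.mulCayley S).Connected) (g h : G) :
    (SimpleGraph.mulCayley S).dist 1 (g * h) ≤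
      (SimpleGraph.mulCayley S).dist 1 g + (SimpleGraph.mulCayley S).dist 1 h := by
  have := hS.dist_triangle (u := 1) (v := g) (w := g * h)
  rwa [← dist_mul_left S g 1 h, mul_one]

theorem wordLength_nf_inl_mul_le (hA : (SimpleGraph.mulCayley SA).Connected) (a : A) (g : A ∗ B) :
    wordLength SA SB (nf (Monoid.Coprod.inl a * g)) ≤
      (SimpleGraph.mulCayley SA).dist 1 a + wordLength SA SB (nf g) := by
  rw [nf_inl_mul]
  conv_rhs => rw [← (sideA A B).tail_head_append_drop (red_nf g)]
  rw [Side.cons, wordLength_append, wordLength_append, wordLength_tail_inl, wordLength_tail_inl]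
  have := dist_one_mul_le hA a ((sideA A B).head (nf g))
  omega

theorem wordLength_nf_inr_mul_le (hB : (SimpleGraph.mulCayley SB).Connected) (b : B) (g : A ∗ B) :
    wordLength SA SB (nf (Monoid.Coprod.inr b * g)) ≤
      (SimpleGraph.mulCayley SB).dist 1 b + wordLength SA SB (nf g) := by
  rw [nf_inr_mul]
  conv_rhs => rw [← (sideB A B).tail_head_append_drop (red_nf g)]
  rw [Side.cons, wordLength_append, wordLength_append, wordLength_tail_inr, wordLength_tail_inr]
  have := dist_one_mul_le hB b ((sideB A B).head (nf g))
  omega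

theorem dist_one_generator_le {G : Type*} [Group G] {S : Set G} {s : G} (hs : s ∈ S) :
    (SimpleGraph.mulCayley S).dist 1 s ≤ 1 := by
  by_cases h : (1 : G) = s
  · simp [← h]
  · exact (SimpleGraph.dist_eq_one_iff_adj.2 ((SimpleGraph.mulCayley_adj S 1 s).2
      ⟨h, Or.inl (by simpa using hs)⟩)).le

theorem dist_one_map_le {G K : Type*} [Group G] [Group K] {S : Set G} {T : Set K}
    (hS : Subgroup.closure S = ⊤) (hT : (SimpleGraph.mulCayley T).Connected) (f : G →* K)
    (hf : ∀ s ∈ S, f s ∈ T) (g : G) :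
    (SimpleGraph.mulCayley T).dist 1 (f g) ≤ (SimpleGraph.mulCayley S).dist 1 g := by
  obtain ⟨p, hp⟩ := (mulCayley_connected hS).exists_walk_length_eq_dist 1 g
  rw [← hp, ← map_one f]
  clear hp
  generalize (1 : G) = e at p
  induction p with
  | nil => simp
  | @cons a b c hadj q ih =>
    have h1 : (SimpleGraph.mulCayley T).dist (f a) (f b) ≤ 1 := by
      rcases ((SimpleGraph.mulCayley_adj S a b).1 hadj).2 with h | h
      · rw [dist_eq_dist_one, ← map_inv, ← map_mul]
        exact dist_one_generator_le (hf _ h)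
      · rw [SimpleGraph.dist_comm, dist_eq_dist_one, ← map_inv, ← map_mul]
        exact dist_one_generator_le (hf _ h)
    have h2 := hT.dist_triangle (u := f a) (v := f b) (w := f c)
    rw [SimpleGraph.Walk.length_cons]
    omega

section Generating

variable (hA : Subgroup.closure SA = ⊤) (hB : Subgroup.closure SB = ⊤)
include hA hB

theorem coprodGraph_connected : (coprodGraph SA SB).Connected :=
  mulCayley_connected (closure_coprodGen hA hB)

theorem dist_one_spell_le (l : List (A ⊕ B)) :
    (coprodGraph SA SB).dist 1 (spell l) ≤ wordLength SA SB l := by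
  have hX := coprodGraph_connected hA hB
  induction l with
  | nil => simp
  | cons x l ih =>
    rw [spell_cons, wordLength_cons]
    refine (dist_one_mul_le hX _ _).trans (add_le_add ?_ ih)
    rcases x with a | b
    · exact dist_one_map_le hA hX Monoid.Coprod.inl (fun s hs => Or.inl ⟨s, hs, rfl⟩) a
    · exact dist_one_map_le hB hX Monoid.Coprod.inr (fun s hs => Or.inr ⟨s, hs, rfl⟩) b

theorem wordLength_nf_mul_le {s : A ∗ B} (hs : s ∈ coprodGen SA SB ∨ s⁻¹ ∈ coprodGen SA SB)
    (g : A ∗ B) : wordLength SA SB (nf (s * g)) ≤ 1 + wordLength SA SB (nf g) := by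
  have hinl : ∀ a : A, a ∈ SA ∨ a⁻¹ ∈ SA →
      wordLength SA SB (nf (Monoid.Coprod.inl a * g)) ≤ 1 + wordLength SA SB (nf g) := by
    intro a ha
    refine (wordLength_nf_inl_mul_le (mulCayley_connected hA) a g).trans
      (Nat.add_le_add_right ?_ _)
    rcases ha with ha | ha
    · exact dist_one_generator_le ha
    · rw [← dist_one_inv]
      exact dist_one_generator_le ha
  have hinr : ∀ b : B, b ∈ SB ∨ b⁻¹ ∈ SB →
      wordLength SA SB (nf (Monoid.Coprod.inr b * g)) ≤ 1 + wordLength SA SB (nf g) := by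
    intro b hb
    refine (wordLength_nf_inr_mul_le (mulCayley_connected hB) b g).trans
      (Nat.add_le_add_right ?_ _)
    rcases hb with hb | hb
    · exact dist_one_generator_le hb
    · rw [← dist_one_inv]
      exact dist_one_generator_le hb
  rcases hs with (⟨a, ha, rfl⟩ | ⟨b, hb, rfl⟩) | (⟨a, ha, hs⟩ | ⟨b, hb, hs⟩)
  · exact hinl a (Or.inl ha)
  · exact hinr b (Or.inl hb)
  · rw [← inv_inv s, ← hs, ← map_inv]
    exact hinl _ (Or.inr (by simpa using ha))
  · rw [← inv_inv s, ← hs, ← map_inv]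
    exact hinr _ (Or.inr (by simpa using hb))

/-- Spelling each letter by a geodesic of its factor gives the upper bound. For the lower bound, a
generator multiplied on the left alters only the first letter, hence adds at most one to the length.
-/
theorem dist_one_eq (g : A ∗ B) : (coprodGraph SA SB).dist 1 g = wordLength SA SB (nf g) := by
  refine le_antisymm ?_ ?_
  · have := dist_one_spell_le hA hB (nf g)
    rwa [spell_nf] at this
  · obtain ⟨p, hp⟩ := (coprodGraph_connected hA hB).exists_walk_length_eq_dist 1 g
    rw [← hp]
    have key : ∀ {x y : A ∗ B} (p : (coprodGraph SA SB).Walk x y),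
        wordLength SA SB (nf (x⁻¹ * y)) ≤ p.length := by
      intro x y p
      induction p with
      | nil => simp [nf_one]
      | @cons a b c hadj q ih =>
        have h1 := ((SimpleGraph.mulCayley_adj _ a b).1 hadj).2
        have h2 := wordLength_nf_mul_le hA hB (s := a⁻¹ * b)
          (by rwa [mul_inv_rev, inv_inv]) (b⁻¹ * c)
        rw [show a⁻¹ * b * (b⁻¹ * c) = a⁻¹ * c by group] at h2
        rw [SimpleGraph.Walk.length_cons]
        omega
    simpa using key p

end Generating

theorem Red.reverse_inv {l : List (A ⊕ B)} (hl : Red l) : Red (l.map invLetter).reverse := by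
  refine ⟨fun x hx => ?_, ?_⟩
  · simp only [List.mem_reverse, List.mem_map] at hx
    obtain ⟨y, hy, rfl⟩ := hx
    rw [letter_invLetter, inv_ne_one]
    exact hl.1 y hy
  · rw [List.isChain_reverse, List.isChain_map]
    refine hl.2.imp fun x y hxy => ?_
    simpa only [isLeft_invLetter] using hxy.symm

theorem spell_reverse_inv (l : List (A ⊕ B)) :
    spell (l.map invLetter).reverse = (spell l)⁻¹ := by
  induction l with
  | nil => simp
  | cons x l ih => simp [ih, letter_invLetter]

theorem wordLength_reverse_inv (l : List (A ⊕ B)) :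
    wordLength SA SB (l.map invLetter).reverse = wordLength SA SB l := by
  simp only [wordLength, List.map_reverse, List.sum_reverse, List.map_map]
  congr 1
  exact List.map_congr_left fun x _ => letterLength_invLetter x

theorem getLast?_reverse_inv (l : List (A ⊕ B)) :
    (l.map invLetter).reverse.getLast? = l.head?.map invLetter := by
  simp

section Generating

variable (hA : Subgroup.closure SA = ⊤) (hB : Subgroup.closure SB = ⊤)
include hA hB

/-- Left invariance removes the common prefix. After that, inverting one word and appending the
other yields a reduced word, except that two first letters of the same factor merge into one
nontrivial letter. -/
theorem dist_spell {l m : List (A ⊕ B)} (hl : Red l) (hm : Red m) :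
    ((coprodGraph SA SB).dist (spell l) (spell m) : ℝ) =
      wordLength SA SB l + wordLength SA SB m - 2 * wordProd SA SB l m := by
  have hone : ∀ {m : List (A ⊕ B)}, Red m →
      (coprodGraph SA SB).dist 1 (spell m) = wordLength SA SB m := fun hm => by
    rw [dist_one_eq hA hB, nf_spell hm]
  induction l generalizing m with
  | nil => simp [hone hm]
  | cons x l ih =>
    cases m with
    | nil => rw [SimpleGraph.dist_comm, spell_nil, hone hl]; simp
    | cons y m =>
      obtain ⟨hx1, hx2, hx3⟩ := red_cons.1 hl
      obtain ⟨hy1, hy2, hy3⟩ := red_cons.1 hm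
      by_cases hxy : x = y
      · subst hxy
        rw [spell_cons, spell_cons, dist_mul_left, ih hx3 hy3, wordProd_cons_self,
          wordLength_cons, wordLength_cons]
        push_cast
        ring
      · have hlast : ∀ {l : List (A ⊕ B)} {z : A ⊕ B},
            z ∈ (l.map invLetter).reverse.getLast? → ∃ t ∈ l.head?, z.isLeft = t.isLeft := by
          intro l z hz
          rw [getLast?_reverse_inv] at hz
          cases l with
          | nil => simp at hz
          | cons t l =>
            refine ⟨t, by simp, ?_⟩
            simp only [List.head?_cons, Option.map_some, Option.mem_def,
              Option.some.injEq] at hz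
            rw [← hz, isLeft_invLetter]
        rw [wordProd_cons_of_ne hxy, dist_eq_dist_one]
        by_cases hside : x.isLeft = y.isLeft
        · -- the two letters amalgamate
          obtain ⟨z, hz, hz1, hzlen⟩ : ∃ z : A ⊕ B, letter z = (letter x)⁻¹ * letter y ∧
              z.isLeft = x.isLeft ∧ (letterLength SA SB z : ℝ) =
                letterLength SA SB x + letterLength SA SB y - 2 * letterProd SA SB x y := by
            rcases x with a | b <;> rcases y with a' | b' <;> simp at hside
            · refine ⟨.inl (a⁻¹ * a'), by simp [letter], rfl, ?_⟩
              simp only [letterLength, letterProd, gromovProd, ← dist_eq_dist_one]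
              ring
            · refine ⟨.inr (b⁻¹ * b'), by simp [letter], rfl, ?_⟩
              simp only [letterLength, letterProd, gromovProd, ← dist_eq_dist_one]
              ring
          have hz2 : letter z ≠ 1 := by
            rw [hz]
            intro h
            have h' := inv_mul_eq_one.1 h
            rcases x with a | b <;> rcases y with a' | b' <;> simp at hside
            · exact hxy (congrArg _ (Monoid.Coprod.inl_injective h'))
            · exact hxy (congrArg _ (Monoid.Coprod.inr_injective h'))
          have hred : Red ((l.map invLetter).reverse ++ (z :: m)) := by
            refine red_append.2 ⟨hx3.reverse_inv, red_cons.2 ⟨hz2, ?_, hy3⟩, ?_⟩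
            · intro t ht
              rw [hz1, hside]
              exact hy2 t ht
            · intro t ht t' ht'
              obtain ⟨r, hr, htr⟩ := hlast ht
              simp only [List.head?_cons, Option.mem_def, Option.some.injEq] at ht'
              rw [htr, ← ht', hz1]
              exact (hx2 r hr).symm
          have hsp : (spell (x :: l))⁻¹ * spell (y :: m) =
              spell ((l.map invLetter).reverse ++ (z :: m)) := by
            rw [spell_append, spell_reverse_inv, spell_cons, spell_cons, spell_cons, hz]
            group
          rw [hsp, hone hred, wordLength_append, wordLength_reverse_inv, wordLength_cons,
            wordLength_cons, wordLength_cons]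
          push_cast
          rw [hzlen]
          ring
        · have hred : Red (((x :: l).map invLetter).reverse ++ (y :: m)) := by
            refine red_append.2 ⟨hl.reverse_inv, hm, ?_⟩
            intro t ht t' ht'
            obtain ⟨r, hr, htr⟩ := hlast ht
            simp only [List.head?_cons, Option.mem_def, Option.some.injEq] at ht' hr
            rw [htr, ← ht', ← hr]
            exact hside
          have hsp : (spell (x :: l))⁻¹ * spell (y :: m) =
              spell (((x :: l).map invLetter).reverse ++ (y :: m)) := by
            rw [spell_append, spell_reverse_inv]
          rw [hsp, hone hred, wordLength_append, wordLength_reverse_inv,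
            letterProd_of_ne hside]
          push_cast
          ring

theorem gromovProd_one_eq (g h : A ∗ B) :
    gromovProd (coprodGraph SA SB) 1 g h = wordProd SA SB (nf g) (nf h) := by
  have h1 := dist_spell hA hB (red_nf g) (red_nf h)
  rw [spell_nf, spell_nf] at h1
  rw [gromovProd, h1, dist_one_eq hA hB, dist_one_eq hA hB]
  ring

theorem gromovProd_eq (o g h : A ∗ B) :
    gromovProd (coprodGraph SA SB) o g h = wordProd SA SB (nf (o⁻¹ * g)) (nf (o⁻¹ * h)) := by
  rw [← gromovProd_one_eq hA hB, ← gromovProd_smul (X := coprodGraph SA SB) o⁻¹ o]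
  simp only [smul_eq_mul, inv_mul_cancel]

/-- A free product of hyperbolic groups is hyperbolic. -/
theorem coprodGraph_fourPoint {δ δ' : ℝ} (h : FourPoint (SimpleGraph.mulCayley SA) δ)
    (h' : FourPoint (SimpleGraph.mulCayley SB) δ') :
    FourPoint (coprodGraph SA SB) (max δ δ') := by
  have h1 : FourPoint (SimpleGraph.mulCayley SA) (max δ δ') :=
    ⟨h.connected, h.nonneg.trans (le_max_left _ _), fun o x y z =>
      (sub_le_sub_left (le_max_left _ _) _).trans (h.min_le o x y z)⟩
  have h2 : FourPoint (SimpleGraph.mulCayley SB) (max δ δ') :=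
    ⟨h'.connected, h'.nonneg.trans (le_max_right _ _), fun o x y z =>
      (sub_le_sub_left (le_max_right _ _) _).trans (h'.min_le o x y z)⟩
  refine ⟨coprodGraph_connected hA hB, h1.nonneg, fun o x y z => ?_⟩
  rw [gromovProd_eq hA hB, gromovProd_eq hA hB, gromovProd_eq hA hB]
  exact wordProd_four_point h1 h2 _ _ _

end Generating

end Metric


/-! ### Geodesics of the Bass–Serre tree in terms of normal forms. -/

section Tree

variable {A : Type u} {B : Type v} [Group A] [Group B] {H : Type w} [Group H]

/-- The vertex `[g, v_A]` or `[g, v_B]`. -/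
def vtx (b : Bool) (g : A ∗ B) : TreeVertex A B := bif b then vertexA g else vertexB g

@[simp] theorem isLeft_vtx (b : Bool) (g : A ∗ B) : (vtx b g).isLeft = b := by cases b <;> rfl

theorem smul_vtx (b : Bool) (g h : A ∗ B) : g • vtx b h = vtx b (g * h) := by cases b <;> rfl

theorem exists_vtx_eq (y : TreeVertex A B) : ∃ g, y = vtx y.isLeft g := by
  rcases y with q | q <;> obtain ⟨g, rfl⟩ := QuotientGroup.mk_surjective q
  exacts [⟨g, rfl⟩, ⟨g, rfl⟩]

theorem vertexA_eq_iff {g h : A ∗ B} :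
    vertexA g = vertexA h ↔ g⁻¹ * h ∈ (Monoid.Coprod.inl : A →* A ∗ B).range := by
  rw [vertexA, vertexA, Sum.inl.injEq, QuotientGroup.eq]

theorem vertexB_eq_iff {g h : A ∗ B} :
    vertexB g = vertexB h ↔ g⁻¹ * h ∈ (Monoid.Coprod.inr : B →* A ∗ B).range := by
  rw [vertexB, vertexB, Sum.inr.injEq, QuotientGroup.eq]

/-- The edge `[g, τ]` joins `x` to `y`. -/
def IsEdge (g : A ∗ B) (x y : TreeVertex A B) : Prop := ∃ b, x = vtx b g ∧ y = vtx (!b) g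

/-- The vertex `y` is an endpoint of the edge `[g, τ]`. -/
def IsEnd (g : A ∗ B) (y : TreeVertex A B) : Prop := ∃ b, y = vtx b g

theorem tree_adj_iff {x y : TreeVertex A B} : (tree A B).Adj x y ↔ ∃ g, IsEdge g x y := by
  constructor
  · rintro ⟨g, ⟨rfl, rfl⟩ | ⟨rfl, rfl⟩⟩
    · exact ⟨g, true, rfl, rfl⟩
    · exact ⟨g, false, rfl, rfl⟩
  · rintro ⟨g, b, rfl, rfl⟩
    cases b
    · exact ⟨g, Or.inr ⟨rfl, rfl⟩⟩
    · exact ⟨g, Or.inl ⟨rfl, rfl⟩⟩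

theorem IsEdge.symm {g : A ∗ B} {x y : TreeVertex A B} (h : IsEdge g x y) : IsEdge g y x := by
  obtain ⟨b, rfl, rfl⟩ := h
  exact ⟨!b, rfl, by rw [Bool.not_not]⟩

theorem IsEdge.isEnd_left {g : A ∗ B} {x y : TreeVertex A B} (h : IsEdge g x y) : IsEnd g x :=
  h.imp fun _ hb => hb.1

theorem IsEdge.isEnd_right {g : A ∗ B} {x y : TreeVertex A B} (h : IsEdge g x y) : IsEnd g y :=
  h.symm.isEnd_left

theorem IsEdge.smul {g : A ∗ B} {x y : TreeVertex A B} (h : IsEdge g x y) (k : A ∗ B) :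
    IsEdge (k * g) (k • x) (k • y) := by
  obtain ⟨b, rfl, rfl⟩ := h
  exact ⟨b, smul_vtx b k g, smul_vtx _ k g⟩

theorem IsEnd.smul {g : A ∗ B} {y : TreeVertex A B} (h : IsEnd g y) (k : A ∗ B) :
    IsEnd (k * g) (k • y) := by
  obtain ⟨b, rfl⟩ := h
  exact ⟨b, smul_vtx b k g⟩

theorem exists_isEnd (y : TreeVertex A B) : ∃ g, IsEnd g y :=
  (exists_vtx_eq y).imp fun _ hg => ⟨_, hg⟩

theorem tree_connected : (tree A B).Connected := by
  have hadj : ∀ (b : Bool) (g : A ∗ B), (tree A B).Reachable (vtx b g) (vtx (!b) g) := fun b g =>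
    (tree_adj_iff.2 ⟨g, b, rfl, rfl⟩).reachable
  have hsm : ∀ {x y : TreeVertex A B} (g : A ∗ B), (tree A B).Reachable x y →
      (tree A B).Reachable (g • x) (g • y) := by
    intro x y g h
    rw [← SimpleGraph.edist_ne_top_iff_reachable] at h ⊢
    exact (edist_smul (tree A B) g x y).symm ▸ h
  have key : ∀ g : A ∗ B, (tree A B).Reachable (vtx true 1) (vtx true g) := by
    intro g
    induction g using Monoid.Coprod.induction_on with
    | inl a =>
      rw [show vtx true (Monoid.Coprod.inl a : A ∗ B) = vtx true 1 from
        (vertexA_eq_iff.2 ⟨a, by simp⟩).symm]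
    | inr b =>
      have h1 := hadj true (1 : A ∗ B)
      have h2 := hadj false (Monoid.Coprod.inr b : A ∗ B)
      rw [show vtx false (Monoid.Coprod.inr b : A ∗ B) = vtx false 1 from
        (vertexB_eq_iff.2 ⟨b, by simp⟩).symm] at h2
      exact h1.trans h2
    | mul x y hx hy =>
      have := hsm x hy
      rw [smul_vtx, smul_vtx, mul_one] at this
      exact hx.trans this
  have key' : ∀ y : TreeVertex A B, (tree A B).Reachable (vtx true 1) y := by
    intro y
    obtain ⟨g, hg⟩ := exists_vtx_eq y
    rw [hg]
    cases y.isLeft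
    · exact (key g).trans (hadj true g)
    · exact key g
  have : Nonempty (TreeVertex A B) := ⟨vtx true 1⟩
  exact SimpleGraph.Connected.mk fun x y => (key' x).symm.trans (key' y)

/-- The facts linking a free factor to the Bass–Serre tree. -/
structure Side.OnTree (s : Side A B H) : Prop where
  vtx_eq : ∀ {g h : A ∗ B}, vtx s.side g = vtx s.side h ↔ g⁻¹ * h ∈ s.φ.range
  π_eq : ∀ {g h : A ∗ B}, vtx (!s.side) g = vtx (!s.side) h → s.π g = s.π h

theorem sideA_onTree : (sideA A B).OnTree where
  vtx_eq := vertexA_eq_iff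
  π_eq {g h} hgh := by
    obtain ⟨k, hk⟩ := vertexB_eq_iff.1 hgh
    have := (sideA A B).π_mul_other (sideB A B) (by simp [sideA, sideB]) g k
    rw [show h = g * (sideB A B).φ k from by rw [show (sideB A B).φ k = g⁻¹ * h from hk]; group]
    exact this.symm

theorem sideB_onTree : (sideB A B).OnTree where
  vtx_eq := vertexB_eq_iff
  π_eq {g h} hgh := by
    obtain ⟨k, hk⟩ := vertexA_eq_iff.1 hgh
    have := (sideB A B).π_mul_other (sideA A B) (by simp [sideA, sideB]) g k
    rw [show h = g * (sideA A B).φ k from by rw [show (sideA A B).φ k = g⁻¹ * h from hk]; group]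
    exact this.symm

theorem onGeodesic_smul_iff (g : A ∗ B) (x y z : TreeVertex A B) :
    OnGeodesic (g • x) (.inl (g • y)) (g • z) ↔ OnGeodesic x (.inl y) z := by
  simp only [OnGeodesic, dist_smul]

namespace Side.OnTree

variable {s : Side A B H} (hs : s.OnTree)
include hs

/-- Away from the vertex of the factor, the projection to the factor only depends on the vertex. -/
theorem π_eq_of_isEnd {g h : A ∗ B} {y : TreeVertex A B} (hg : IsEnd g y) (hh : IsEnd h y)
    (hy : y ≠ vtx s.side 1) : s.π g = s.π h := by
  obtain ⟨b, rfl⟩ := hg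
  obtain ⟨b', hb'⟩ := hh
  obtain rfl : b = b' := by simpa using congrArg Sum.isLeft hb'
  by_cases hb : b = s.side
  · subst hb
    obtain ⟨k, hk⟩ := hs.vtx_eq.1 hb'
    rw [show h = g * s.φ k by rw [hk]; group]
    refine (s.π_mul_φ (fun hg => hy ?_) k).symm
    rw [eq_comm, hs.vtx_eq]
    simpa using hg
  · rw [Bool.eq_not_of_ne hb] at hb'
    exact hs.π_eq hb'

theorem exists_onGeodesic_one {y : TreeVertex A B} (hy : y ≠ vtx s.side 1) :
    ∃ a, OnGeodesic (vtx s.side 1) (.inl y) (vtx (!s.side) (s.φ a)) := by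
  obtain ⟨c, h0, h1, hc⟩ := exists_geodesic (tree_connected (A := A) (B := B)) (vtx s.side 1) y
  have hpos := (tree_connected (A := A) (B := B)).pos_dist_of_ne hy.symm
  have h2 := hc 0 1 (Nat.zero_le _) hpos
  have h3 := hc 1 _ hpos le_rfl
  rw [h0] at h2
  rw [h1] at h3
  obtain ⟨g, b, hb1, hb2⟩ := tree_adj_iff.1 (SimpleGraph.dist_eq_one_iff_adj.1
    (show (tree A B).dist (vtx s.side 1) (c 1) = 1 by omega))
  obtain rfl : s.side = b := by simpa using congrArg Sum.isLeft hb1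
  obtain ⟨a, ha⟩ := hs.vtx_eq.1 hb1
  rw [inv_one, one_mul] at ha
  refine ⟨a, ?_⟩
  rw [ha, ← hb2]
  change _ + _ = _
  omega

/-- After its first edge a geodesic never returns to its origin, and away from that vertex adjacent
edges have the same projection; so the value at the first edge persists to the end. Uniqueness of
geodesics is deduced from this, with no separate proof of acyclicity. -/
theorem π_eq_of_onGeodesic_one {y : TreeVertex A B} {h : A ∗ B} (hh : IsEnd h y) {a : H}
    (ha : OnGeodesic (vtx s.side 1) (.inl y) (vtx (!s.side) (s.φ a))) : s.π h = a := by
  have hT := tree_connected (A := A) (B := B)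
  set p := vtx (!s.side) (s.φ a) with hp
  have ha' : (tree A B).dist (vtx s.side 1) p + (tree A B).dist p y =
    (tree A B).dist (vtx s.side 1) y := ha
  have hadj : (tree A B).Adj (vtx s.side 1) p := by
    refine tree_adj_iff.2 ⟨s.φ a, s.side, hs.vtx_eq.2 ⟨a, by simp⟩, rfl⟩
  rw [SimpleGraph.dist_eq_one_iff_adj.2 hadj] at ha'
  obtain ⟨c, h0, h1, hc⟩ := exists_geodesic hT p y
  have hne : ∀ t ≤ (tree A B).dist p y, c t ≠ vtx s.side 1 := by
    intro t ht hct
    have h2 := hc t _ ht le_rfl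
    rw [h1, hct] at h2
    omega
  have key : ∀ t ≤ (tree A B).dist p y, ∀ g, IsEnd g (c t) → s.π g = a := by
    intro t
    induction t with
    | zero =>
      intro ht g hg
      rw [hs.π_eq_of_isEnd hg (h := s.φ a) ⟨!s.side, by rw [h0]⟩ (hne 0 ht), s.π_φ]
    | succ t ih =>
      intro ht g hg
      have h2 := hc t (t + 1) (Nat.le_succ _) ht
      obtain ⟨k, hk⟩ := tree_adj_iff.1 (SimpleGraph.dist_eq_one_iff_adj.1
        (show (tree A B).dist (c t) (c (t + 1)) = 1 by omega))
      rw [hs.π_eq_of_isEnd hg hk.isEnd_right (hne _ ht)]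
      exact ih (by omega) k hk.isEnd_left
  exact key _ le_rfl h (by rwa [h1])

/-- The first edge of a geodesic of the Bass–Serre tree. -/
theorem onGeodesic_iff {g h : A ∗ B} {y : TreeVertex A B} (hh : IsEnd h y)
    (hy : y ≠ vtx s.side g) (a : H) :
    OnGeodesic (vtx s.side g) (.inl y) (vtx (!s.side) (g * s.φ a)) ↔ s.π (g⁻¹ * h) = a := by
  have h1 : ∀ a, OnGeodesic (vtx s.side g) (.inl y) (vtx (!s.side) (g * s.φ a)) ↔
      OnGeodesic (vtx s.side 1) (.inl (g⁻¹ • y)) (vtx (!s.side) (s.φ a)) := by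
    intro a
    rw [← onGeodesic_smul_iff g⁻¹ (vtx s.side g), smul_vtx, smul_vtx, inv_mul_cancel,
      inv_mul_cancel_left]
  have hy' : g⁻¹ • y ≠ vtx s.side 1 := by
    intro h2
    apply hy
    rw [← smul_inv_smul g y, h2, smul_vtx, mul_one]
  rw [h1]
  refine ⟨hs.π_eq_of_onGeodesic_one (hh.smul g⁻¹), fun hπ => ?_⟩
  obtain ⟨a', ha'⟩ := hs.exists_onGeodesic_one hy'
  rw [← hπ, hs.π_eq_of_onGeodesic_one (hh.smul g⁻¹) ha']
  exact ha'

end Side.OnTree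

/-- Every vertex of the tree comes from a free factor. -/
theorem forall_bool_of_side {P : Bool → Prop}
    (hA : (sideA A B).OnTree → P (sideA A B).side) (hB : (sideB A B).OnTree → P (sideB A B).side)
    (b : Bool) : P b := by
  cases b
  · exact hB sideB_onTree
  · exact hA sideA_onTree

theorem Side.π_eq_one_iff (s : Side A B H) (g : A ∗ B) : s.π g = 1 ↔ s.Free (nf g) := by
  refine ⟨fun h => ?_, fun h => s.head_of_free h⟩
  have h1 := s.tail_head_append_drop (red_nf g)
  rw [show s.head (nf g) = 1 from h, s.tail_one, List.nil_append] at h1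
  rw [← h1]
  exact s.free_drop (red_nf g)

/-- The case `a = 1` of the description of first edges, in a form that does not mention the factor:
crossing the edge of `g` means that no letter of the factor at `x` comes first. -/
theorem onGeodesic_edge_iff {g h : A ∗ B} {x x' y : TreeVertex A B} (hx : IsEdge g x x')
    (hh : IsEnd h y) (hy : y ≠ x) :
    OnGeodesic x (.inl y) x' ↔ ∀ t ∈ (nf (g⁻¹ * h)).head?, t.isLeft ≠ x.isLeft := by
  obtain ⟨b, rfl, rfl⟩ := hx
  revert hy
  rw [isLeft_vtx]
  refine forall_bool_of_side (A := A) (B := B) (P := fun b => y ≠ vtx b g →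
    (OnGeodesic (vtx b g) (.inl y) (vtx (!b) g) ↔
      ∀ t ∈ (nf (g⁻¹ * h)).head?, t.isLeft ≠ b)) ?_ ?_ b
  · intro hs hy
    have := hs.onGeodesic_iff hh hy 1
    rwa [map_one, mul_one, Side.π_eq_one_iff] at this
  · intro hs hy
    have := hs.onGeodesic_iff hh hy 1
    rwa [map_one, mul_one, Side.π_eq_one_iff] at this

theorem exists_letter_of_vtx_eq {b : Bool} {g h : A ∗ B} (hgh : vtx b g = vtx b h) (hne : g ≠ h) :
    ∃ x : A ⊕ B, letter x = g⁻¹ * h ∧ x.isLeft = b ∧ letter x ≠ 1 := by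
  have h1 : g⁻¹ * h ≠ 1 := fun h1 => hne (inv_mul_eq_one.1 h1)
  cases b
  · obtain ⟨k, hk⟩ := vertexB_eq_iff.1 hgh
    exact ⟨.inr k, hk, rfl, by rw [← hk] at h1; exact h1⟩
  · obtain ⟨k, hk⟩ := vertexA_eq_iff.1 hgh
    exact ⟨.inl k, hk, rfl, by rw [← hk] at h1; exact h1⟩

theorem nf_letter {x : A ⊕ B} (hx : letter x ≠ 1) : nf (letter x) = [x] := by
  have : Red [x] := red_cons.2 ⟨hx, by simp, Red.nil⟩
  exact nf_eq_of_spell_eq this (by simp)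

theorem isLeft_of_mem_head?_nf {b : Bool} {g h : A ∗ B} (hgh : vtx b g = vtx b h) {t : A ⊕ B}
    (ht : t ∈ (nf (g⁻¹ * h)).head?) : t.isLeft = b := by
  by_cases hne : g = h
  · simp [hne, nf_one] at ht
  · obtain ⟨x, h1, h2, h3⟩ := exists_letter_of_vtx_eq hgh hne
    rw [← h1, nf_letter h3] at ht
    simp only [List.head?_cons, Option.mem_def, Option.some.injEq] at ht
    exact ht ▸ h2

/-- Two labels of one edge would differ by a nontrivial letter belonging to both factors. -/
theorem IsEdge.unique {g h : A ∗ B} {x y : TreeVertex A B} (hg : IsEdge g x y)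
    (hh : IsEdge h x y) : g = h := by
  by_contra hne
  obtain ⟨b, h1, h2⟩ := hg
  obtain ⟨b', h3, h4⟩ := hh
  rw [h1] at h3
  rw [h2] at h4
  obtain rfl : b = b' := by simpa using congrArg Sum.isLeft h3
  obtain ⟨x, hx1, hx2, hx3⟩ := exists_letter_of_vtx_eq h3 hne
  have := isLeft_of_mem_head?_nf h4 (t := x) (by rw [← hx1, nf_letter hx3]; simp)
  rw [hx2] at this
  cases b <;> simp at this

/-- The first edge of a geodesic of the tree is unique. -/
theorem onGeodesic_adj_unique {x y x₁ x₂ : TreeVertex A B} (h1 : (tree A B).Adj x x₁)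
    (h2 : (tree A B).Adj x x₂) (hy : y ≠ x) (h1' : OnGeodesic x (.inl y) x₁)
    (h2' : OnGeodesic x (.inl y) x₂) : x₁ = x₂ := by
  obtain ⟨h, hh⟩ := exists_isEnd y
  obtain ⟨g₁, b, rfl, rfl⟩ := tree_adj_iff.1 h1
  obtain ⟨g₂, b', hb, rfl⟩ := tree_adj_iff.1 h2
  obtain rfl : b = b' := by simpa using congrArg Sum.isLeft hb
  refine forall_bool_of_side (A := A) (B := B) (P := fun b => vtx b g₁ = vtx b g₂ → y ≠ vtx b g₁ →
    OnGeodesic (vtx b g₁) (.inl y) (vtx (!b) g₁) → OnGeodesic (vtx b g₁) (.inl y) (vtx (!b) g₂) →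
    vtx (!b) g₁ = vtx (!b) g₂) ?_ ?_ b hb hy h1' h2'
  · clear hb hy h1' h2'
    intro hs hb hy h1' h2'
    obtain ⟨a, ha⟩ := hs.vtx_eq.1 hb
    have h3 := (hs.onGeodesic_iff hh hy 1).1 (by rwa [map_one, mul_one])
    have h4 := (hs.onGeodesic_iff hh hy a).1 (by rw [ha, mul_inv_cancel_left]; exact h2')
    have h5 : g₁⁻¹ * g₂ = 1 := by rw [← ha, ← h4, h3, map_one]
    rw [inv_mul_eq_one.1 h5]
  · clear hb hy h1' h2'
    intro hs hb hy h1' h2'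
    obtain ⟨a, ha⟩ := hs.vtx_eq.1 hb
    have h3 := (hs.onGeodesic_iff hh hy 1).1 (by rwa [map_one, mul_one])
    have h4 := (hs.onGeodesic_iff hh hy a).1 (by rw [ha, mul_inv_cancel_left]; exact h2')
    have h5 : g₁⁻¹ * g₂ = 1 := by rw [← ha, ← h4, h3, map_one]
    rw [inv_mul_eq_one.1 h5]

/-! ### Rays in the tree -/

theorem GeodesicRay.adj {V : Type*} {X : SimpleGraph V} (r : GeodesicRay X) (n : ℕ) :
    X.Adj (r n) (r (n + 1)) := by
  rw [← SimpleGraph.dist_eq_one_iff_adj]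
  have := r.dist_eq (show n ≤ n + 1 by omega)
  omega

/-- A vertex lies on the geodesic to an end if and only if it lies on the geodesics to the far
vertices of a ray representing the end. -/
theorem onGeodesic_end_iff {x z : TreeVertex A B} {r : GeodesicRay (tree A B)} :
    OnGeodesic x (.inr r.end') z ↔ ∀ᶠ k in Filter.atTop, OnGeodesic x (.inl (r k)) z := by
  have hT := tree_connected (A := A) (B := B)
  constructor
  · rintro ⟨r', rfl, hr', j, rfl⟩
    obtain ⟨m, n, hmn⟩ := Quotient.exact hr'
    filter_upwards [Filter.eventually_ge_atTop (n + j)] with k hk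
    have h1 := hmn (k - n)
    rw [Nat.add_sub_cancel' (by omega)] at h1
    rw [← h1]
    have h2 := r'.dist_eq (Nat.zero_le j)
    have h3 := r'.dist_eq (show j ≤ m + (k - n) by omega)
    have h4 := r'.dist_eq (Nat.zero_le (m + (k - n)))
    change _ + _ = _
    omega
  · intro hev
    obtain ⟨M, hM⟩ := Filter.eventually_atTop.1 hev
    have hbd : ∀ k, k ≤ (tree A B).dist x (r k) + (tree A B).dist x (r 0) := by
      intro k
      have h1 := r.dist_eq (Nat.zero_le k)
      have h2 := hT.dist_triangle (u := r 0) (v := x) (w := r k)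
      rw [(tree A B).dist_comm (u := r 0) (v := x)] at h2
      omega
    -- from some point on the ray moves away from `x`
    obtain ⟨N, hNM, hN⟩ : ∃ N ≥ M, ∀ k ≥ N,
        (tree A B).dist x (r k) = (tree A B).dist x (r N) + (k - N) := by
      -- A Busemann-type function: the triangle inequality makes it nonincreasing, so it is constant
      -- from a minimizer on. The summand `d(x, r 0)` keeps the natural subtraction from truncating.
      let f : ℕ → ℕ := fun k => (tree A B).dist x (r (M + k)) + (tree A B).dist x (r 0) - (M + k)
      obtain ⟨k₀, hk₀⟩ : ∃ k₀, ∀ k, f k₀ ≤ f k :=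
        ⟨Function.argmin f, fun k => Function.argmin_le f k⟩
      refine ⟨M + k₀, by omega, fun k hk => ?_⟩
      have h1 := hk₀ (k - M)
      simp only [f] at h1
      rw [Nat.add_sub_cancel' (by omega)] at h1
      have h2 := hT.dist_triangle (u := x) (v := r (M + k₀)) (w := r k)
      have h3 := r.dist_eq hk
      have h4 := hbd k
      have h5 := hbd (M + k₀)
      omega
    obtain ⟨c, h0, h1, hz, hc⟩ := exists_geodesic_through hT (hM N hNM)
    generalize hℓ : (tree A B).dist x (r N) = ℓ at *
    -- The ray through `z`: first a geodesic from `x` through `z` to `r N`, then `r` itself, along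
    -- which the distance to `x` grows at unit speed.
    let r' : GeodesicRay (tree A B) :=
      ⟨fun i => if i ≤ ℓ then c i else r (N + (i - ℓ)), by
        intro i j hij
        split_ifs with hi hj hj
        · have := hc i j hij hj
          omega
        · have h2 := hc i ℓ hi le_rfl
          rw [h1] at h2
          have h3 := hc 0 i (Nat.zero_le _) hi
          rw [h0] at h3
          have h4 := hN (N + (j - ℓ)) (by omega)
          have h5 := r.dist_eq (show N ≤ N + (j - ℓ) by omega)
          have h6 := hT.dist_triangle (u := c i) (v := r N) (w := r (N + (j - ℓ)))
          have h7 := hT.dist_triangle (u := x) (v := c i) (w := r (N + (j - ℓ)))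
          omega
        · omega
        · have := r.dist_eq (show N + (i - ℓ) ≤ N + (j - ℓ) by omega)
          omega⟩
    refine ⟨r', by simp [r', h0], Quotient.sound ⟨ℓ + 1, N + 1, fun k => ?_⟩,
      (tree A B).dist x z, ?_⟩
    · have h2 : ¬ ℓ + 1 + k ≤ ℓ := by omega
      simp only [r', h2, if_false]
      congr 1
      omega
    · have h2 : (tree A B).dist x z ≤ ℓ := by
        have : (tree A B).dist x z + (tree A B).dist z (r N) = (tree A B).dist x (r N) :=
          hM N hNM
        omega
      simp only [r', h2, if_true, hz]

theorem exists_ray_from_vertex (x : TreeVertex A B) (η : Ends (tree A B)) :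
    ∃ r : GeodesicRay (tree A B), r 0 = x ∧ r.end' = η := by
  obtain ⟨r, rfl⟩ := Quotient.exists_rep η
  have h : OnGeodesic x (.inr r.end') x := onGeodesic_end_iff.2
    (Filter.Eventually.of_forall fun k => by simp [OnGeodesic])
  obtain ⟨r', h1, h2, -⟩ := h
  exact ⟨r', h1, h2⟩

theorem onGeodesic_ray {r : GeodesicRay (tree A B)} {y : TreeVertex A B} {m n : ℕ} (hmn : m ≤ n)
    (h : OnGeodesic (r 0) (.inl y) (r n)) :
    OnGeodesic (r m) (.inl y) (r n) ∧ OnGeodesic (r 0) (.inl y) (r m) := by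
  have hT := tree_connected (A := A) (B := B)
  have h' : (tree A B).dist (r 0) (r n) + (tree A B).dist (r n) y = (tree A B).dist (r 0) y := h
  have h1 := r.dist_eq (Nat.zero_le n)
  have h2 := r.dist_eq (Nat.zero_le m)
  have h3 := r.dist_eq hmn
  have h4 := hT.dist_triangle (u := r 0) (v := r m) (w := y)
  have h5 := hT.dist_triangle (u := r m) (v := r n) (w := y)
  constructor <;> (change _ + _ = _; omega)

theorem onGeodesic_ray_ne {r : GeodesicRay (tree A B)} {y : TreeVertex A B} {m n : ℕ} (hmn : m < n)
    (h : OnGeodesic (r 0) (.inl y) (r n)) : y ≠ r m := by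
  rintro rfl
  have h' : (tree A B).dist (r 0) (r n) + (tree A B).dist (r n) (r m) =
    (tree A B).dist (r 0) (r m) := h
  have h1 := r.dist_eq (Nat.zero_le n)
  have h2 := r.dist_eq (Nat.zero_le m)
  omega

/-- The next edges of both rays start geodesics to a common far vertex, and first edges of geodesics
are unique. -/
theorem ray_ext {r r' : GeodesicRay (tree A B)} (h0 : r 0 = r' 0)
    (h : ∀ n, ∃ y, OnGeodesic (r 0) (.inl y) (r n) ∧ OnGeodesic (r' 0) (.inl y) (r' n)) :
    r = r' := by
  have key : ∀ n, r n = r' n := by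
    intro n
    induction n with
    | zero => exact h0
    | succ n ih =>
      obtain ⟨y, hy, hy'⟩ := h (n + 1)
      have h1 := (onGeodesic_ray (Nat.le_succ n) hy).1
      have h2 := (onGeodesic_ray (Nat.le_succ n) hy').1
      have h3 := r'.adj n
      rw [← ih] at h2 h3
      exact onGeodesic_adj_unique (r.adj n) h3 (onGeodesic_ray_ne (Nat.lt_succ_self n) hy) h1 h2
  exact GeodesicRay.ext (funext key)

theorem ray_unique {r r' : GeodesicRay (tree A B)} (h0 : r 0 = r' 0) (h : r.end' = r'.end') :
    r = r' := by
  obtain ⟨m, n, hmn⟩ := Quotient.exact h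
  refine ray_ext h0 fun k => ⟨r (m + k), ?_, ?_⟩
  · have h1 := r.dist_eq (Nat.zero_le k)
    have h2 := r.dist_eq (show k ≤ m + k by omega)
    have h3 := r.dist_eq (Nat.zero_le (m + k))
    change _ + _ = _
    omega
  · rw [hmn k]
    have h1 := r'.dist_eq (Nat.zero_le k)
    have h2 := r'.dist_eq (show k ≤ n + k by omega)
    have h3 := r'.dist_eq (Nat.zero_le (n + k))
    change _ + _ = _
    omega

end Tree


/-! ### Rays of the tree as infinite reduced words, and the factors inside the word metric. -/

section RayWords

/-- The word formed by the first `n` letters of a sequence. -/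
def initWord {L : Type*} (x : ℕ → L) (n : ℕ) : List L := (List.range n).map x

theorem initWord_succ {L : Type*} (x : ℕ → L) (n : ℕ) : initWord x (n + 1) = initWord x n ++ [x n] := by
  simp [initWord, List.range_succ]

theorem initWord_prefix {L : Type*} (x : ℕ → L) {m n : ℕ} (h : m ≤ n) :
    initWord x m <+: initWord x n := by
  induction n, h using Nat.le_induction with
  | base => exact List.prefix_rfl
  | succ n _ ih => exact ih.trans ⟨[x n], (initWord_succ x n).symm⟩

theorem getLast?_initWord_succ {L : Type*} (x : ℕ → L) (n : ℕ) :
    (initWord x (n + 1)).getLast? = some (x n) := by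
  rw [initWord_succ]
  simp

variable {A : Type u} {B : Type v} [Group A] [Group B] {SA : Set A} {SB : Set B}

/-- The edges of a ray `r` of the tree are the `[e n, τ]`, and consecutive edges differ by the
letters `x n`. -/
structure RayWord (r : GeodesicRay (tree A B)) (e : ℕ → A ∗ B) (x : ℕ → A ⊕ B) : Prop where
  edge : ∀ n, IsEdge (e n) (r n) (r (n + 1))
  letter_eq : ∀ n, letter (x n) = (e n)⁻¹ * e (n + 1)
  isLeft_eq : ∀ n, (x n).isLeft = (r (n + 1)).isLeft
  ne_one : ∀ n, letter (x n) ≠ 1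

theorem IsEdge.isLeft_ne {g : A ∗ B} {x y : TreeVertex A B} (h : IsEdge g x y) :
    x.isLeft ≠ y.isLeft := by
  obtain ⟨b, rfl, rfl⟩ := h
  simp

theorem IsEdge.left_eq {g : A ∗ B} {x y : TreeVertex A B} (h : IsEdge g x y) :
    x = vtx x.isLeft g := by
  obtain ⟨b, rfl, rfl⟩ := h
  simp

theorem IsEnd.eq_vtx {g : A ∗ B} {x : TreeVertex A B} (h : IsEnd g x) :
    x = vtx x.isLeft g := by
  obtain ⟨b, rfl⟩ := h
  simp

theorem exists_edge_label (r : GeodesicRay (tree A B)) :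
    ∃ e : ℕ → A ∗ B, ∀ n, IsEdge (e n) (r n) (r (n + 1)) := by
  choose e he using fun n => tree_adj_iff.1 (r.adj n)
  exact ⟨e, he⟩

/-- Consecutive edges share a vertex and so differ by a letter of its factor; a trivial letter would
make the ray turn back. -/
theorem exists_rayWord {r : GeodesicRay (tree A B)} {e : ℕ → A ∗ B}
    (he : ∀ n, IsEdge (e n) (r n) (r (n + 1))) : ∃ x, RayWord r e x := by
  have hex : ∀ n, ∃ x : A ⊕ B, letter x = (e n)⁻¹ * e (n + 1) ∧ x.isLeft = (r (n + 1)).isLeft ∧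
      letter x ≠ 1 := by
    intro n
    refine exists_letter_of_vtx_eq ?_ fun heq => ?_
    · rw [← (he n).symm.left_eq, ← (he (n + 1)).left_eq]
    · obtain ⟨b, h1, h2⟩ := he n
      obtain ⟨b', h3, h4⟩ := he (n + 1)
      rw [h2, heq] at h3
      obtain rfl : (!b) = b' := by simpa using congrArg Sum.isLeft h3
      rw [Bool.not_not, ← heq, ← h1] at h4
      have := r.dist_eq (show n ≤ n + 1 + 1 by omega)
      rw [h4, SimpleGraph.dist_self] at this
      omega
  choose x hx using hex
  exact ⟨x, he, fun n => (hx n).1, fun n => (hx n).2.1, fun n => (hx n).2.2⟩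

theorem red_initWord {x : ℕ → A ⊕ B} (h1 : ∀ n, letter (x n) ≠ 1)
    (h2 : ∀ n, (x n).isLeft ≠ (x (n + 1)).isLeft) (n : ℕ) : Red (initWord x n) := by
  induction n with
  | zero => exact Red.nil
  | succ n ih =>
    rw [initWord_succ]
    refine red_append.2 ⟨ih, red_cons.2 ⟨h1 n, by simp, Red.nil⟩, fun y hy z hz => ?_⟩
    simp only [List.head?_cons, Option.mem_def, Option.some.injEq] at hz
    cases n with
    | zero => simp [initWord] at hy
    | succ n =>
      rw [getLast?_initWord_succ] at hy
      simp only [Option.mem_def, Option.some.injEq] at hy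
      rw [← hy, ← hz]
      exact h2 n

namespace RayWord

variable {r : GeodesicRay (tree A B)} {e : ℕ → A ∗ B} {x : ℕ → A ⊕ B} (h : RayWord r e x)
include h

theorem spell_initWord (n : ℕ) : spell (initWord x n) = (e 0)⁻¹ * e n := by
  induction n with
  | zero => simp [initWord]
  | succ n ih =>
    rw [initWord_succ, spell_append, ih, spell_cons, spell_nil, mul_one, h.letter_eq]
    group

theorem red (n : ℕ) : Red (initWord x n) := by
  refine red_initWord h.ne_one (fun n => ?_) n
  rw [h.isLeft_eq, h.isLeft_eq]
  exact (h.edge (n + 1)).isLeft_ne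

theorem nf_eq (n : ℕ) : nf ((e 0)⁻¹ * e n) = initWord x n :=
  nf_eq_of_spell_eq (h.red n) (h.spell_initWord n)

/-- If the normal form of `g`, seen from the ray, starts with the first `n` letters of the ray, then
the geodesic from the origin of the ray to `g` follows the ray up to the `n`-th vertex. -/
theorem onGeodesic_of_prefix {n : ℕ} {g : A ∗ B} {y : TreeVertex A B} (hg : IsEnd g y)
    (hpre : initWord x n <+: nf ((e 0)⁻¹ * g)) : OnGeodesic (r 0) (.inl y) (r n) := by
  have key : ∀ i ≤ n, OnGeodesic (r 0) (.inl y) (r i) := by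
    intro i
    induction i with
    | zero => intro _; simp [OnGeodesic]
    | succ i ih =>
      intro hi
      obtain ⟨m, hm⟩ := (initWord_prefix x hi).trans hpre
      rw [initWord_succ, List.append_assoc, List.singleton_append] at hm
      have hred := red_nf ((e 0)⁻¹ * g)
      rw [← hm] at hred
      have hnf : nf ((e i)⁻¹ * g) = x i :: m := by
        refine nf_eq_of_spell_eq (red_append.1 hred).2.1 ?_
        have h1 := congrArg spell hm
        rw [spell_append, h.spell_initWord, spell_nf] at h1
        rw [eq_inv_mul_iff_mul_eq]
        have h2 : (e 0)⁻¹ * (e i * spell (x i :: m)) = (e 0)⁻¹ * g := by rw [← h1]; group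
        exact mul_left_cancel h2
      have hside : (x i).isLeft ≠ (r i).isLeft := by
        rw [h.isLeft_eq]
        exact (h.edge i).isLeft_ne.symm
      have hne : y ≠ r i := by
        rintro rfl
        apply hside
        refine isLeft_of_mem_head?_nf (g := e i) (h := g) ?_ (by rw [hnf]; simp)
        rw [← (h.edge i).left_eq, ← hg.eq_vtx]
      have h1 : OnGeodesic (r i) (.inl y) (r (i + 1)) := by
        refine (onGeodesic_edge_iff (h.edge i) hg hne).2 fun t ht => ?_
        rw [hnf] at ht
        simp only [List.head?_cons, Option.mem_def, Option.some.injEq] at ht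
        exact ht ▸ hside
      have h2 : (tree A B).dist (r i) (r (i + 1)) + (tree A B).dist (r (i + 1)) y =
        (tree A B).dist (r i) y := h1
      have h3 : (tree A B).dist (r 0) (r i) + (tree A B).dist (r i) y =
        (tree A B).dist (r 0) y := ih (by omega)
      have h4 := r.dist_eq (Nat.zero_le i)
      have h5 := r.dist_eq (Nat.zero_le (i + 1))
      have h6 := r.dist_eq (show i ≤ i + 1 by omega)
      change _ + _ = _
      omega
  exact key n le_rfl

/-- The first `n` letters lead to the edge `e n`, and this edge is known to be crossed only when the
geodesic reaches `r (n + 1)`; hence one vertex more than in the converse. -/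
theorem prefix_of_onGeodesic {n : ℕ} {g : A ∗ B} {y : TreeVertex A B} (hg : IsEnd g y)
    (hy : OnGeodesic (r 0) (.inl y) (r (n + 1))) : initWord x n <+: nf ((e 0)⁻¹ * g) := by
  have key : ∀ i ≤ n, nf ((e 0)⁻¹ * g) = initWord x i ++ nf ((e i)⁻¹ * g) := by
    intro i
    induction i with
    | zero => intro _; simp [initWord]
    | succ i ih =>
      intro hi
      have h1 := (onGeodesic_ray (show i + 1 + 1 ≤ n + 1 by omega) hy).2
      have h2 := (onGeodesic_edge_iff (h.edge (i + 1)) hg (onGeodesic_ray_ne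
        (show i + 1 < n + 1 by omega) hy)).1 (onGeodesic_ray (show i + 1 ≤ i + 1 + 1 by omega) h1).1
      have h3 : nf ((e i)⁻¹ * g) = x i :: nf ((e (i + 1))⁻¹ * g) := by
        refine nf_eq_of_spell_eq (red_cons.2 ⟨h.ne_one i, fun t ht => ?_, red_nf _⟩) ?_
        · rw [h.isLeft_eq]
          exact (h2 t ht).symm
        · rw [spell_cons, spell_nf, h.letter_eq]
          group
      rw [ih (by omega), h3, initWord_succ, List.append_assoc, List.singleton_append]
  exact ⟨_, (key n le_rfl).symm⟩

end RayWord

theorem one_le_letterLength (hA : (SimpleGraph.mulCayley SA).Connected)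
    (hB : (SimpleGraph.mulCayley SB).Connected) {x : A ⊕ B} (hx : letter x ≠ 1) :
    1 ≤ letterLength SA SB x := by
  rcases x with a | b
  · refine hA.pos_dist_of_ne fun h => hx ?_
    rw [← h]
    exact map_one _
  · refine hB.pos_dist_of_ne fun h => hx ?_
    rw [← h]
    exact map_one _

theorem length_le_wordLength (hA : (SimpleGraph.mulCayley SA).Connected)
    (hB : (SimpleGraph.mulCayley SB).Connected) {l : List (A ⊕ B)} (hl : ∀ x ∈ l, letter x ≠ 1) :
    l.length ≤ wordLength SA SB l := by
  induction l with
  | nil => simp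
  | cons x l ih =>
    rw [List.length_cons, wordLength_cons]
    have h1 := one_le_letterLength hA hB (hl x (by simp))
    have h2 := ih fun y hy => hl y (by simp [hy])
    omega

theorem wordLength_le_wordProd (hA : (SimpleGraph.mulCayley SA).Connected)
    (hB : (SimpleGraph.mulCayley SB).Connected) {w l m : List (A ⊕ B)} (hl : w <+: l)
    (hm : w <+: m) : wordLength SA SB w ≤ wordProd SA SB l m := by
  obtain ⟨l, rfl⟩ := hl
  obtain ⟨m, rfl⟩ := hm
  rw [wordProd_append]
  have := wordProd_nonneg hA hB l m
  linarith

/-- If the words diverged within `w`, the differing letters would contribute at most the length of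
the letter of `w`, so the product could not exceed the length of `w`. -/
theorem prefix_of_lt_wordProd (hA : (SimpleGraph.mulCayley SA).Connected)
    (hB : (SimpleGraph.mulCayley SB).Connected) {w l m : List (A ⊕ B)} (hl : w <+: l)
    (h : wordLength SA SB w < wordProd SA SB l m) : w <+: m := by
  obtain ⟨l, rfl⟩ := hl
  induction w generalizing m with
  | nil => exact List.nil_prefix
  | cons x w ih =>
    cases m with
    | nil =>
      rw [wordProd_nil_right] at h
      exact absurd h (not_lt.2 (Nat.cast_nonneg _))
    | cons y m =>
      by_cases hxy : x = y
      · subst hxy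
        rw [List.cons_append, wordProd_cons_self, wordLength_cons] at h
        push_cast at h
        exact List.prefix_cons_inj x |>.2 (ih (by linarith))
      · rw [List.cons_append, wordProd_cons_of_ne hxy, wordLength_cons] at h
        have h1 := letterProd_le_left hA hB x y
        have h2 : (0 : ℝ) ≤ wordLength SA SB w := Nat.cast_nonneg _
        push_cast at h
        linarith

namespace RayWord

variable {r : GeodesicRay (tree A B)} {e : ℕ → A ∗ B} {x : ℕ → A ⊕ B} (h : RayWord r e x)
  (hA : Subgroup.closure SA = ⊤) (hB : Subgroup.closure SB = ⊤)
include h hA hB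

theorem le_wordLength (n : ℕ) : n ≤ wordLength SA SB (initWord x n) := by
  have := length_le_wordLength (mulCayley_connected hA) (mulCayley_connected hB) (h.red n).1
  simpa [initWord] using this

theorem le_gromovProd {n k : ℕ} (hk : n ≤ k) {g : A ∗ B}
    (hpre : initWord x n <+: nf ((e 0)⁻¹ * g)) :
    (n : ℝ) ≤ gromovProd (coprodGraph SA SB) (e 0) (e k) g := by
  rw [gromovProd_eq hA hB, h.nf_eq]
  refine le_trans ?_ (wordLength_le_wordProd (mulCayley_connected hA) (mulCayley_connected hB)
    (initWord_prefix x hk) hpre)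
  exact_mod_cast h.le_wordLength hA hB n

theorem prefix_of_lt_gromovProd {n k : ℕ} (hk : n ≤ k) {g : A ∗ B}
    (hlt : wordLength SA SB (initWord x n) < gromovProd (coprodGraph SA SB) (e 0) (e k) g) :
    initWord x n <+: nf ((e 0)⁻¹ * g) := by
  rw [gromovProd_eq hA hB, h.nf_eq] at hlt
  exact prefix_of_lt_wordProd (mulCayley_connected hA) (mulCayley_connected hB)
    (initWord_prefix x hk) hlt

theorem evGe_self (o : A ∗ B) (R : ℝ) : EvGe (coprodGraph SA SB) o R e e := by
  obtain ⟨n, hn⟩ := exists_nat_ge (R + (coprodGraph SA SB).dist (e 0) o)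
  have h1 : EvGe (coprodGraph SA SB) (e 0) n e e := ⟨n, fun i hi j hj =>
    h.le_gromovProd hA hB hi (by rw [h.nf_eq]; exact initWord_prefix x hj)⟩
  exact (h1.base (coprodGraph_connected hA hB) o).mono (by linarith)

end RayWord

/-- An infinite reduced word is spelled by a ray of the tree. -/
theorem exists_ray_of_letters {x : ℕ → A ⊕ B} (h1 : ∀ n, letter (x n) ≠ 1)
    (h2 : ∀ n, (x n).isLeft ≠ (x (n + 1)).isLeft) :
    ∃ r : GeodesicRay (tree A B), ∀ n, IsEdge (spell (initWord x n)) (r n) (r (n + 1)) := by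
  have hT := tree_connected (A := A) (B := B)
  -- The letter `x n` fixes the far end of the `n`-th edge, so the near end has the opposite type.
  let p : ℕ → TreeVertex A B := fun n => vtx (!(x n).isLeft) (spell (initWord x n))
  have hedge : ∀ n, IsEdge (spell (initWord x n)) (p n) (p (n + 1)) := by
    intro n
    refine ⟨!(x n).isLeft, rfl, ?_⟩
    have h3 : (!(x (n + 1)).isLeft) = (x n).isLeft := (Bool.eq_not_of_ne (h2 n)).symm
    simp only [p, h3, Bool.not_not, initWord_succ, spell_append, spell_cons, spell_nil, mul_one]
    rcases x n with a | b
    · refine (vertexA_eq_iff.2 ⟨a, ?_⟩).symm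
      simp [letter]
    · refine (vertexB_eq_iff.2 ⟨b, ?_⟩).symm
      simp [letter]
  have hnf : ∀ i k, ∃ m, nf ((spell (initWord x i))⁻¹ * spell (initWord x (i + k + 1))) =
      x i :: m := by
    intro i k
    obtain ⟨m, hm⟩ := initWord_prefix x (show i + 1 ≤ i + k + 1 by omega)
    have hred := red_initWord h1 h2 (i + k + 1)
    rw [initWord_succ, List.append_assoc, List.singleton_append] at hm
    rw [← hm] at hred
    refine ⟨m, nf_eq_of_spell_eq (red_append.1 hred).2.1 ?_⟩
    rw [← hm, spell_append]
    group
  -- The element labelling a later edge starts, seen from edge `i`, with a letter of the opposite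
  -- factor from the one at `p i`; so the geodesic crosses edge `i`, and one can induct on the
  -- remainder.
  have hdist : ∀ k i, (tree A B).dist (p i) (p (i + k)) = k := by
    intro k
    induction k with
    | zero => simp
    | succ k ih =>
      intro i
      obtain ⟨m, hm⟩ := hnf i k
      have hend : IsEnd (spell (initWord x (i + k + 1))) (p (i + k + 1)) := ⟨_, rfl⟩
      have hne : p (i + k + 1) ≠ p i := by
        intro heq
        have hb := congrArg Sum.isLeft heq
        simp only [p, isLeft_vtx] at hb
        simp only [p, hb] at heq
        have := isLeft_of_mem_head?_nf heq.symm (t := x i) (by rw [hm]; simp)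
        exact Bool.self_ne_not _ this
      have h3 := (onGeodesic_edge_iff (hedge i) hend hne).2 (by
        intro t ht
        rw [hm] at ht
        simp only [List.head?_cons, Option.mem_def, Option.some.injEq] at ht
        rw [← ht, isLeft_vtx]
        exact Bool.self_ne_not _)
      have h4 : (tree A B).dist (p i) (p (i + 1)) + (tree A B).dist (p (i + 1)) (p (i + k + 1)) =
        (tree A B).dist (p i) (p (i + k + 1)) := h3
      rw [SimpleGraph.dist_eq_one_iff_adj.2 (tree_adj_iff.2 ⟨_, hedge i⟩),
        show i + k + 1 = i + 1 + k by ring, ih (i + 1)] at h4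
      rw [← add_assoc, show i + k + 1 = i + 1 + k by ring, ← h4, add_comm]
  refine ⟨⟨p, fun i j hij => ?_⟩, hedge⟩
  have := hdist (j - i) i
  rwa [Nat.add_sub_cancel' hij] at this

/-! ### The factors -/

variable {H : Type w} [Group H]

/-- The lengths of the letters of a free factor are given by the Cayley graph of `S`. -/
structure Side.Metric (s : Side A B H) (S : Set H) (SA : Set A) (SB : Set B) : Prop where
  letterProd_ι : ∀ h k, letterProd SA SB (s.ι h) (s.ι k) =
    gromovProd (SimpleGraph.mulCayley S) 1 h k
  letterLength_ι : ∀ h, letterLength SA SB (s.ι h) = (SimpleGraph.mulCayley S).dist 1 h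

theorem sideA_metric : (sideA A B).Metric SA SA SB := ⟨fun _ _ => rfl, fun _ => rfl⟩

theorem sideB_metric : (sideB A B).Metric SB SA SB := ⟨fun _ _ => rfl, fun _ => rfl⟩

/-- A word of at most one letter interacts only with the first letter of `l`, and not even with that
one if it comes from the other factor. -/
theorem Side.Metric.wordProd_tail {s : Side A B H} {S : Set H} (hs : s.Metric S SA SB) (h : H)
    {l : List (A ⊕ B)} (hl : Red l) :
    wordProd SA SB (s.tail h) l = gromovProd (SimpleGraph.mulCayley S) 1 h (s.head l) := by
  have hone : ∀ k : H, gromovProd (SimpleGraph.mulCayley S) 1 1 k = 0 := fun k => by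
    simp [gromovProd]
  by_cases hh : h = 1
  · rw [hh, s.tail_one, wordProd_nil_left, hone]
  · rw [s.tail_of_ne hh]
    cases l with
    | nil => rw [wordProd_nil_right, Side.head, gromovProd_comm, hone]
    | cons x l =>
      rw [Side.head]
      by_cases hx : x.isLeft = s.side
      · rw [← s.ι_get x hx, s.get_ι]
        by_cases heq : s.ι h = s.ι (s.get x)
        · have h1 : h = s.get x := by rw [← s.get_ι h, heq, s.get_ι]
          rw [← h1, wordProd_cons_self, wordProd_nil_left, add_zero, hs.letterLength_ι,
            gromovProd_self]
        · rw [wordProd_cons_of_ne heq, hs.letterProd_ι]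
      · have h1 : s.ι h ≠ x := by
          rintro rfl
          exact hx (s.isLeft_ι h)
        rw [wordProd_cons_of_ne h1, letterProd_of_ne (by rw [s.isLeft_ι]; exact Ne.symm hx),
          s.get_other x hx, gromovProd_comm, hone]

/-- Gromov products with the points of a coset of a free factor. -/
theorem Side.Metric.gromovProd_mul_φ {s : Side A B H} {S : Set H} (hs : s.Metric S SA SB)
    (hA : Subgroup.closure SA = ⊤) (hB : Subgroup.closure SB = ⊤) (g : A ∗ B) (h : H)
    (k : A ∗ B) : gromovProd (coprodGraph SA SB) g (g * s.φ h) k =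
      gromovProd (SimpleGraph.mulCayley S) 1 h (s.π (g⁻¹ * k)) := by
  rw [gromovProd_eq hA hB, inv_mul_cancel_left, s.nf_φ, hs.wordProd_tail h (red_nf _)]
  rfl

theorem Side.Metric.evGe_iff {s : Side A B H} {S : Set H} (hs : s.Metric S SA SB)
    (hA : Subgroup.closure SA = ⊤) (hB : Subgroup.closure SB = ⊤) (g : A ∗ B) (R : ℝ) (h : ℕ → H)
    (x : ℕ → A ∗ B) : EvGe (coprodGraph SA SB) g R (fun n => g * s.φ (h n)) x ↔
      EvGe (SimpleGraph.mulCayley S) 1 R h (fun n => s.π (g⁻¹ * x n)) := by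
  simp only [EvGe, hs.gromovProd_mul_φ hA hB]

end RayWords


/-! ### Standard sequences for the points of `δΓ` and the basic neighbourhoods. -/

section Comparison

variable {A : Type u} {B : Type v} [Group A] [Group B] {SA : Set A} {SB : Set B}
  {v₀ : TreeVertex A B}

theorem Induced.mk_eq_mk_iff {G : Type u} {H : Type v} [Group G] [Group H] {φ : H →* G}
    {Y : Type w} [MulAction H Y] {g g' : G} {y y' : Y} :
    Induced.mk φ g y = Induced.mk φ g' y' ↔ ∃ h, φ h = g'⁻¹ * g ∧ h • y = y' :=
  Quotient.eq

theorem Induced.mk_right_injective {G : Type u} {H : Type v} [Group G] [Group H] {φ : H →* G}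
    (hφ : Function.Injective φ) {Y : Type w} [MulAction H Y] (g : G) {y y' : Y}
    (h : Induced.mk φ g y = Induced.mk φ g y') : y = y' := by
  obtain ⟨k, h1, h2⟩ := Induced.mk_eq_mk_iff.1 h
  rw [inv_mul_cancel, ← map_one φ] at h1
  rw [← h2, hφ h1, one_smul]

/-- The point `[g, ξ]` with `ξ` in the boundary of `A`. -/
def pointA (v₀ : TreeVertex A B) (SB : Set B) (g : A ∗ B)
    (ξ : GromovBoundary (SimpleGraph.mulCayley SA)) : DeltaGamma SA SB v₀ :=
  .inl (.inl (Induced.mk _ g ξ))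

/-- The point `[g, ξ]` with `ξ` in the boundary of `B`. -/
def pointB (v₀ : TreeVertex A B) (SA : Set A) (g : A ∗ B)
    (ξ : GromovBoundary (SimpleGraph.mulCayley SB)) : DeltaGamma SA SB v₀ :=
  .inl (.inr (Induced.mk _ g ξ))

/-- The point given by an end of the tree. -/
def pointEnd (v₀ : TreeVertex A B) (SA : Set A) (SB : Set B) (η : Ends (tree A B)) :
    DeltaGamma SA SB v₀ := .inr η

theorem deltaGamma_cases {P : DeltaGamma SA SB v₀ → Prop}
    (hA : ∀ g (ρ : GeodesicRay (SimpleGraph.mulCayley SA)), P (pointA v₀ SB g ρ.limit))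
    (hB : ∀ g (ρ : GeodesicRay (SimpleGraph.mulCayley SB)), P (pointB v₀ SA g ρ.limit))
    (hE : ∀ η, P (pointEnd v₀ SA SB η)) (z : DeltaGamma SA SB v₀) : P z := by
  rcases z with (⟨g, ⟨ρ⟩⟩ | ⟨g, ⟨ρ⟩⟩) | η
  exacts [hA g ρ, hB g ρ, hE η]

/-- The sequence `x` of elements of the free product, with the sequence `y` of vertices of the tree,
is a standard representative of the point `z`. -/
def Rep (x : ℕ → A ∗ B) (y : ℕ → TreeVertex A B) : DeltaGamma SA SB v₀ → Prop
  | .inl (.inl q) => ∃ g, ∃ ρ : GeodesicRay (SimpleGraph.mulCayley SA),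
      q = Induced.mk _ g ρ.limit ∧ (∀ n, x n = g * (sideA A B).φ (ρ n)) ∧ ∀ n, y n = vertexA g
  | .inl (.inr q) => ∃ g, ∃ ρ : GeodesicRay (SimpleGraph.mulCayley SB),
      q = Induced.mk _ g ρ.limit ∧ (∀ n, x n = g * (sideB A B).φ (ρ n)) ∧ ∀ n, y n = vertexB g
  | .inr η => ∃ r : GeodesicRay (tree A B), r.end' = η ∧ (∀ n, y n = r n) ∧
      ∀ n, IsEdge (x n) (r n) (r (n + 1))

theorem rep_pointA (g : A ∗ B) (ρ : GeodesicRay (SimpleGraph.mulCayley SA)) :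
    Rep (fun n => g * (sideA A B).φ (ρ n)) (fun _ => vertexA g) (pointA v₀ SB g ρ.limit) :=
  ⟨g, ρ, rfl, fun _ => rfl, fun _ => rfl⟩

theorem rep_pointB (g : A ∗ B) (ρ : GeodesicRay (SimpleGraph.mulCayley SB)) :
    Rep (fun n => g * (sideB A B).φ (ρ n)) (fun _ => vertexB g) (pointB v₀ SA g ρ.limit) :=
  ⟨g, ρ, rfl, fun _ => rfl, fun _ => rfl⟩

theorem rep_pointEnd {r : GeodesicRay (tree A B)} {e : ℕ → A ∗ B}
    (he : ∀ n, IsEdge (e n) (r n) (r (n + 1))) : Rep e r (pointEnd v₀ SA SB r.end') :=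
  ⟨r, rfl, fun _ => rfl, he⟩

theorem exists_rep (z : DeltaGamma SA SB v₀) : ∃ x y, Rep x y z := by
  refine deltaGamma_cases (P := fun z => ∃ x y, Rep x y z) (fun g ρ => ⟨_, _, rep_pointA g ρ⟩)
    (fun g ρ => ⟨_, _, rep_pointB g ρ⟩) (fun η => ?_) z
  obtain ⟨r, rfl⟩ := Quotient.exists_rep η
  obtain ⟨e, he⟩ := exists_edge_label r
  exact ⟨e, r, rep_pointEnd he⟩

theorem Rep.smul {x : ℕ → A ∗ B} {y : ℕ → TreeVertex A B} {z : DeltaGamma SA SB v₀}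
    (h : Rep x y z) (k : A ∗ B) : Rep (fun n => k • x n) (fun n => k • y n) (k • z) := by
  rcases z with (q | q) | η
  · obtain ⟨g, ρ, rfl, h1, h2⟩ := h
    exact ⟨k * g, ρ, rfl, fun n => by simp only [h1, smul_eq_mul, mul_assoc],
      fun n => by simp only [h2]; rfl⟩
  · obtain ⟨g, ρ, rfl, h1, h2⟩ := h
    exact ⟨k * g, ρ, rfl, fun n => by simp only [h1, smul_eq_mul, mul_assoc],
      fun n => by simp only [h2]; rfl⟩
  · obtain ⟨r, rfl, h1, h2⟩ := h
    exact ⟨k • r, rfl, fun n => by simp only [h1]; rfl, fun n => (h2 n).smul k⟩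

/-- Either the sequence of vertices is constant or it is a ray of the tree. -/
theorem Rep.p_eq {x : ℕ → A ∗ B} {y : ℕ → TreeVertex A B} {z : DeltaGamma SA SB v₀}
    (h : Rep x y z) :
    (∃ u, (GammaBar.bdry z).p = .inl u ∧ ∀ n, y n = u) ∨
      ∃ r : GeodesicRay (tree A B), (GammaBar.bdry z).p = .inr r.end' ∧ ∀ n, y n = r n := by
  rcases z with (q | q) | η
  · obtain ⟨g, ρ, rfl, h1, h2⟩ := h
    exact Or.inl ⟨vertexA g, rfl, h2⟩
  · obtain ⟨g, ρ, rfl, h1, h2⟩ := h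
    exact Or.inl ⟨vertexB g, rfl, h2⟩
  · obtain ⟨r, rfl, h1, h2⟩ := h
    exact Or.inr ⟨r, rfl, h1⟩

theorem Rep.isEnd {x : ℕ → A ∗ B} {y : ℕ → TreeVertex A B} {z : DeltaGamma SA SB v₀}
    (h : Rep x y z) (n : ℕ) : IsEnd (x n) (y n) ∧ IsEnd (x n) (y (n + 1)) := by
  rcases z with (q | q) | η
  · obtain ⟨g, ρ, rfl, h1, h2⟩ := h
    rw [h2, h2, h1, and_self]
    exact ⟨true, vertexA_eq_iff.2 ⟨ρ n, by rw [inv_mul_cancel_left]; rfl⟩⟩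
  · obtain ⟨g, ρ, rfl, h1, h2⟩ := h
    rw [h2, h2, h1, and_self]
    exact ⟨false, vertexB_eq_iff.2 ⟨ρ n, by rw [inv_mul_cancel_left]; rfl⟩⟩
  · obtain ⟨r, rfl, h1, h2⟩ := h
    rw [h1, h1]
    exact ⟨(h2 n).isEnd_left, (h2 n).isEnd_right⟩

theorem Rep.onGeodesic_iff {x : ℕ → A ∗ B} {y : ℕ → TreeVertex A B} {z : DeltaGamma SA SB v₀}
    (h : Rep x y z) {p q : TreeVertex A B} :
    OnGeodesic p (GammaBar.bdry z).p q ↔ ∀ᶠ n in Filter.atTop, OnGeodesic p (.inl (y n)) q := by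
  rcases h.p_eq with ⟨u, h1, h2⟩ | ⟨r, h1, h2⟩
  · simp only [h1, h2, Filter.eventually_const]
  · simp only [h1, h2]
    exact onGeodesic_end_iff

theorem Rep.eq_or_ne {x : ℕ → A ∗ B} {y : ℕ → TreeVertex A B} {z : DeltaGamma SA SB v₀}
    (h : Rep x y z) (p : TreeVertex A B) :
    ((GammaBar.bdry z).p = .inl p ∧ ∀ n, y n = p) ∨
      ((GammaBar.bdry z).p ≠ .inl p ∧ ∀ᶠ n in Filter.atTop, y n ≠ p) := by
  rcases h.p_eq with ⟨u, h1, h2⟩ | ⟨r, h1, h2⟩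
  · by_cases hu : u = p
    · exact Or.inl ⟨by rw [h1, hu], fun n => by rw [h2, hu]⟩
    · exact Or.inr ⟨by rw [h1]; simpa using hu,
        Filter.Eventually.of_forall fun n => by rw [h2]; exact hu⟩
  · refine Or.inr ⟨by rw [h1]; simp, ?_⟩
    simp only [h2]
    filter_upwards [Filter.eventually_gt_atTop ((tree A B).dist (r 0) p)] with n hn
    rintro rfl
    have := r.dist_eq (Nat.zero_le n)
    omega

/-- The direction of a point of the boundary, seen from a vertex of the tree. -/
theorem Rep.exists_direction {H : Type w} [Group H] {s : Side A B H} (hs : s.OnTree)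
    {x : ℕ → A ∗ B} {y : ℕ → TreeVertex A B} {z : DeltaGamma SA SB v₀} (h : Rep x y z)
    {g : A ∗ B} (hne : (GammaBar.bdry z).p ≠ .inl (vtx s.side g)) :
    ∃ a, (∀ᶠ n in Filter.atTop, s.π (g⁻¹ * x n) = a) ∧
      ∀ a', OnGeodesic (vtx s.side g) (GammaBar.bdry z).p (vtx (!s.side) (g * s.φ a')) ↔
        a = a' := by
  obtain ⟨-, hev⟩ := (h.eq_or_ne (vtx s.side g)).resolve_left fun h' => hne h'.1
  obtain ⟨N, hN⟩ := Filter.eventually_atTop.1 hev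
  -- Consecutive terms are labels at the common vertex `y (n + 1)`, which differs from the base
  -- vertex, so they project to the same element.
  have hstep : ∀ n ≥ N, s.π (g⁻¹ * x (n + 1)) = s.π (g⁻¹ * x n) := by
    intro n hn
    have h1 := hN (n + 1) (by omega)
    exact (hs.onGeodesic_iff (h.isEnd (n + 1)).1 h1 _).1
      ((hs.onGeodesic_iff (h.isEnd n).2 h1 _).2 rfl)
  have hconst : ∀ n ≥ N, s.π (g⁻¹ * x n) = s.π (g⁻¹ * x N) := by
    intro n hn
    induction n, hn using Nat.le_induction with
    | base => rfl
    | succ n hn ih => rw [hstep n hn, ih]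
  refine ⟨s.π (g⁻¹ * x N), Filter.eventually_atTop.2 ⟨N, hconst⟩, fun a' => ?_⟩
  rw [h.onGeodesic_iff]
  constructor
  · intro hev'
    obtain ⟨n, h1, h2⟩ := (hev'.and (Filter.eventually_ge_atTop N)).exists
    rw [← hconst n h2]
    exact (hs.onGeodesic_iff (h.isEnd n).1 (hN n h2) a').1 h1
  · rintro rfl
    filter_upwards [Filter.eventually_ge_atTop N] with n hn
    exact (hs.onGeodesic_iff (h.isEnd n).1 (hN n hn) _).2 (hconst n hn)

theorem Rep.exists_ray_of_p_eq_vertexA {x : ℕ → A ∗ B} {y : ℕ → TreeVertex A B}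
    {z : DeltaGamma SA SB v₀} (h : Rep x y z) {g : A ∗ B}
    (hp : (GammaBar.bdry z).p = .inl (vertexA g)) :
    ∃ ρ : GeodesicRay (SimpleGraph.mulCayley SA), z = pointA v₀ SB g ρ.limit ∧
      ∀ n, x n = g * (sideA A B).φ (ρ n) := by
  rcases z with (q | q) | η
  · obtain ⟨g', ρ, rfl, h1, -⟩ := h
    have hp' : vertexA g' = vertexA g := Sum.inl.inj hp
    obtain ⟨k, hk⟩ := vertexA_eq_iff.1 hp'
    have heq : Induced.mk Monoid.Coprod.inl g' ρ.limit =
        Induced.mk Monoid.Coprod.inl g (k⁻¹ • ρ).limit :=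
      Induced.mk_eq_mk_iff.2 ⟨k⁻¹, by rw [map_inv, hk]; group, rfl⟩
    refine ⟨k⁻¹ • ρ, by rw [heq]; rfl, fun n => ?_⟩
    rw [h1, GeodesicRay.smul_apply, smul_eq_mul, map_mul, map_inv,
      show (sideA A B).φ k = g'⁻¹ * g from hk]
    group
  · exact absurd (Sum.inl.inj hp) (by simp [vertexA])
  · cases hp

theorem Rep.exists_ray_of_p_eq_vertexB {x : ℕ → A ∗ B} {y : ℕ → TreeVertex A B}
    {z : DeltaGamma SA SB v₀} (h : Rep x y z) {g : A ∗ B}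
    (hp : (GammaBar.bdry z).p = .inl (vertexB g)) :
    ∃ ρ : GeodesicRay (SimpleGraph.mulCayley SB), z = pointB v₀ SA g ρ.limit ∧
      ∀ n, x n = g * (sideB A B).φ (ρ n) := by
  rcases z with (q | q) | η
  · exact absurd (Sum.inl.inj hp) (by simp [vertexB])
  · obtain ⟨g', ρ, rfl, h1, -⟩ := h
    have hp' : vertexB g' = vertexB g := Sum.inl.inj hp
    obtain ⟨k, hk⟩ := vertexB_eq_iff.1 hp'
    have heq : Induced.mk Monoid.Coprod.inr g' ρ.limit =
        Induced.mk Monoid.Coprod.inr g (k⁻¹ • ρ).limit :=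
      Induced.mk_eq_mk_iff.2 ⟨k⁻¹, by rw [map_inv, hk]; group, rfl⟩
    refine ⟨k⁻¹ • ρ, by rw [heq]; rfl, fun n => ?_⟩
    rw [h1, GeodesicRay.smul_apply, smul_eq_mul, map_mul, map_inv,
      show (sideB A B).φ k = g'⁻¹ * g from hk]
    group
  · cases hp

theorem bdry_pointA_mem_nhdA_iff (g : A ∗ B) (ξ : GromovBoundary (SimpleGraph.mulCayley SA))
    (U : Set (Bordification (SimpleGraph.mulCayley SA))) :
    GammaBar.bdry (pointA v₀ SB g ξ) ∈ nhdA SA SB v₀ g U ↔ .bdry ξ ∈ U := by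
  constructor
  · rintro (⟨a | ζ, hu, heq⟩ | ⟨hne, -⟩)
    · cases heq
    · have h1 := Induced.mk_right_injective Monoid.Coprod.inl_injective g
        (Sum.inl.inj (Sum.inl.inj (GammaBar.bdry.inj heq)))
      exact h1 ▸ hu
    · exact absurd rfl hne
  · exact fun h => Or.inl ⟨.bdry ξ, h, rfl⟩

theorem bdry_pointB_mem_nhdB_iff (g : A ∗ B) (ξ : GromovBoundary (SimpleGraph.mulCayley SB))
    (U : Set (Bordification (SimpleGraph.mulCayley SB))) :
    GammaBar.bdry (pointB v₀ SA g ξ) ∈ nhdB SA SB v₀ g U ↔ .bdry ξ ∈ U := by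
  constructor
  · rintro (⟨a | ζ, hu, heq⟩ | ⟨hne, -⟩)
    · cases heq
    · have h1 := Induced.mk_right_injective Monoid.Coprod.inr_injective g
        (Sum.inr.inj (Sum.inl.inj (GammaBar.bdry.inj heq)))
      exact h1 ▸ hu
    · exact absurd rfl hne
  · exact fun h => Or.inl ⟨.bdry ξ, h, rfl⟩

/-- The sets `V_{gU}` are the preimages of the sets `U` under the projection to the
compactification of the Cayley graph of `A`. -/
theorem Rep.exists_tendsTo_A (hA : Subgroup.closure SA = ⊤) {x : ℕ → A ∗ B}
    {y : ℕ → TreeVertex A B} {z : DeltaGamma SA SB v₀} (h : Rep x y z) (g : A ∗ B) :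
    ∃ b, TendsTo (SimpleGraph.mulCayley SA) (fun n => (sideA A B).π (g⁻¹ * x n)) b ∧
      ∀ U, GammaBar.bdry z ∈ nhdA SA SB v₀ g U ↔ b ∈ U := by
  -- A point lying over `g A` projects to its own boundary point, any other point to the vertex
  -- where the first edge towards it is attached.
  by_cases hp : (GammaBar.bdry z).p = .inl (vertexA g)
  · obtain ⟨ρ, rfl, hx⟩ := h.exists_ray_of_p_eq_vertexA hp
    refine ⟨.bdry ρ.limit, ?_, bdry_pointA_mem_nhdA_iff g _⟩
    simp only [hx, inv_mul_cancel_left, Side.π_φ]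
    exact ρ.convTo (mulCayley_connected hA)
  · obtain ⟨a, ha, ha'⟩ := h.exists_direction sideA_onTree hp
    refine ⟨.vertex a, ha, fun U => ⟨?_, fun hU => Or.inr ⟨hp, a, hU, (ha' a).2 rfl⟩⟩⟩
    rintro (⟨a | ζ, hu, heq⟩ | ⟨-, a', hU, ha''⟩)
    · cases heq
    · cases heq
      exact absurd rfl hp
    · rwa [(ha' a').1 ha'']

theorem Rep.exists_tendsTo_B (hB : Subgroup.closure SB = ⊤) {x : ℕ → A ∗ B}
    {y : ℕ → TreeVertex A B} {z : DeltaGamma SA SB v₀} (h : Rep x y z) (g : A ∗ B) :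
    ∃ b, TendsTo (SimpleGraph.mulCayley SB) (fun n => (sideB A B).π (g⁻¹ * x n)) b ∧
      ∀ U, GammaBar.bdry z ∈ nhdB SA SB v₀ g U ↔ b ∈ U := by
  by_cases hp : (GammaBar.bdry z).p = .inl (vertexB g)
  · obtain ⟨ρ, rfl, hx⟩ := h.exists_ray_of_p_eq_vertexB hp
    refine ⟨.bdry ρ.limit, ?_, bdry_pointB_mem_nhdB_iff g _⟩
    simp only [hx, inv_mul_cancel_left, Side.π_φ]
    exact ρ.convTo (mulCayley_connected hB)
  · obtain ⟨a, ha, ha'⟩ := h.exists_direction sideB_onTree hp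
    refine ⟨.vertex a, ha, fun U => ⟨?_, fun hU => Or.inr ⟨hp, a, hU, (ha' a).2 rfl⟩⟩⟩
    rintro (⟨a | ζ, hu, heq⟩ | ⟨-, a', hU, ha''⟩)
    · cases heq
    · cases heq
      exact absurd rfl hp
    · rwa [(ha' a').1 ha'']

theorem isOpen_deltaGamma_iff {W : Set (DeltaGamma SA SB v₀)} : IsOpen W ↔
    (∀ g ξ, pointA v₀ SB g ξ ∈ W → ∃ U, IsOpen U ∧ Bordification.bdry ξ ∈ U ∧
      ∀ z, GammaBar.bdry z ∈ nhdA SA SB v₀ g U → z ∈ W) ∧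
    (∀ g ξ, pointB v₀ SA g ξ ∈ W → ∃ U, IsOpen U ∧ Bordification.bdry ξ ∈ U ∧
      ∀ z, GammaBar.bdry z ∈ nhdB SA SB v₀ g U → z ∈ W) ∧
    ∀ η, pointEnd v₀ SA SB η ∈ W → ∃ n ≥ 1, ∀ z, GammaBar.bdry z ∈ nhdEnd SA SB v₀ η n → z ∈ W := by
  rw [isOpen_induced_iff]
  constructor
  · rintro ⟨W', ⟨h1, h2, h3⟩, rfl⟩
    refine ⟨fun g ξ h => ?_, fun g ξ h => ?_, fun η h => ?_⟩
    · obtain ⟨U, hU, hξ, hsub⟩ := h1 g ξ h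
      exact ⟨U, hU, hξ, fun z hz => hsub hz⟩
    · obtain ⟨U, hU, hξ, hsub⟩ := h2 g ξ h
      exact ⟨U, hU, hξ, fun z hz => hsub hz⟩
    · obtain ⟨n, hn, hsub⟩ := h3 η h
      exact ⟨n, hn, fun z hz => hsub hz⟩
  · rintro ⟨h1, h2, h3⟩
    -- The vertices of `Γ` are isolated and may all be added to `W`.
    refine ⟨{b | ∀ z, b = .bdry z → z ∈ W}, ⟨fun g ξ h => ?_, fun g ξ h => ?_, fun η h => ?_⟩, ?_⟩
    · obtain ⟨U, hU, hξ, hsub⟩ := h1 g ξ (h _ rfl)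
      refine ⟨U, hU, hξ, ?_⟩
      rintro b hb z rfl
      exact hsub z hb
    · obtain ⟨U, hU, hξ, hsub⟩ := h2 g ξ (h _ rfl)
      refine ⟨U, hU, hξ, ?_⟩
      rintro b hb z rfl
      exact hsub z hb
    · obtain ⟨n, hn, hsub⟩ := h3 η (h _ rfl)
      refine ⟨n, hn, ?_⟩
      rintro b hb z rfl
      exact hsub z hb
    · ext z
      constructor
      · exact fun h => h z rfl
      · rintro h z' heq
        cases heq
        exact h

end Comparison


/-! ### Limits of standard sequences: existence, injectivity, surjectivity. -/

section Homeomorphism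

variable {A : Type u} {B : Type v} [Group A] [Group B] {SA : Set A} {SB : Set B}
  {v₀ : TreeVertex A B} {H : Type w} [Group H]

/-- The boundary of a free factor in the boundary `δΓ`: the points `[g, ξ]` are given by `pt` and
their basic neighbourhoods by `nhd`. -/
structure Side.Boundary (s : Side A B H) (S : Set H)
    (pt : A ∗ B → GromovBoundary (SimpleGraph.mulCayley S) → DeltaGamma SA SB v₀)
    (nhd : A ∗ B → Set (Bordification (SimpleGraph.mulCayley S)) → Set (DeltaGamma SA SB v₀)) :
    Prop where
  metric : s.Metric S SA SB
  exists_rep : ∀ g (ρ : GeodesicRay (SimpleGraph.mulCayley S)),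
    ∃ y, Rep (fun n => g * s.φ (ρ n)) y (pt g ρ.limit)
  mem_iff : ∀ g ξ U, pt g ξ ∈ nhd g U ↔ .bdry ξ ∈ U
  eq_of_mem : ∀ g ξ z, z ∈ nhd g {.bdry ξ} → z = pt g ξ
  exists_tendsTo : ∀ {x y z}, Rep x y z → ∀ g, ∃ b,
    TendsTo (SimpleGraph.mulCayley S) (fun n => s.π (g⁻¹ * x n)) b ∧ ∀ U, z ∈ nhd g U ↔ b ∈ U

theorem sideA_boundary (hA : Subgroup.closure SA = ⊤) :
    (sideA A B).Boundary SA (pointA v₀ SB) fun g U => {z | .bdry z ∈ nhdA SA SB v₀ g U} where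
  metric := sideA_metric
  exists_rep g ρ := ⟨_, rep_pointA g ρ⟩
  mem_iff g ξ U := bdry_pointA_mem_nhdA_iff g ξ U
  eq_of_mem g ξ z := by
    rintro (⟨a | ζ, hu, heq⟩ | ⟨-, a, hu, -⟩)
    · cases hu
    · cases hu
      exact (GammaBar.bdry.inj heq).symm
    · cases hu
  exists_tendsTo h g := h.exists_tendsTo_A hA g

theorem sideB_boundary (hB : Subgroup.closure SB = ⊤) :
    (sideB A B).Boundary SB (pointB v₀ SA) fun g U => {z | .bdry z ∈ nhdB SA SB v₀ g U} where
  metric := sideB_metric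
  exists_rep g ρ := ⟨_, rep_pointB g ρ⟩
  mem_iff g ξ U := bdry_pointB_mem_nhdB_iff g ξ U
  eq_of_mem g ξ z := by
    rintro (⟨a | ζ, hu, heq⟩ | ⟨-, a, hu, -⟩)
    · cases hu
    · cases hu
      exact (GammaBar.bdry.inj heq).symm
    · cases hu
  exists_tendsTo h g := h.exists_tendsTo_B hB g

variable (hA : Subgroup.closure SA = ⊤) (hB : Subgroup.closure SB = ⊤)

theorem not_forall_evGe_const {V : Type*} {X : SimpleGraph V} (hX : X.Connected) {o a : V}
    {x y : ℕ → V} (hy : ∀ᶠ n in Filter.atTop, y n = a) : ¬ ∀ R, EvGe X o R x y := by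
  intro h
  obtain ⟨N, hN⟩ := h (X.dist o a + 1)
  obtain ⟨j, h1, h2⟩ := (hy.and (Filter.eventually_ge_atTop N)).exists
  have h3 := hN N le_rfl j h2
  rw [h1] at h3
  linarith [gromovProd_le_right hX o (x N) a]

include hA hB in
/-- The sequences converging to a point `[g, ξ]` of the boundary of a free factor. -/
theorem Side.Boundary.forall_evGe_iff {s : Side A B H} {S : Set H} {pt nhd}
    (hs : s.Boundary (SA := SA) (SB := SB) (v₀ := v₀) S pt nhd) {δ : ℝ}
    (h : FourPoint (SimpleGraph.mulCayley S) δ) {x y z} (hx : Rep x y z)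
    (g : A ∗ B) (ρ : GeodesicRay (SimpleGraph.mulCayley S)) :
    (∀ R, EvGe (coprodGraph SA SB) g R (fun n => g * s.φ (ρ n)) x) ↔ z = pt g ρ.limit := by
  simp only [hs.metric.evGe_iff hA hB]
  obtain ⟨b, hb, hmem⟩ := hs.exists_tendsTo hx g
  constructor
  · intro hall
    cases b with
    | vertex a => exact absurd hall (not_forall_evGe_const h.connected hb)
    | bdry ξ =>
      obtain rfl : ρ.limit = ξ := (ρ.convTo h.connected).eq_of_evGe h hb fun o R => by
        refine ((hall (R + (SimpleGraph.mulCayley S).dist 1 o)).base h.connected o).mono ?_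
        linarith
      -- The description of `nhd` holds for all sets, not only open ones; the singleton of the
      -- boundary point identifies `z`.
      exact hs.eq_of_mem g _ z ((hmem _).2 rfl)
  · rintro rfl R
    obtain rfl : .bdry ρ.limit = b := (hs.mem_iff g ρ.limit {b}).1 ((hmem {b}).2 rfl)
    exact (ρ.convTo h.connected).evGe h hb 1 R


include hA hB in
/-- Standard representatives of the same end have the same limit. -/
theorem Rep.evGe_pointEnd {x x' : ℕ → A ∗ B} {y y' : ℕ → TreeVertex A B} {η : Ends (tree A B)}
    (hx : Rep x y (pointEnd v₀ SA SB η)) (hx' : Rep x' y' (pointEnd v₀ SA SB η)) (o : A ∗ B)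
    (R : ℝ) : EvGe (coprodGraph SA SB) o R x x' := by
  obtain ⟨r, rfl, -, h1⟩ := hx
  obtain ⟨r', hr, -, h2⟩ := hx'
  obtain ⟨m, n, hmn⟩ := Quotient.exact hr
  have heq : ∀ k, x' (m + k) = x (n + k) := fun k => by
    have h3 := h2 (m + k)
    rw [hmn, add_assoc, hmn, ← add_assoc] at h3
    exact h3.unique (h1 (n + k))
  obtain ⟨l, hl⟩ := exists_rayWord h1
  obtain ⟨N, hN⟩ := hl.evGe_self hA hB o R
  refine ⟨m + N, fun i hi j hj => ?_⟩
  obtain ⟨k, rfl⟩ := Nat.exists_eq_add_of_le (show m ≤ j by omega)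
  rw [heq]
  exact hN i (by omega) _ (by omega)

variable {δA δB : ℝ} (hδA : FourPoint (SimpleGraph.mulCayley SA) δA)
  (hδB : FourPoint (SimpleGraph.mulCayley SB) δB)

include hA hB hδA hδB in
/-- Standard representatives of a point of `δΓ` have the same limit. -/
theorem Rep.evGe {x x' : ℕ → A ∗ B} {y y' : ℕ → TreeVertex A B} {z : DeltaGamma SA SB v₀}
    (hx : Rep x y z) (hx' : Rep x' y' z) (o : A ∗ B) (R : ℝ) :
    EvGe (coprodGraph SA SB) o R x x' := by
  have hX := coprodGraph_fourPoint hA hB hδA hδB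
  revert hx hx'
  refine deltaGamma_cases (P := fun z => Rep x y z → Rep x' y' z → _) ?_ ?_ ?_ z
  · intro g ρ hx hx'
    have h1 := ((sideA_boundary hA).forall_evGe_iff hA hB hδA hx g ρ).2 rfl
    have h2 := ((sideA_boundary hA).forall_evGe_iff hA hB hδA hx' g ρ).2 rfl
    have h3 := ((h1 (R + max δA δB + (coprodGraph SA SB).dist g o)).symm.trans hX (h2 _)).base
      hX.connected o
    exact h3.mono (by linarith)
  · intro g ρ hx hx'
    have h1 := ((sideB_boundary hB).forall_evGe_iff hA hB hδB hx g ρ).2 rfl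
    have h2 := ((sideB_boundary hB).forall_evGe_iff hA hB hδB hx' g ρ).2 rfl
    have h3 := ((h1 (R + max δA δB + (coprodGraph SA SB).dist g o)).symm.trans hX (h2 _)).base
      hX.connected o
    exact h3.mono (by linarith)
  · intro η hx hx'
    exact hx.evGe_pointEnd hA hB hx' o R

include hA hB in
theorem Side.Boundary.eq_of_evGe {s : Side A B H} {S : Set H} {pt nhd}
    (hs : s.Boundary (SA := SA) (SB := SB) (v₀ := v₀) S pt nhd) {δ δ' : ℝ}
    (h : FourPoint (SimpleGraph.mulCayley S) δ) (hX : FourPoint (coprodGraph SA SB) δ')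
    {x x' y y' z g} {ρ : GeodesicRay (SimpleGraph.mulCayley S)} (hx : Rep x y (pt g ρ.limit))
    (hx' : Rep x' y' z) (hxx' : ∀ o R, EvGe (coprodGraph SA SB) o R x x') :
    z = pt g ρ.limit := by
  refine (hs.forall_evGe_iff hA hB h hx' g ρ).1 fun R => ?_
  simpa using ((hs.forall_evGe_iff hA hB h hx g ρ).2 rfl (R + δ')).trans hX (hxx' g (R + δ'))

include hA hB in
-- A product larger than the length of an initial word of one ray forces the labels of the other to
-- share that word, hence the rays from `v₀` to share the corresponding vertices.
theorem end_eq_of_evGe {x x' : ℕ → A ∗ B} {y y' : ℕ → TreeVertex A B} {η η' : Ends (tree A B)}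
    {δ : ℝ} (hX : FourPoint (coprodGraph SA SB) δ) (hx : Rep x y (pointEnd v₀ SA SB η))
    (hx' : Rep x' y' (pointEnd v₀ SA SB η'))
    (hxx' : ∀ o R, EvGe (coprodGraph SA SB) o R x x') : η = η' := by
  obtain ⟨r, h0, rfl⟩ := exists_ray_from_vertex v₀ η
  obtain ⟨r', h0', rfl⟩ := exists_ray_from_vertex v₀ η'
  obtain ⟨e, he⟩ := exists_edge_label r
  obtain ⟨e', he'⟩ := exists_edge_label r'
  obtain ⟨l, hl⟩ := exists_rayWord he
  have hee' : ∀ o R, EvGe (coprodGraph SA SB) o R e e' := fun o R => by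
    have h1 := ((rep_pointEnd he).evGe_pointEnd hA hB hx o (R + 2 * δ)).trans hX
      (hxx' o (R + 2 * δ))
    have h2 := h1.trans hX ((hx'.evGe_pointEnd hA hB (rep_pointEnd he') o (R + 2 * δ - δ)))
    exact h2.mono (by linarith)
  refine congrArg _ (ray_ext (h0.trans h0'.symm) fun n => ?_)
  obtain ⟨N, hN⟩ := hee' (e 0) (wordLength SA SB (initWord l n) + 1)
  refine ⟨r' (N + n), ?_, ?_⟩
  · refine hl.onGeodesic_of_prefix (he' (N + n)).isEnd_left
      (hl.prefix_of_lt_gromovProd hA hB (show n ≤ N + n by omega) ?_)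
    linarith [hN (N + n) (by omega) (N + n) (by omega)]
  · have h1 := r'.dist_eq (Nat.zero_le n)
    have h2 := r'.dist_eq (show n ≤ N + n by omega)
    have h3 := r'.dist_eq (Nat.zero_le (N + n))
    change _ + _ = _
    omega

include hA hB hδA hδB in
-- As soon as one point lies over a vertex, the convergence criterion for that vertex identifies the
-- other; only two ends need a comparison of rays.
theorem eq_of_rep_of_evGe {x x' : ℕ → A ∗ B} {y y' : ℕ → TreeVertex A B}
    {z z' : DeltaGamma SA SB v₀} (hx : Rep x y z) (hx' : Rep x' y' z')
    (hxx' : ∀ o R, EvGe (coprodGraph SA SB) o R x x') : z = z' := by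
  have hX := coprodGraph_fourPoint hA hB hδA hδB
  have hA' : ∀ {x x' : ℕ → A ∗ B} {y y' : ℕ → TreeVertex A B} (g)
      (ρ : GeodesicRay (SimpleGraph.mulCayley SA)) {z : DeltaGamma SA SB v₀},
      Rep x y (pointA v₀ SB g ρ.limit) → Rep x' y' z →
      (∀ o R, EvGe (coprodGraph SA SB) o R x x') → z = pointA v₀ SB g ρ.limit :=
    fun g ρ => (sideA_boundary hA).eq_of_evGe hA hB hδA hX
  have hB' : ∀ {x x' : ℕ → A ∗ B} {y y' : ℕ → TreeVertex A B} (g)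
      (ρ : GeodesicRay (SimpleGraph.mulCayley SB)) {z : DeltaGamma SA SB v₀},
      Rep x y (pointB v₀ SA g ρ.limit) → Rep x' y' z →
      (∀ o R, EvGe (coprodGraph SA SB) o R x x') → z = pointB v₀ SA g ρ.limit :=
    fun g ρ => (sideB_boundary hB).eq_of_evGe hA hB hδB hX
  revert hx
  refine deltaGamma_cases (P := fun z => Rep x y z → z = z')
    (fun g ρ hx => (hA' g ρ hx hx' hxx').symm) (fun g ρ hx => (hB' g ρ hx hx' hxx').symm)
    (fun η hx => ?_) z
  revert hx'
  refine deltaGamma_cases (P := fun z => Rep x' y' z → _ = z)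
    (fun g ρ hx' => hA' g ρ hx' hx fun o R => (hxx' o R).symm)
    (fun g ρ hx' => hB' g ρ hx' hx fun o R => (hxx' o R).symm) (fun η' hx' => ?_) z'
  exact congrArg _ (end_eq_of_evGe hA hB hX hx hx' hxx')

include hA hB in
/-- A sequence whose normal forms follow more and more of an infinite reduced word converges to an
end of the tree. -/
theorem exists_rep_of_extend {x : ℕ → A ∗ B}
    (hext : ∀ w, (∀ᶠ j in Filter.atTop, w <+: nf (x j)) →
      ∃ t, ∀ᶠ j in Filter.atTop, w ++ [t] <+: nf (x j)) :
    ∃ (z : DeltaGamma SA SB v₀) (x' : ℕ → A ∗ B) (y' : ℕ → TreeVertex A B), Rep x' y' z ∧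
      ∀ o R, EvGe (coprodGraph SA SB) o R x' x := by
  choose t ht using hext
  -- Starting from the empty word, eventual common prefixes are extended one letter at a time, which
  -- yields an infinite reduced word.
  let W : ℕ → {w // ∀ᶠ j in Filter.atTop, w <+: nf (x j)} := fun n => Nat.rec
    ⟨[], Filter.Eventually.of_forall fun _ => List.nil_prefix⟩
    (fun _ w => ⟨w.1 ++ [t w.1 w.2], ht w.1 w.2⟩) n
  let l : ℕ → A ⊕ B := fun n => t (W n).1 (W n).2
  have hW : ∀ n, initWord l n = (W n).1 := by
    intro n
    induction n with
    | zero => rfl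
    | succ n ih => rw [initWord_succ, ih]
  have hpre : ∀ n, ∀ᶠ j in Filter.atTop, initWord l n <+: nf (x j) := fun n =>
    (hW n) ▸ (W n).2
  have hred : ∀ n, Red (initWord l n) := by
    intro n
    obtain ⟨j, m, hm⟩ := (hpre n).exists
    have := red_nf (x j)
    rw [← hm] at this
    exact (red_append.1 this).1
  have hne : ∀ n, letter (l n) ≠ 1 := fun n => (hred (n + 1)).1 _ (by rw [initWord_succ]; simp)
  have halt : ∀ n, (l n).isLeft ≠ (l (n + 1)).isLeft := fun n => by
    have h1 := hred (n + 1 + 1)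
    rw [initWord_succ] at h1
    exact (red_append.1 h1).2.2 _ (getLast?_initWord_succ l n) _ rfl
  obtain ⟨r, hr⟩ := exists_ray_of_letters hne halt
  refine ⟨_, _, _, rep_pointEnd hr, fun o R => ?_⟩
  have hcA := mulCayley_connected hA
  have hcB := mulCayley_connected hB
  obtain ⟨n, hn⟩ := exists_nat_ge (R + (coprodGraph SA SB).dist 1 o)
  obtain ⟨N, hN⟩ := Filter.eventually_atTop.1 (hpre n)
  have h1 : EvGe (coprodGraph SA SB) 1 n (fun n => spell (initWord l n)) x := by
    refine ⟨max n N, fun i hi j hj => ?_⟩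
    rw [gromovProd_one_eq hA hB, nf_spell (hred i)]
    refine le_trans ?_ (wordLength_le_wordProd hcA hcB
      (initWord_prefix l (le_of_max_le_left hi)) (hN j (le_of_max_le_right hj)))
    have := length_le_wordLength hcA hcB (hred n).1
    rw [initWord, List.length_map, List.length_range] at this
    exact_mod_cast this
  exact (h1.base (coprodGraph_connected hA hB) o).mono (by linarith)

include hA hB in
/-- A sequence whose normal forms have a longest common prefix converges to a point of the boundary
of a translate of a free factor. -/
theorem Side.Boundary.exists_rep_of_maximal {s : Side A B H} {S : Set H} {pt nhd}
    (hs : s.Boundary (SA := SA) (SB := SB) (v₀ := v₀) S pt nhd) {δ : ℝ}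
    (h : FourPoint (SimpleGraph.mulCayley S) δ) (hfin : ProperGraph (SimpleGraph.mulCayley S))
    {x : ℕ → A ∗ B} {g : A ∗ B} (hx : ∀ R, EvGe (coprodGraph SA SB) g R x x)
    (hhead : ∀ᶠ j in Filter.atTop, ∃ a m, nf (g⁻¹ * x j) = s.ι a :: m)
    (hmax : ∀ a, ∃ᶠ j in Filter.atTop, s.π (g⁻¹ * x j) ≠ a) :
    ∃ (z : DeltaGamma SA SB v₀) (x' : ℕ → A ∗ B) (y' : ℕ → TreeVertex A B), Rep x' y' z ∧
      ∀ o R, EvGe (coprodGraph SA SB) o R x' x := by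
  obtain ⟨N₀, hN₀⟩ := Filter.eventually_atTop.1 hhead
  have hX := coprodGraph_connected hA hB
  have key : ∀ R, EvGe (SimpleGraph.mulCayley S) 1 R (fun j => s.π (g⁻¹ * x j))
      (fun j => s.π (g⁻¹ * x j)) := by
    intro R
    obtain ⟨N, hN⟩ := hx R
    -- When the first letters differ, the product in the free product is exactly the product of
    -- these letters in the factor.
    have hdiff : ∀ i ≥ max N₀ N, ∀ j ≥ max N₀ N, s.π (g⁻¹ * x i) ≠ s.π (g⁻¹ * x j) →
        R ≤ gromovProd (SimpleGraph.mulCayley S) 1 (s.π (g⁻¹ * x i)) (s.π (g⁻¹ * x j)) := by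
      intro i hi j hj hne
      obtain ⟨a, m, ham⟩ := hN₀ i (le_of_max_le_left hi)
      obtain ⟨a', m', ham'⟩ := hN₀ j (le_of_max_le_left hj)
      have h1 := hN i (le_of_max_le_right hi) j (le_of_max_le_right hj)
      have h2 : s.π (g⁻¹ * x i) = a := by rw [Side.π, ham]; exact s.get_ι a
      have h3 : s.π (g⁻¹ * x j) = a' := by rw [Side.π, ham']; exact s.get_ι a'
      rw [h2, h3] at hne ⊢
      rwa [gromovProd_eq hA hB, ham, ham',
        wordProd_cons_of_ne fun h4 => hne (by rw [← s.get_ι a, h4, s.get_ι]),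
        hs.metric.letterProd_ι] at h1
    refine ⟨max N₀ N, fun i hi j hj => ?_⟩
    by_cases hij : s.π (g⁻¹ * x i) = s.π (g⁻¹ * x j)
    -- For equal letters the product is their length. A third, different letter exists by `hmax`,
    -- and its large product with this letter forces the letter to be long.
    · obtain ⟨k, hk, hk'⟩ := ((hmax (s.π (g⁻¹ * x i))).and_eventually
        (Filter.eventually_ge_atTop (max N₀ N))).exists
      have h1 := hdiff i hi k hk' (Ne.symm hk)
      have h2 := gromovProd_le_left h.connected 1 (s.π (g⁻¹ * x i)) (s.π (g⁻¹ * x k))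
      dsimp only
      rw [← hij, gromovProd_self]
      exact h1.trans h2
    · exact hdiff i hi j hj hij
  obtain ⟨ρ, -, hρ⟩ := h.exists_convTo_ray hfin 1 key
  obtain ⟨y', hy'⟩ := hs.exists_rep g ρ
  refine ⟨_, _, y', hy', fun o R => ?_⟩
  have h1 := (hs.metric.evGe_iff hA hB g (R + (coprodGraph SA SB).dist g o) ρ x).2
    ((ρ.convTo h.connected).evGe h hρ 1 _)
  exact (h1.base hX o).mono (by linarith)

include hA hB hδA hδB in
/-- Every point of the boundary of the free product comes from a point of `δΓ`. -/
theorem exists_rep_evGe (hfA : ProperGraph (SimpleGraph.mulCayley SA))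
    (hfB : ProperGraph (SimpleGraph.mulCayley SB)) {x : ℕ → A ∗ B}
    (hx : ∀ o R, EvGe (coprodGraph SA SB) o R x x) :
    ∃ (z : DeltaGamma SA SB v₀) (x' : ℕ → A ∗ B) (y' : ℕ → TreeVertex A B), Rep x' y' z ∧
      ∀ o R, EvGe (coprodGraph SA SB) o R x' x := by
  by_cases hext : ∀ w, (∀ᶠ j in Filter.atTop, w <+: nf (x j)) →
      ∃ t, ∀ᶠ j in Filter.atTop, w ++ [t] <+: nf (x j)
  · exact exists_rep_of_extend hA hB hext
  push Not at hext
  obtain ⟨w, hw, hmax⟩ := hext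
  have hsplit : ∀ j, w <+: nf (x j) → nf (x j) = w ++ nf ((spell w)⁻¹ * x j) := by
    rintro j ⟨m, hm⟩
    have hred := red_nf (x j)
    rw [← hm] at hred
    have h1 : nf ((spell w)⁻¹ * x j) = m := nf_eq_of_spell_eq (red_append.1 hred).2.1 (by
      rw [← spell_nf (x j), ← hm, spell_append, inv_mul_cancel_left])
    rw [h1, hm]
  -- Products at least `1`, seen from the end of `w`, already show that the remainders are nonempty
  -- and start in the same factor, since otherwise the product would vanish.
  obtain ⟨N, hN⟩ := hx (spell w) 1
  have hcons : ∀ j ≥ N, ∃ t m, nf ((spell w)⁻¹ * x j) = t :: m := by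
    intro j hj
    refine List.exists_cons_of_ne_nil fun h0 => ?_
    have h1 := hN j hj j hj
    rw [gromovProd_eq hA hB, h0, wordProd_nil_left] at h1
    linarith
  obtain ⟨t₀, m₀, h₀⟩ := hcons N le_rfl
  have hside : ∀ j ≥ N, ∀ t m, nf ((spell w)⁻¹ * x j) = t :: m → t.isLeft = t₀.isLeft := by
    intro j hj t m htm
    by_contra hne
    have h1 := hN j hj N le_rfl
    rw [gromovProd_eq hA hB, htm, h₀, wordProd_cons_of_ne fun h2 => hne (by rw [h2]),
      letterProd_of_ne hne] at h1
    linarith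
  have hmax' : ∀ t, ∃ᶠ j in Filter.atTop, ¬ [t] <+: nf ((spell w)⁻¹ * x j) := by
    intro t hev
    refine hmax t ?_
    filter_upwards [hev, hw] with j h1 h2
    rw [not_not] at h1
    rw [hsplit j h2]
    exact not_not.2 ((List.prefix_append_right_inj w).2 h1)
  rcases hb : t₀.isLeft with _ | _
  · have hhead : ∀ j ≥ N, ∃ a m, nf ((spell w)⁻¹ * x j) = (sideB A B).ι a :: m := fun j hj => by
      obtain ⟨t, m, htm⟩ := hcons j hj
      exact ⟨(sideB A B).get t, m, by
        rw [(sideB A B).ι_get t ((hside j hj t m htm).trans hb), htm]⟩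
    refine (sideB_boundary hB).exists_rep_of_maximal hA hB hδB hfB (hx (spell w))
      (Filter.eventually_atTop.2 ⟨N, hhead⟩) fun a => ?_
    refine ((hmax' ((sideB A B).ι a)).and_eventually (Filter.eventually_ge_atTop N)).mono ?_
    rintro j ⟨h1, h2⟩ rfl
    obtain ⟨a', m, ham⟩ := hhead j h2
    rw [Side.π, ham] at h1
    exact h1 ⟨m, by rw [Side.head, (sideB A B).get_ι]; rfl⟩
  · have hhead : ∀ j ≥ N, ∃ a m, nf ((spell w)⁻¹ * x j) = (sideA A B).ι a :: m := fun j hj => by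
      obtain ⟨t, m, htm⟩ := hcons j hj
      exact ⟨(sideA A B).get t, m, by
        rw [(sideA A B).ι_get t ((hside j hj t m htm).trans hb), htm]⟩
    refine (sideA_boundary hA).exists_rep_of_maximal hA hB hδA hfA (hx (spell w))
      (Filter.eventually_atTop.2 ⟨N, hhead⟩) fun a => ?_
    refine ((hmax' ((sideA A B).ι a)).and_eventually (Filter.eventually_ge_atTop N)).mono ?_
    rintro j ⟨h1, h2⟩ rfl
    obtain ⟨a', m, ham⟩ := hhead j h2
    rw [Side.π, ham] at h1
    exact h1 ⟨m, by rw [Side.head, (sideA A B).get_ι]; rfl⟩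

end Homeomorphism


/-! ### The limit map is an equivariant homeomorphism. -/

section Homeomorphism

variable {A : Type u} {B : Type v} [Group A] [Group B] {SA : Set A} {SB : Set B}
  {v₀ : TreeVertex A B} {H : Type w} [Group H]

/-- The map `f` sends each point of `δΓ` to the limit of its standard representatives, and every
boundary point is such a limit. -/
structure IsLimitMap (f : DeltaGamma SA SB v₀ → GromovBoundary (coprodGraph SA SB)) : Prop where
  convTo : ∀ {x y z}, Rep x y z → ConvTo (coprodGraph SA SB) x (f z)
  bijective : Function.Bijective f

theorem exists_isLimitMap (hA : Subgroup.closure SA = ⊤) (hB : Subgroup.closure SB = ⊤)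
    {δA δB : ℝ} (hδA : FourPoint (SimpleGraph.mulCayley SA) δA)
    (hδB : FourPoint (SimpleGraph.mulCayley SB) δB)
    (hfA : ProperGraph (SimpleGraph.mulCayley SA)) (hfB : ProperGraph (SimpleGraph.mulCayley SB))
    (hf : ProperGraph (coprodGraph SA SB)) :
    ∃ f : DeltaGamma SA SB v₀ → GromovBoundary (coprodGraph SA SB), IsLimitMap f := by
  have hX := coprodGraph_fourPoint hA hB hδA hδB
  have hex : ∀ z : DeltaGamma SA SB v₀, ∃ ξ, ∀ x y, Rep x y z →
      ConvTo (coprodGraph SA SB) x ξ := by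
    intro z
    obtain ⟨x, y, hx⟩ := exists_rep z
    obtain ⟨ρ, -, hρ⟩ := hX.exists_convTo_ray hf 1 fun R => hx.evGe hA hB hδA hδB hx 1 R
    exact ⟨ρ.limit, fun x' y' hx' => hρ.trans hX (hx'.evGe hA hB hδA hδB hx)⟩
  choose f hconv using hex
  refine ⟨f, fun h => hconv _ _ _ h, fun z z' hzz' => ?_, fun ξ => ?_⟩
  · obtain ⟨x, y, hx⟩ := exists_rep z
    obtain ⟨x', y', hx'⟩ := exists_rep z'
    exact eq_of_rep_of_evGe hA hB hδA hδB hx hx'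
      ((hconv _ _ _ hx).evGe hX (hzz' ▸ hconv _ _ _ hx'))
  · obtain ⟨x, hx⟩ := ξ.exists_convTo hX.connected
    obtain ⟨z, x', y', hx', hev⟩ := exists_rep_evGe (v₀ := v₀) hA hB hδA hδB hfA hfB (hx.evGe hX hx)
    exact ⟨z, (hconv _ _ _ hx').eq_of_evGe hX hx hev⟩

variable {f : DeltaGamma SA SB v₀ → GromovBoundary (coprodGraph SA SB)} (hf : IsLimitMap f)
  {δ : ℝ} (hX : FourPoint (coprodGraph SA SB) δ)

include hf hX in
theorem IsLimitMap.map_smul (g : A ∗ B) (z : DeltaGamma SA SB v₀) : f (g • z) = g • f z := by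
  obtain ⟨x, y, hx⟩ := exists_rep z
  exact (hf.convTo (hx.smul g)).unique hX ((hf.convTo hx).smul g)

variable (hA : Subgroup.closure SA = ⊤) (hB : Subgroup.closure SB = ⊤)

include hf hX hA hB in
-- Gromov products at `g` with the sequence `g φ(ρ n)` are products in the factor with the projected
-- sequence, and `nhd g U` is the preimage of `U` under the projection. So both neighbourhood
-- systems measure the same quantity, up to `2 δ` and `2 δ'`.
theorem IsLimitMap.mem_nhds_iff {s : Side A B H} {S : Set H} {pt nhd}
    (hs : s.Boundary (SA := SA) (SB := SB) (v₀ := v₀) S pt nhd) {δ' : ℝ}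
    (h : FourPoint (SimpleGraph.mulCayley S) δ') (g : A ∗ B)
    (ξ : GromovBoundary (SimpleGraph.mulCayley S)) {O : Set (GromovBoundary (coprodGraph SA SB))} :
    O ∈ nhds (f (pt g ξ)) ↔
      ∃ U, IsOpen U ∧ Bordification.bdry ξ ∈ U ∧ ∀ z, z ∈ nhd g U → f z ∈ O := by
  obtain ⟨ρ, rfl⟩ : ∃ ρ : GeodesicRay (SimpleGraph.mulCayley S), ρ.limit = ξ :=
    Quotient.exists_rep ξ
  obtain ⟨y₀, hρ⟩ := hs.exists_rep g ρ
  rw [hX.mem_nhds_boundary_iff g]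
  constructor
  · rintro ⟨R, hR⟩
    obtain ⟨U, hU, hξ, hsub⟩ :=
      h.exists_isOpen_subset_gromovNhd 1 ρ.limit (R + 2 * δ + 2 * δ')
    refine ⟨U, hU, hξ, fun z hz => hR _ ?_⟩
    obtain ⟨x, y, hx⟩ := exists_rep z
    obtain ⟨b, hb, hmem⟩ := hs.exists_tendsTo hx g
    have h1 := h.evGe_of_mem_gromovNhd (ρ.convTo h.connected) hb (hsub ((hmem U).1 hz))
    rw [add_sub_cancel_right] at h1
    exact hX.mem_gromovNhd (z := .bdry _) (hf.convTo hρ) (hf.convTo hx)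
      ((hs.metric.evGe_iff hA hB g _ ρ x).2 h1)
  · rintro ⟨U, hU, hξ, hsub⟩
    obtain ⟨R, hR⟩ := hU _ hξ 1
    refine ⟨R + 2 * δ' + 2 * δ, fun η hη => ?_⟩
    obtain ⟨z, rfl⟩ := hf.bijective.2 η
    obtain ⟨x, y, hx⟩ := exists_rep z
    obtain ⟨b, hb, hmem⟩ := hs.exists_tendsTo hx g
    have h1 := hX.evGe_of_mem_gromovNhd (z := .bdry _) (hf.convTo hρ) (hf.convTo hx) hη
    rw [add_sub_cancel_right, hs.metric.evGe_iff hA hB] at h1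
    exact hsub z ((hmem U).2 (hR (h.mem_gromovNhd (ρ.convTo h.connected) hb h1)))

include hf hX hA hB in
theorem IsLimitMap.mem_nhds_pointEnd_iff (η : Ends (tree A B))
    {O : Set (GromovBoundary (coprodGraph SA SB))} :
    O ∈ nhds (f (pointEnd v₀ SA SB η)) ↔
      ∃ n ≥ 1, ∀ z, GammaBar.bdry z ∈ nhdEnd SA SB v₀ η n → f z ∈ O := by
  obtain ⟨r, h0, rfl⟩ := exists_ray_from_vertex v₀ η
  obtain ⟨e, he⟩ := exists_edge_label r
  obtain ⟨l, hl⟩ := exists_rayWord he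
  have hrep : Rep e r (pointEnd v₀ SA SB r.end') := rep_pointEnd he
  rw [hX.mem_nhds_boundary_iff (e 0)]
  constructor
  · rintro ⟨R, hR⟩
    obtain ⟨n, hn⟩ := exists_nat_ge (R + 2 * δ)
    -- Passing through `r (n + 1)` guarantees `n` common letters, each of length at least one, hence
    -- a product of at least `n`.
    refine ⟨n + 1, by omega, fun z hz => hR _ ?_⟩
    obtain ⟨r', h0', hr', hgeod, -⟩ := hz
    obtain rfl : r' = r := ray_unique (h0'.trans h0.symm) hr'
    obtain ⟨x, y, hx⟩ := exists_rep z
    have h1 := hgeod (n + 1) le_rfl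
    rw [hx.onGeodesic_iff, ← h0] at h1
    obtain ⟨N, hN⟩ := Filter.eventually_atTop.1 h1
    refine hX.mem_gromovNhd (z := .bdry _) (hf.convTo hrep) (hf.convTo hx)
      (EvGe.mono (R := n) ⟨max n N, fun i hi j hj => ?_⟩ hn)
    exact hl.le_gromovProd hA hB (le_of_max_le_left hi)
      (hl.prefix_of_onGeodesic (hx.isEnd j).1 (hN j (le_of_max_le_right hj)))
  · rintro ⟨n, -, hsub⟩
    -- The summand `1` makes the product strictly exceed the length of the word, so `n + 1` letters
    -- are shared. The extra letter carries the geodesic beyond `r n`, as the definition of `V_n`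
    -- demands.
    refine ⟨wordLength SA SB (initWord l (n + 1)) + 1 + 2 * δ, fun ζ hζ => ?_⟩
    obtain ⟨z, rfl⟩ := hf.bijective.2 ζ
    obtain ⟨x, y, hx⟩ := exists_rep z
    obtain ⟨N, hN⟩ := hX.evGe_of_mem_gromovNhd (z := .bdry _) (hf.convTo hrep) (hf.convTo hx) hζ
    rw [add_sub_cancel_right] at hN
    have hgeod : ∀ᶠ j in Filter.atTop, OnGeodesic (r 0) (.inl (y j)) (r (n + 1)) := by
      filter_upwards [Filter.eventually_ge_atTop N] with j hj
      refine hl.onGeodesic_of_prefix (hx.isEnd j).1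
        (hl.prefix_of_lt_gromovProd hA hB (show n + 1 ≤ N + n + 1 by omega) ?_)
      linarith [hN (N + n + 1) (by omega) j hj]
    refine hsub z ⟨r, h0, rfl, fun i hi => ?_, fun hp => ?_⟩
    · rw [hx.onGeodesic_iff, ← h0]
      exact hgeod.mono fun j hj => (onGeodesic_ray (by omega) hj).2
    · have hy := ((hx.eq_or_ne (r n)).resolve_right fun h' => h'.1 hp).2
      obtain ⟨j, hj⟩ := hgeod.exists
      exact onGeodesic_ray_ne (Nat.lt_succ_self n) hj (hy j)

/-- The boundary `δΓ` is equivariantly homeomorphic to the boundary of the Cayley graph of the free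
product. -/
theorem exists_homeomorph_boundary (hA : Subgroup.closure SA = ⊤) (hB : Subgroup.closure SB = ⊤)
    {δA δB : ℝ} (hδA : FourPoint (SimpleGraph.mulCayley SA) δA)
    (hδB : FourPoint (SimpleGraph.mulCayley SB) δB)
    (hfA : ProperGraph (SimpleGraph.mulCayley SA)) (hfB : ProperGraph (SimpleGraph.mulCayley SB))
    (hfX : ProperGraph (coprodGraph SA SB)) :
    ∃ h : DeltaGamma SA SB v₀ ≃ₜ GromovBoundary (coprodGraph SA SB),
      ∀ (g : A ∗ B) (z : DeltaGamma SA SB v₀), h (g • z) = g • h z := by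
  have hX := coprodGraph_fourPoint hA hB hδA hδB
  obtain ⟨f, hf⟩ := exists_isLimitMap (v₀ := v₀) hA hB hδA hδB hfA hfB hfX
  refine ⟨(Equiv.ofBijective f hf.bijective).toHomeomorph fun O => ?_, hf.map_smul hX⟩
  -- Openness on both sides is tested pointwise by the same three conditions, so it is not necessary
  -- to show that the sets `V_{gU}` and `V_n` are themselves neighbourhoods.
  rw [isOpen_deltaGamma_iff, isOpen_iff_mem_nhds]
  constructor
  · rintro ⟨h1, h2, h3⟩ ζ hζ
    obtain ⟨z, rfl⟩ := hf.bijective.2 ζ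
    revert hζ
    refine deltaGamma_cases (P := fun z => f z ∈ O → O ∈ nhds (f z)) (fun g ρ hz => ?_)
      (fun g ρ hz => ?_) (fun η hz => ?_) z
    · exact (hf.mem_nhds_iff hX hA hB (sideA_boundary hA) hδA g _).2 (h1 g _ hz)
    · exact (hf.mem_nhds_iff hX hA hB (sideB_boundary hB) hδB g _).2 (h2 g _ hz)
    · exact (hf.mem_nhds_pointEnd_iff hX hA hB η).2 (h3 η hz)
  · intro hO
    exact ⟨fun g ξ hz =>
        (hf.mem_nhds_iff hX hA hB (sideA_boundary hA) hδA g _).1 (hO _ hz),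
      fun g ξ hz => (hf.mem_nhds_iff hX hA hB (sideB_boundary hB) hδB g _).1 (hO _ hz),
      fun η hz => (hf.mem_nhds_pointEnd_iff hX hA hB η).1 (hO _ hz)⟩

end Homeomorphism

end FreeProd
end

/-! ### The theorem, for arbitrary finite generating sets of the free product. -/

theorem proposition3p1 {A B : Type*} [Group A] [Group B]
    (hA : FreeProd.IsHyperbolicGroup A) (hB : FreeProd.IsHyperbolicGroup B)
    (SA : Set A) (hSA : SA.Finite) (hSA' : Subgroup.closure SA = ⊤)
    (SB : Set B) (hSB : SB.Finite) (hSB' : Subgroup.closure SB = ⊤)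
    (v₀ : FreeProd.TreeVertex A B) :
    CompactSpace (FreeProd.DeltaGamma SA SB v₀) ∧
    TopologicalSpace.MetrizableSpace (FreeProd.DeltaGamma SA SB v₀) ∧
    FreeProd.IsHyperbolicGroup (A ∗ B) ∧
    ∀ S : Set (A ∗ B), S.Finite → Subgroup.closure S = ⊤ →
      ∃ h : FreeProd.DeltaGamma SA SB v₀ ≃ₜ
          FreeProd.GromovBoundary (SimpleGraph.mulCayley S),
        ∀ (g : A ∗ B) (z : FreeProd.DeltaGamma SA SB v₀), h (g • z) = g • h z := by
  obtain ⟨δA, hδA⟩ := hA.fourPoint hSA hSA'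
  obtain ⟨δB, hδB⟩ := hB.fourPoint hSB hSB'
  have hX := FreeProd.coprodGraph_fourPoint hSA' hSB' hδA hδB
  have hfin := FreeProd.coprodGen_finite hSA hSB
  have hgen := FreeProd.closure_coprodGen hSA' hSB'
  have hfX := FreeProd.mulCayley_proper hfin hgen
  have hG : FreeProd.IsHyperbolicGroup (A ∗ B) := ⟨_, hfin, hgen, hX.isHyperbolicGraph⟩
  obtain ⟨f, hf⟩ := FreeProd.exists_homeomorph_boundary (v₀ := v₀) hSA' hSB' hδA hδB
    (FreeProd.mulCayley_proper hSA hSA') (FreeProd.mulCayley_proper hSB hSB') hfX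
  have := hX.compactSpace hfX
  have := hX.metrizableSpace
  refine ⟨f.symm.compactSpace, f.isEmbedding.metrizableSpace, hG, fun S hS hS' => ?_⟩
  obtain ⟨k, hk⟩ := hG.exists_homeomorph hfin hgen hS hS'
  exact ⟨f.trans k, fun g z => by simp [hf, hk]⟩
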